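/- **Setting.** Let $M$ be a smooth ($C^\infty$, Hausdorff, without boundary) manifold of dimension $n$. Let $q$ assign to every smooth Riemannian metric $g$ on $M$ a $(0,2)$-tensor field $q(g)$ on $M$ which is natural, $q(\varphi^*g)=\varphi^*q(g)$ for all diffeomorphisms $\varphi$ of $M$, and which scales by $q(\lambda g)=\lambda^{w/2}q(g)$ for all constants $\lambda>0$, where $w\in\mathbb R$ is fixed. The $q$-flow with initial metric $h$ is $\partial_t g_t=q(g_t)$, $g_0=h$. A complete gradient $q$-soliton $(M,h,f_0,c)$ consists of a smooth metric $h$, a smooth function $f_0$ and $c\in\mathbb R$ with $$\mathrm{Hess}_h f_0=c\,h+\tfrac12 q(h),$$ such that $\nabla_h f_0$ is a complete vector field. (Completeness of the metric $h$ is then not needed.) **Theorem.** Let $(M,h,f_0,c)$ be a complete gradient $q$-soliton. Put $$\tau_t=\begin{cases}e^{-2ct}, & w=2,\\ \bigl(1-2c(1-\tfrac w2)t\bigr)^{1/(1-w/2)}, & w\ne 2,\end{cases}\qquad J=\{t\in\mathbb R:\ 1-2c(1-\tfrac w2)t>0\}$$ (so $J=\mathbb R$ if $w=2$). Then $(-\varepsilon,\varepsilon)\subseteq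 J$ for some $\varepsilon>0$, and there are smooth metrics $g_t$, diffeomorphisms $\phi_t$ of $M$ and functions $f_t$ with $g_0=h$, $\phi_0=\mathrm{id}_M$ and $f_0$ as given, such that $(t,x)\mapsto\phi_t(x)$ is smooth on $J\times M$ and for all $t\in J$: 1. $\tau_t>0$, and $\frac{\partial}{\partial t}\phi_t(x)=\tau_t^{w/2-1}(\nabla_hf_0)(\phi_t(x))$ for all $x\in M$, i.e. $\phi_t$ is generated by $X_t=\tau_t^{w/2-1}\nabla_hf_0$; 2. $g_t=\tau_t\,\phi_t^*h$ and $f_t=f_0\circ\phi_t$; 3. $\partial_t g_t=q(g_t)$, so $g_t$ is a solution of the $q$-flow; 4. $\mathrm{Hess}_{g_t}f_t=\frac{c}{\tau_t}g_t+\frac12\tau_t^{-w/2}q(g_t)$, equivalently $q(g_t)=\tau_t^{w/2}\bigl(-\frac{2c}{\tau_t}g_t+2\,\mathrm{Hess}_{g_t}f_t\bigr)$; 5. $\frac{\partial f_t}{\partial t}=\tau_t^{w/2}\,|\nabla_{g_t}f_t|_{g_t}^2$. **Corollary.** Let $n\ge4$ be even, and let $$q(g)=\mathcal O_n(g)+c_n(-1)^{n/2}\bigl(\Delta^{n/2-1}S\bigr)g,\qquad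 c_n=\frac{1}{2^{n/2-2}\,(\frac n2-2)!\,(n-2)(n-1)},$$ be the right-hand side of the ambient obstruction flow, where $S$ is the scalar curvature, $\Delta=\mathrm{tr}\,\mathrm{Hess}$, and $\mathcal O_n$ is the Fefferman–Graham ambient obstruction tensor, normalized to have leading part $\frac{1}{(-2)^{n/2-2}(n/2-2)!}\Delta^{n/2-1}P$ with $P$ the Schouten tensor (the Bach tensor if $n=4$). Then every complete gradient $q$-soliton (a gradient ambient obstruction soliton with $\nabla_hf_0$ complete) generates a self-similar solution of the ambient obstruction flow: all the conclusions of the theorem hold for this $q$ with $w=2-n$. -/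

import Mathlib

open scoped Manifold ContDiff

noncomputable section

namespace SelfSimilar

/-! ### Local (coordinate) Riemannian geometry on an open part of `ℝⁿ`

A metric is given by its Gram matrix `G : ℝⁿ → Matrix`, a function by `u : ℝⁿ → ℝ`. -/

/-- The model space `ℝⁿ`. -/
abbrev Coord (n : ℕ) : Type := EuclideanSpace ℝ (Fin n)

/-- A field of `n × n` matrices on `ℝⁿ`. -/
abbrev MatField (n : ℕ) : Type := Coord n → Matrix (Fin n) (Fin n) ℝ

variable {n : ℕ}

/-- The partial derivative `∂ᵢ u` at `y`. -/
def pderiv (i : Fin n) (u : Coord n → ℝ) (y : Coord n) : ℝ :=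
  fderiv ℝ u y (EuclideanSpace.single i 1)

/-- Christoffel symbols of the second kind,
`Γᵏᵢⱼ = ½ ∑ₗ gᵏˡ (∂ᵢ gⱼₗ + ∂ⱼ gᵢₗ - ∂ₗ gᵢⱼ)`. -/
def christoffel (G : MatField n) (k i j : Fin n) (y : Coord n) : ℝ :=
  (1 / 2) * ∑ l, (G y)⁻¹ k l *
    (pderiv i (fun z => G z j l) y + pderiv j (fun z => G z i l) y
      - pderiv l (fun z => G z i j) y)

/-- Ricci curvature,
`Rᵢⱼ = ∑ₖ (∂ₖ Γᵏᵢⱼ - ∂ⱼ Γᵏᵢₖ) + ∑ₖₗ (Γᵏₖₗ Γˡᵢⱼ - Γᵏⱼₗ Γˡᵢₖ)`. -/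
def ricci (G : MatField n) : MatField n := fun y => Matrix.of fun i j =>
  ∑ k, (pderiv k (christoffel G k i j) y - pderiv j (christoffel G k i k) y)
    + ∑ k, ∑ l, (christoffel G k k l y * christoffel G l i j y
        - christoffel G k j l y * christoffel G l i k y)

/-- The trace of a covariant 2-tensor with components `A` with respect to a metric with
Gram matrix `G`: `∑ᵢⱼ gⁱʲ Aᵢⱼ`. -/
def metricTrace (G A : Matrix (Fin n) (Fin n) ℝ) : ℝ := ∑ i, ∑ j, G⁻¹ i j * A i j

/-- Scalar curvature. -/
def scalarCurv (G : MatField n) (y : Coord n) : ℝ := metricTrace (G y) (ricci G y)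

/-- Hessian, `(∇² u)ᵢⱼ = ∂ᵢ ∂ⱼ u - ∑ₖ Γᵏᵢⱼ ∂ₖ u`. -/
def hessian (G : MatField n) (u : Coord n → ℝ) : MatField n := fun y => Matrix.of fun i j =>
  pderiv i (pderiv j u) y - ∑ k, christoffel G k i j y * pderiv k u y

/-! ### The Fefferman–Graham expansion

For a family `g_ρ` of metrics, the tangential components of the Ricci tensor of the
ambient metric `2ρ dt² + 2t dt dρ + t² g_ρ` at `t = 1` are
`Eᵢⱼ = ρ gᵢⱼ'' - ρ gᵏˡ gᵢₖ' gⱼₗ' + ½ ρ (gᵏˡ gₖₗ') gᵢⱼ' - (n/2 - 1) gᵢⱼ' - ½ (gᵏˡ gₖₗ') gᵢⱼ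
  + Rᵢⱼ(g_ρ)`, where `'` denotes `∂/∂ρ`. -/

/-- The derivative in the parameter `ρ` of a family of matrix fields. -/
def rhoDeriv (γ : ℝ → MatField n) : ℝ → MatField n := fun ρ y => Matrix.of fun i j =>
  deriv (fun s => γ s y i j) ρ

/-- The tangential Ricci components `Eᵢⱼ` of the ambient metric of the family `γ`. -/
def ambientRicci (γ : ℝ → MatField n) : ℝ → MatField n := fun ρ y =>
  let g := γ ρ y;
  let g' := rhoDeriv γ ρ y;
  let g'' := rhoDeriv (rhoDeriv γ) ρ y;
  ρ • g'' - ρ • (g' * g⁻¹ * g'.transpose) + (ρ / 2 * metricTrace g g') • g'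
    - ((n : ℝ) / 2 - 1) • g' - (1 / 2 * metricTrace g g') • g + ricci (γ ρ) y

/-- The derivative `∂ᵐE/∂ρᵐ` at `ρ = 0`. -/
def ambientRicciJet (γ : ℝ → MatField n) (m : ℕ) : MatField n := fun y => Matrix.of fun i j =>
  iteratedDeriv m (fun ρ => ambientRicci γ ρ y i j) 0

/-- The Fefferman–Graham expansion `g + ρ g₁ + ⋯ + ρᵐ gₘ` of the metric `G`.
With `m' = m + 1` and `L` the coefficient of `ρᵐ` in `E(g + ⋯ + ρᵐ gₘ)`, adding `ρ^m' g_m'`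
changes this coefficient to `m' (m' - n/2) g_m' - ½ m' tr(g_m') g + L`; the coefficient `g_m'`
below is the solution of "this vanishes" (unique for `m' < n/2`). Thus for even `n` and `m < n/2`
the expansion is the one determined by `E = O(ρᵐ)`; for instance `g₁` is twice the Schouten
tensor. -/
def fgExpansion (G : MatField n) : ℕ → ℝ → MatField n
  | 0 => fun _ => G
  | m + 1 => fun ρ y =>
      let L := (1 / (m.factorial : ℝ)) • ambientRicciJet (fgExpansion G m) m y;
      fgExpansion G m ρ y + ρ ^ (m + 1) •
        (-(1 / (((m : ℝ) + 1) * ((m : ℝ) + 1 - (n : ℝ) / 2))) •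
          (L + (metricTrace (G y) L / (2 * ((m : ℝ) + 1 - (n : ℝ)))) • G y))

/-- The ambient obstruction tensor for even `n ≥ 4`: the obstruction to solving
`E = O(ρ^{n/2})` modulo pure trace terms, that is, the trace-free part of `∂ρ^{n/2-1} E` at `ρ = 0`
for the expansion up to order `n/2 - 1`. The factor `-1` normalizes the leading part to
`Δ^{n/2-1} P / ((-2)^{n/2-2} (n/2-2)!)`, with `P` the Schouten tensor; for `n = 4` one gets the
Bach tensor. -/
def localObstruction (G : MatField n) : MatField n := fun y =>
  let D := ambientRicciJet (fgExpansion G (n / 2 - 1)) (n / 2 - 1) y;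
  (metricTrace (G y) D / (n : ℝ)) • G y - D

/-! ### Tensors on a smooth manifold -/

variable {M : Type*} [TopologicalSpace M] [ChartedSpace (Coord n) M]

/-- Smooth Riemannian metrics on the `n`-manifold `M`. -/
abbrev Metric (n : ℕ) (M : Type*) [TopologicalSpace M] [ChartedSpace (Coord n) M]
    [IsManifold (𝓡 n) ∞ M] : Type _ :=
  Bundle.ContMDiffRiemannianMetric (𝓡 n) ∞ (Coord n) (fun x : M => TangentSpace (𝓡 n) x)

/-- Covariant 2-tensor fields on `M`. -/
abbrev TwoTensor (n : ℕ) (M : Type*) [TopologicalSpace M] [ChartedSpace (Coord n) M] : Type _ :=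
  ∀ x : M, TangentSpace (𝓡 n) x →L[ℝ] TangentSpace (𝓡 n) x →L[ℝ] ℝ

/-- The `i`-th component of a tangent vector at `x` in the preferred chart at `x`. -/
def component (x : M) (i : Fin n) : TangentSpace (𝓡 n) x →L[ℝ] ℝ :=
  (EuclideanSpace.proj i : Coord n →L[ℝ] ℝ).comp
    (mfderiv (𝓡 n) 𝓘(ℝ, Coord n) (extChartAt (𝓡 n) x) x)

/-- The bilinear form `∑ᵢⱼ Aᵢⱼ dxⁱ ⊗ dxʲ` on `TₓM`, in the preferred chart at `x`. -/
def ofComponents (x : M) (A : Matrix (Fin n) (Fin n) ℝ) :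
    TangentSpace (𝓡 n) x →L[ℝ] TangentSpace (𝓡 n) x →L[ℝ] ℝ :=
  ∑ i, ∑ j, A i j • (component x i).smulRight (component x j)

/-- The coordinate expression of a function in the preferred chart at `x`. -/
def chartFun (u : M → ℝ) (x : M) : Coord n → ℝ :=
  fun y => u ((extChartAt (𝓡 n) x).symm y)

variable [IsManifold (𝓡 n) ∞ M]

/-- The Gram matrix of `g` in the preferred chart at `x`. -/
def gram (g : Metric n M) (x : M) : MatField n := fun y => Matrix.of fun i j =>
  g.inner ((extChartAt (𝓡 n) x).symm y)
    (mfderiv 𝓘(ℝ, Coord n) (𝓡 n) (extChartAt (𝓡 n) x).symm y (EuclideanSpace.single i (1 : ℝ)))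
    (mfderiv 𝓘(ℝ, Coord n) (𝓡 n) (extChartAt (𝓡 n) x).symm y (EuclideanSpace.single j (1 : ℝ)))

/-- The Hessian `Hess_g u`. -/
def hess (g : Metric n M) (u : M → ℝ) : TwoTensor n M := fun x =>
  ofComponents x (hessian (gram g x) (chartFun u x) (extChartAt (𝓡 n) x x))

/-- The Laplacian `Δ_g u = tr_g Hess_g u`. -/
def laplacian (g : Metric n M) (u : M → ℝ) (x : M) : ℝ :=
  metricTrace (gram g x (extChartAt (𝓡 n) x x))
    (hessian (gram g x) (chartFun u x) (extChartAt (𝓡 n) x x))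

/-- The scalar curvature of `g`. -/
def scalarCurvature (g : Metric n M) (x : M) : ℝ :=
  scalarCurv (gram g x) (extChartAt (𝓡 n) x x)

/-- The ambient obstruction tensor of `g`. -/
def obstruction (g : Metric n M) : TwoTensor n M := fun x =>
  ofComponents x (localObstruction (gram g x) (extChartAt (𝓡 n) x x))

/-- The right-hand side of the ambient obstruction flow,
`𝒪 + cₙ (-1)^{n/2} (Δ^{n/2-1} S) g` with `cₙ = 1 / (2^{n/2-2} (n/2-2)! (n-2) (n-1))`. -/
def ambientObstructionFlowTensor (g : Metric n M) : TwoTensor n M := fun x =>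
  obstruction g x +
    (1 / (2 ^ (n / 2 - 2) * ((n / 2 - 2).factorial : ℝ) * ((n : ℝ) - 2) * ((n : ℝ) - 1))
      * (-1) ^ (n / 2) * ((laplacian g)^[n / 2 - 1] (scalarCurvature g)) x) • g.inner x

theorem exists_gradient (g : Metric n M) (u : M → ℝ) (x : M) :
    ∃ X : TangentSpace (𝓡 n) x, ∀ v : TangentSpace (𝓡 n) x,
      g.inner x X v = mfderiv (𝓡 n) 𝓘(ℝ, ℝ) u x v := by
  let B : TangentSpace (𝓡 n) x →ₗ[ℝ] Module.Dual ℝ (TangentSpace (𝓡 n) x) :=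
    { toFun := fun X => (g.inner x X).toLinearMap
      map_add' := fun a b => by rw [map_add]; rfl
      map_smul' := fun r a => by rw [map_smul]; rfl }
  have hinj : Function.Injective B := by
    rw [← LinearMap.ker_eq_bot, LinearMap.ker_eq_bot']
    intro X hX
    by_contra hne
    have h1 := g.pos x X hne
    have h2 : g.inner x X X = 0 := LinearMap.congr_fun hX X
    exact absurd h2 h1.ne'
  have : FiniteDimensional ℝ (TangentSpace (𝓡 n) x) :=
    inferInstanceAs (FiniteDimensional ℝ (Coord n))
  have hsurj : Function.Surjective B :=
    (LinearMap.injective_iff_surjective_of_finrank_eq_finrank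
      (Subspace.dual_finrank_eq).symm).1 hinj
  obtain ⟨X, hX⟩ := hsurj (mfderiv (𝓡 n) 𝓘(ℝ, ℝ) u x).toLinearMap
  exact ⟨X, fun v => LinearMap.congr_fun hX v⟩

/-- The gradient `∇_g u`, characterized by `g(∇_g u, v) = du(v)`. -/
def grad (g : Metric n M) (u : M → ℝ) (x : M) : TangentSpace (𝓡 n) x :=
  Classical.choose (exists_gradient g u x)

/-- `g' = lam • g`. -/
def IsScaling (lam : ℝ) (g g' : Metric n M) : Prop :=
  ∀ x, g'.inner x = lam • g.inner x

/-- `S = φ^* T` for covariant 2-tensors and a diffeomorphism `φ`. -/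
def IsPullback (φ : M ≃ₘ⟮𝓡 n, 𝓡 n⟯ M) (T S : TwoTensor n M) : Prop :=
  ∀ (x : M) (v w : TangentSpace (𝓡 n) x),
    S x v w = T (φ x) (mfderiv (𝓡 n) (𝓡 n) φ x v) (mfderiv (𝓡 n) (𝓡 n) φ x w)

/-- `q` is invariant under diffeomorphisms: `q(φ^* g) = φ^* q(g)`. -/
def IsNatural (q : Metric n M → TwoTensor n M) : Prop :=
  ∀ (φ : M ≃ₘ⟮𝓡 n, 𝓡 n⟯ M) (g g' : Metric n M),
    IsPullback φ g.inner g'.inner → IsPullback φ (q g) (q g')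

/-- `q(lam g) = lam^{w/2} q(g)` for constants `lam > 0`. -/
def HasWeight (w : ℝ) (q : Metric n M → TwoTensor n M) : Prop :=
  ∀ (lam : ℝ), 0 < lam → ∀ g g' : Metric n M,
    IsScaling lam g g' → ∀ x, q g' x = lam ^ (w / 2) • q g x

/-- A vector field is complete if it has an integral curve defined on all of `ℝ` through
every point. -/
def IsCompleteField (X : ∀ x : M, TangentSpace (𝓡 n) x) : Prop :=
  ∀ x : M, ∃ γ : ℝ → M, γ 0 = x ∧ IsMIntegralCurve γ X

/-- `(M, h, f₀, c)` is a gradient `q`-soliton, `Hess_h f₀ = c h + ½ q(h)`, with smooth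
potential `f₀`, and `∇_h f₀` is a complete vector field. -/
structure IsCompleteGradientSoliton (q : Metric n M → TwoTensor n M)
    (h : Metric n M) (f₀ : M → ℝ) (c : ℝ) : Prop where
  smooth : ContMDiff (𝓡 n) 𝓘(ℝ, ℝ) ∞ f₀
  equation : ∀ x, hess h f₀ x = c • h.inner x + (1 / 2 : ℝ) • q h x
  complete : IsCompleteField (grad h f₀)

/-- The metrics `g t`, `t ∈ J`, solve the `q`-flow `∂ₜ g = q(g)`, `g 0 = h`. -/
structure IsFlowSolution (q : Metric n M → TwoTensor n M) (J : Set ℝ) (h : Metric n M)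
    (g : ℝ → Metric n M) : Prop where
  initial : g 0 = h
  equation : ∀ t ∈ J, ∀ (x : M) (v w : TangentSpace (𝓡 n) x),
    HasDerivAt (fun s => (g s).inner x v w) (q (g t) x v w) t

/-- The scale factor `τₜ`. -/
def tau (w c t : ℝ) : ℝ :=
  if w = 2 then Real.exp (-2 * c * t)
  else (1 - 2 * c * (1 - w / 2) * t) ^ (1 / (1 - w / 2))

/-- The times at which `τₜ` is defined and positive (all of `ℝ` if `w = 2`). -/
def tauDomain (w c : ℝ) : Set ℝ := {t | 0 < 1 - 2 * c * (1 - w / 2) * t}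

/-- The soliton `(M, h, f₀, c)` generates, on the time set `J`, the self-similar solution
`g t = τₜ φₜ^* h` of the `q`-flow. -/
structure IsSelfSimilarSolution (q : Metric n M → TwoTensor n M) (w : ℝ) (h : Metric n M)
    (f₀ : M → ℝ) (c : ℝ) (J : Set ℝ) (g : ℝ → Metric n M)
    (φ : ℝ → (M ≃ₘ⟮𝓡 n, 𝓡 n⟯ M)) (f : ℝ → M → ℝ) : Prop where
  flow : IsFlowSolution q J h g
  phi_zero : ∀ x, φ 0 x = x
  f_zero : f 0 = f₀
  tau_pos : ∀ t ∈ J, 0 < tau w c t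
  phi_smooth : ContMDiffOn (𝓘(ℝ, ℝ).prod (𝓡 n)) (𝓡 n) ∞
    (fun p : ℝ × M => φ p.1 p.2) (J ×ˢ Set.univ)
  /-- `∂ₜ φₜ(x) = τₜ^{w/2-1} (∇_h f₀)(φₜ(x))` -/
  phi_deriv : ∀ t ∈ J, ∀ x : M,
    HasMFDerivAt 𝓘(ℝ, ℝ) (𝓡 n) (fun s : ℝ => φ s x) t
      ((1 : ℝ →L[ℝ] ℝ).smulRight (tau w c t ^ (w / 2 - 1) • grad h f₀ (φ t x)))
  /-- `g t = τₜ φₜ^* h` -/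
  g_eq : ∀ t ∈ J, IsPullback (φ t) (fun x => tau w c t • h.inner x) (g t).inner
  f_eq : ∀ t ∈ J, f t = f₀ ∘ φ t
  hess_eq : ∀ t ∈ J, ∀ x, hess (g t) (f t) x =
    (c / tau w c t) • (g t).inner x + (1 / 2 * tau w c t ^ (-(w / 2))) • q (g t) x
  q_eq : ∀ t ∈ J, ∀ x, q (g t) x = tau w c t ^ (w / 2) •
    ((-(2 * c / tau w c t)) • (g t).inner x + (2 : ℝ) • hess (g t) (f t) x)
  /-- `∂ₜ f = τₜ^{w/2} |∇ f|²`, gradient and norm with respect to `g t` -/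
  f_deriv : ∀ t ∈ J, ∀ x, HasDerivAt (fun s => f s x)
    (tau w c t ^ (w / 2) *
      (g t).inner x (grad (g t) (f t) x) (grad (g t) (f t) x)) t

/-- The soliton generates a self-similar solution for all times in `tauDomain w c`, which contains
an interval `(-ε, ε)`. -/
def GeneratesSelfSimilarSolution (q : Metric n M → TwoTensor n M) (w : ℝ) (h : Metric n M)
    (f₀ : M → ℝ) (c : ℝ) : Prop :=
  (∃ ε > 0, Set.Ioo (-ε) ε ⊆ tauDomain w c) ∧
    ∃ (g : ℝ → Metric n M) (φ : ℝ → (M ≃ₘ⟮𝓡 n, 𝓡 n⟯ M)) (f : ℝ → M → ℝ),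
      IsSelfSimilarSolution q w h f₀ c (tauDomain w c) g φ f

end SelfSimilar

end

/-! Let X = ∇_h f₀, let ψ_s be its flow, and put φ_t = ψ_{σ(t)} with σ' = τ^{w/2-1} and σ(0) = 0.
Since L_X h = 2 Hess_h f₀ and τ' = -2c τ^{w/2}, the derivative of τ φ^*h is τ^{w/2} φ^*(-2c h + 2
Hess_h f₀) = τ^{w/2} φ^* q(h) = q(τ φ^*h), by the soliton equation, naturality and weight. The
remaining identities follow because Hess is natural and unchanged by constant scaling, while |∇f|²
scales with the inverse of the metric.

Three ingredients carry the proof. The flow of a complete smooth field, given pointwise by a choice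
of integral curves, is jointly smooth (`contMDiff_fieldFlow`). Locally this is the inverse function
theorem on a Banach space of curves, and the group law spreads it along orbits. The identity L_X h =
2 Hess_h f₀ comes from the Koszul formula in a chart (`lieDeriv_metric_eq`,
`hasDerivAt_pullback_flow`). The time change is elementary, because τ^{w/2-1} is the reciprocal of
an affine function of t for every w (`tau_rpow`).

The corollary needs naturality and weight 2 - n of the obstruction flow tensor. Every operator is
defined by coordinate formulas in the preferred charts, so naturality means that these formulas are
covariant under local diffeomorphisms of ℝⁿ. This is proved for Christoffel symbols, Hessian, Ricci
curvature, the ambient Ricci components and finally, by induction, the Fefferman–Graham expansion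
(`fgExpansion_pull`, `localObstruction_pull`). The weight comes from the rule that scaling G by r
turns the expansion γ(ρ) into r γ(ρ/r) (`fgExpansion_smul`). -/

namespace SelfSimilar

/-! ### Superposition operators on spaces of continuous functions -/

section Superposition

variable {K : Type*} [TopologicalSpace K] [CompactSpace K]

/-- Pointwise application of a family of continuous linear maps. -/
noncomputable def pointwiseApply (K : Type*) [TopologicalSpace K] [CompactSpace K]
    (E F : Type*) [NormedAddCommGroup E] [NormedSpace ℝ E] [NormedAddCommGroup F]
    [NormedSpace ℝ F] : C(K, E →L[ℝ] F) →L[ℝ] C(K, E) →L[ℝ] C(K, F) :=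
  LinearMap.mkContinuous₂
    (LinearMap.mk₂ ℝ (fun (A : C(K, E →L[ℝ] F)) (α : C(K, E)) =>
      (⟨fun t => A t (α t), A.continuous.clm_apply α.continuous⟩ : C(K, F)))
      (fun _ _ _ => by ext; simp) (fun _ _ _ => by ext; simp)
      (fun _ _ _ => by ext; simp) (fun _ _ _ => by ext; simp)) 1 (fun A α => by
        rw [one_mul]
        refine (ContinuousMap.norm_le _ (by positivity)).2 fun t => ?_
        exact (A t).le_of_opNorm_le_of_le (A.norm_coe_le_norm t) (α.norm_coe_le_norm t))

theorem pointwiseApply_apply {E F : Type*} [NormedAddCommGroup E] [NormedSpace ℝ E]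
    [NormedAddCommGroup F] [NormedSpace ℝ F] (A : C(K, E →L[ℝ] F)) (α : C(K, E)) (t : K) :
    pointwiseApply K E F A α t = A t (α t) := rfl

/-- Closeness of `dv ∘ β` to `dv ∘ α` in the sup norm makes the mean value estimate on the segment
from α(t) to β(t) uniform in t. No bound on a second derivative of v is needed. -/
theorem hasFDerivAt_postcomp {E F : Type*} [NormedAddCommGroup E] [NormedSpace ℝ E]
    [NormedAddCommGroup F] [NormedSpace ℝ F] (v : C(E, F)) (dv : C(E, E →L[ℝ] F))
    (h : ∀ x, HasFDerivAt v (dv x) x) (α : C(K, E)) :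
    HasFDerivAt (fun β : C(K, E) => v.comp β) (pointwiseApply K E F (dv.comp α)) α := by
  refine HasFDerivAt.of_isLittleO (Asymptotics.isLittleO_iff.2 fun c hc => ?_)
  have hcont : ContinuousAt (fun β : C(K, E) => dv.comp β) α :=
    (ContinuousMap.continuous_postcomp dv).continuousAt
  have hnhds : (fun β : C(K, E) => dv.comp β) ⁻¹' Metric.ball (dv.comp α) c ∈ nhds α :=
    hcont (Metric.ball_mem_nhds (dv.comp α) hc)
  obtain ⟨δ, hδ, hball⟩ := Metric.mem_nhds_iff.1 hnhds
  filter_upwards [Metric.ball_mem_nhds α hδ] with β hβ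
  refine (ContinuousMap.norm_le _ (by positivity)).2 fun t => ?_
  have key := (convex_segment (𝕜 := ℝ) (α t) (β t)).norm_image_sub_le_of_norm_hasFDerivWithin_le'
    (f := v) (f' := dv) (φ := dv (α t)) (C := c)
    (fun x _ => (h x).hasFDerivWithinAt) (fun x hx => ?_)
    (left_mem_segment ℝ _ _) (right_mem_segment ℝ _ _)
  · refine le_trans (by simpa [pointwiseApply_apply] using key) ?_
    gcongr
    exact (β - α).norm_coe_le_norm t
  · rw [segment_eq_image_lineMap] at hx
    obtain ⟨s, hs, rfl⟩ := hx
    -- The point of the segment in E is the value at t of a curve on the segment from α to β, which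
    -- stays in the ball.
    have hmem : AffineMap.lineMap α β s ∈ Metric.ball α δ := by
      have hseg := (convex_ball α δ).segment_subset (Metric.mem_ball_self hδ) hβ
      rw [segment_eq_image_lineMap] at hseg
      exact hseg ⟨s, hs, rfl⟩
    have h1 := hball hmem
    rw [Set.mem_preimage, Metric.mem_ball] at h1
    have h2 := ContinuousMap.dist_apply_le_dist (f := dv.comp (AffineMap.lineMap α β s))
      (g := dv.comp α) t
    have h3 : (AffineMap.lineMap α β s : C(K, E)) t = AffineMap.lineMap (α t) (β t) s := by
      simp [AffineMap.lineMap_apply]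
    simp only [ContinuousMap.comp_apply, h3] at h2
    rw [← dist_eq_norm]
    exact h2.trans h1.le

universe u

/-- The derivative of a superposition operator is the superposition operator of `fderiv ℝ v`
followed by the continuous linear map `pointwiseApply`. The induction changes F into E →L F, hence F
is quantified after k and shares the universe of E. -/
theorem contDiff_postcomp_nat {E : Type u} [NormedAddCommGroup E] [NormedSpace ℝ E] (k : ℕ) :
    ∀ {F : Type u} [NormedAddCommGroup F] [NormedSpace ℝ F] (v : C(E, F)), ContDiff ℝ k v →
      ContDiff ℝ k (fun β : C(K, E) => v.comp β) := by
  induction k with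
  | zero =>
    intro F _ _ v _
    exact contDiff_zero.2 (ContinuousMap.continuous_postcomp v)
  | succ k ih =>
    intro F _ _ v hv
    have hv' : ContDiff ℝ k (fderiv ℝ v) := hv.fderiv_right (m := k) (by norm_cast)
    have hN := ih ⟨fderiv ℝ v, hv'.continuous⟩ hv'
    refine contDiff_succ_iff_hasFDerivAt.2
      ⟨fun α => pointwiseApply K E F ((⟨fderiv ℝ v, hv'.continuous⟩ : C(E, E →L[ℝ] F)).comp α),
        hN.continuousLinearMap_comp (pointwiseApply K E F), fun α => ?_⟩
    exact hasFDerivAt_postcomp v ⟨fderiv ℝ v, hv'.continuous⟩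
      (fun x => (hv.differentiable (by simp) x).hasFDerivAt) α

theorem contDiff_postcomp {E F : Type u} [NormedAddCommGroup E] [NormedSpace ℝ E]
    [NormedAddCommGroup F] [NormedSpace ℝ F] (v : C(E, F)) (hv : ContDiff ℝ ∞ v) :
    ContDiff ℝ ∞ (fun β : C(K, E) => v.comp β) :=
  contDiff_infty.2 fun k => contDiff_postcomp_nat k v (contDiff_infty.1 hv k)

end Superposition

/-! ### Smooth dependence of the solutions of an ordinary differential equation -/

section LocalFlow

universe u

variable {E : Type u} [NormedAddCommGroup E]

/-- The extension of a curve on `[-2, 2]` to the real line by constants. -/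
noncomputable def extendCurve (α : C(Set.Icc (-2 : ℝ) 2, E)) : ℝ → E :=
  Set.IccExtend (by norm_num) α

theorem continuous_extendCurve (α : C(Set.Icc (-2 : ℝ) 2, E)) : Continuous (extendCurve α) :=
  α.continuous.Icc_extend'

theorem norm_extendCurve_le (α : C(Set.Icc (-2 : ℝ) 2, E)) (s : ℝ) : ‖extendCurve α s‖ ≤ ‖α‖ :=
  α.norm_coe_le_norm _

theorem extendCurve_of_mem (α : C(Set.Icc (-2 : ℝ) 2, E)) {s : ℝ} (hs : s ∈ Set.Icc (-2 : ℝ) 2) :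
    extendCurve α s = α ⟨s, hs⟩ := Set.IccExtend_of_mem _ _ hs

variable [NormedSpace ℝ E]

/-- Constant curves, as a continuous linear map. -/
noncomputable def constCurve (E : Type u) [NormedAddCommGroup E] [NormedSpace ℝ E] :
    E →L[ℝ] C(Set.Icc (-2 : ℝ) 2, E) :=
  LinearMap.mkContinuous
    { toFun := fun x => ContinuousMap.const _ x
      map_add' := fun _ _ => by ext; simp
      map_smul' := fun _ _ => by ext; simp } 1 (fun x => by
        rw [one_mul]
        exact (ContinuousMap.norm_le _ (by positivity)).2 fun t => le_rfl)

/-- The primitive vanishing at `0` of a curve on `[-2, 2]`. -/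
noncomputable def primitive (E : Type u) [NormedAddCommGroup E] [NormedSpace ℝ E]
    [CompleteSpace E] : C(Set.Icc (-2 : ℝ) 2, E) →L[ℝ] C(Set.Icc (-2 : ℝ) 2, E) :=
  LinearMap.mkContinuous
    { toFun := fun α => ⟨fun s => ∫ r in (0 : ℝ)..s, extendCurve α r,
        (intervalIntegral.continuous_primitive (fun a b =>
          (continuous_extendCurve α).intervalIntegrable a b) 0).comp continuous_subtype_val⟩
      map_add' := fun α β => by
        ext s
        exact intervalIntegral.integral_add ((continuous_extendCurve α).intervalIntegrable 0 s)
          ((continuous_extendCurve β).intervalIntegrable 0 s)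
      map_smul' := fun c α => by
        ext s
        exact intervalIntegral.integral_smul c (extendCurve α) } 2 (fun α => by
        refine (ContinuousMap.norm_le _ (by positivity)).2 fun s => ?_
        have h := intervalIntegral.norm_integral_le_of_norm_le_const (a := 0) (b := (s : ℝ))
          (f := extendCurve α) (C := ‖α‖) fun r _ => norm_extendCurve_le α r
        refine h.trans ?_
        rw [mul_comm, sub_zero]
        gcongr
        exact abs_le.2 s.2)

/-- The equation `α(s) = x + ∫₀ˢ t v(α)`, written as `picardDefect v (t, x, α) = (t, x, 0)`. -/
noncomputable def picardDefect [CompleteSpace E] (v : C(E, E))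
    (p : ℝ × E × C(Set.Icc (-2 : ℝ) 2, E)) : ℝ × E × C(Set.Icc (-2 : ℝ) 2, E) :=
  (p.1, p.2.1, p.2.2 - constCurve E p.2.1 - p.1 • primitive E (v.comp p.2.2))

/-- The shear `(t, x, α) ↦ (t, x, α - x - t w)`. -/
noncomputable def curveShear (w : C(Set.Icc (-2 : ℝ) 2, E)) :
    (ℝ × E × C(Set.Icc (-2 : ℝ) 2, E)) ≃L[ℝ] (ℝ × E × C(Set.Icc (-2 : ℝ) 2, E)) :=
  let fst := ContinuousLinearMap.fst ℝ ℝ (E × C(Set.Icc (-2 : ℝ) 2, E))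
  let snd := (ContinuousLinearMap.fst ℝ E C(Set.Icc (-2 : ℝ) 2, E)).comp
    (ContinuousLinearMap.snd ℝ ℝ (E × C(Set.Icc (-2 : ℝ) 2, E)))
  let trd := (ContinuousLinearMap.snd ℝ E C(Set.Icc (-2 : ℝ) 2, E)).comp
    (ContinuousLinearMap.snd ℝ ℝ (E × C(Set.Icc (-2 : ℝ) 2, E)))
  ContinuousLinearEquiv.equivOfInverse
    (fst.prod (snd.prod (trd - (constCurve E).comp snd - fst.smulRight w)))
    (fst.prod (snd.prod (trd + (constCurve E).comp snd + fst.smulRight w)))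
    (fun p => by ext <;> simp [fst, snd, trd]; abel)
    (fun p => by ext <;> simp [fst, snd, trd]; abel)

theorem contDiff_picardDefect [CompleteSpace E] (v : C(E, E)) (hv : ContDiff ℝ ∞ v) :
    ContDiff ℝ ∞ (picardDefect v) := by
  have h1 : ContDiff ℝ ∞ fun p : ℝ × E × C(Set.Icc (-2 : ℝ) 2, E) => v.comp p.2.2 :=
    (contDiff_postcomp v hv).comp (contDiff_snd.comp contDiff_snd)
  have h2 : ContDiff ℝ ∞ fun p : ℝ × E × C(Set.Icc (-2 : ℝ) 2, E) => constCurve E p.2.1 :=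
    (constCurve E).contDiff.comp (contDiff_fst.comp contDiff_snd)
  have h3 := (primitive E).contDiff.comp h1
  exact contDiff_fst.prodMk ((contDiff_fst.comp contDiff_snd).prodMk
    (((contDiff_snd.comp contDiff_snd).sub h2).sub (contDiff_fst.smul h3)))

/-- At t = 0 the integral term contributes only through the derivative of its factor t. The
derivative is therefore a shear, invertible without any estimate on v; the speed parameter t
replaces a short time interval. -/
theorem hasFDerivAt_picardDefect [CompleteSpace E] (v : C(E, E)) (hv : ContDiff ℝ ∞ v)
    (x : E) (α : C(Set.Icc (-2 : ℝ) 2, E)) :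
    HasFDerivAt (picardDefect v) (curveShear (primitive E (v.comp α)) :
      (ℝ × E × C(Set.Icc (-2 : ℝ) 2, E)) →L[ℝ] (ℝ × E × C(Set.Icc (-2 : ℝ) 2, E)))
      (0, x, α) := by
  have h1 : ContDiff ℝ ∞ fun p : ℝ × E × C(Set.Icc (-2 : ℝ) 2, E) =>
      primitive E (v.comp p.2.2) := (primitive E).contDiff.comp
    ((contDiff_postcomp v hv).comp (contDiff_snd.comp contDiff_snd))
  have h2 := (h1.differentiable (by simp) (0, x, α)).hasFDerivAt
  have hf : HasFDerivAt (fun p : ℝ × E × C(Set.Icc (-2 : ℝ) 2, E) => p.1) _ (0, x, α) :=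
    (ContinuousLinearMap.fst ℝ ℝ (E × C(Set.Icc (-2 : ℝ) 2, E))).hasFDerivAt
  have hs : HasFDerivAt (fun p : ℝ × E × C(Set.Icc (-2 : ℝ) 2, E) => p.2) _ (0, x, α) :=
    (ContinuousLinearMap.snd ℝ ℝ (E × C(Set.Icc (-2 : ℝ) 2, E))).hasFDerivAt
  have h := hf.prodMk (hs.fst.prodMk
    ((hs.snd.sub ((constCurve E).hasFDerivAt.comp (0, x, α) hs.fst)).sub (hf.smul h2)))
  convert! h using 1
  ext <;> simp [curveShear]

/-- Solutions of `α' = t v(α)`, `α(0) = x` on `(-2, 2)`, for `(t, x)` near `(0, x₀)`, that depend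
smoothly on `(t, x)`. -/
theorem exists_smooth_local_solution [CompleteSpace E] {v : E → E} (hv : ContDiff ℝ ∞ v) (x₀ : E) :
    ∃ Φ : ℝ × E → C(Set.Icc (-2 : ℝ) 2, E), ContDiffAt ℝ ∞ Φ (0, x₀) ∧
      Φ (0, x₀) = constCurve E x₀ ∧
      ∀ᶠ p in nhds ((0 : ℝ), x₀), extendCurve (Φ p) 0 = p.2 ∧
        ∀ s ∈ Set.Ioo (-2 : ℝ) 2,
          HasDerivAt (extendCurve (Φ p)) (p.1 • v (extendCurve (Φ p) s)) s := by
  let V : C(E, E) := ⟨v, hv.continuous⟩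
  have hD := (contDiff_picardDefect V hv).contDiffAt (x := ((0 : ℝ), x₀, constCurve E x₀))
  have hD' := hasFDerivAt_picardDefect V hv x₀ (constCurve E x₀)
  have hval : picardDefect V (0, x₀, constCurve E x₀) = (0, x₀, 0) := by
    simp [picardDefect]
  -- The inverse function theorem applies to the defect; the solution curve is the third component
  -- of the local inverse at (t, x, 0).
  let e := hD.toOpenPartialHomeomorph (picardDefect V) hD' (by simp)
  have he : (e : _ → _) = picardDefect V := rfl
  have hinv : ContDiffAt ℝ ∞ e.symm (0, x₀, 0) := by
    have := hD.to_localInverse hD' (by simp)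
    rw [hval] at this
    exact this
  have hmem : ((0 : ℝ), x₀, (0 : C(Set.Icc (-2 : ℝ) 2, E))) ∈ e.target := by
    have := hD.image_mem_toOpenPartialHomeomorph_target hD' (by simp)
    rw [hval] at this
    exact this
  have hemb : ContDiff ℝ ∞ fun p : ℝ × E => (p.1, p.2, (0 : C(Set.Icc (-2 : ℝ) 2, E))) :=
    contDiff_fst.prodMk (contDiff_snd.prodMk contDiff_const)
  refine ⟨fun p => (e.symm (p.1, p.2, 0)).2.2, ?_, ?_, ?_⟩
  · have := hinv.comp ((0 : ℝ), x₀) hemb.contDiffAt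
    exact this.snd.snd
  · have h1 : e.symm (0, x₀, 0) = (0, x₀, constCurve E x₀) := by
      rw [← hval, ← he]
      exact e.left_inv (hD.mem_toOpenPartialHomeomorph_source hD' (by simp))
    simp [h1]
  · have hev := hemb.continuous.continuousAt.preimage_mem_nhds
      (x := ((0 : ℝ), x₀)) (e.open_target.mem_nhds hmem)
    filter_upwards [hev] with p hp
    have h1 : picardDefect V (e.symm (p.1, p.2, 0)) = (p.1, p.2, 0) := e.right_inv hp
    set α := (e.symm (p.1, p.2, 0)).2.2 with hα
    simp only [picardDefect, Prod.mk.injEq] at h1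
    obtain ⟨h2, h3, h4⟩ := h1
    rw [h2, h3, ← hα, sub_sub, sub_eq_zero] at h4
    have hint : ∀ s ∈ Set.Icc (-2 : ℝ) 2, extendCurve α s =
        p.2 + p.1 • ∫ r in (0 : ℝ)..s, v (extendCurve α r) := by
      intro s hs
      have h5 := congrArg (fun β => β ⟨s, hs⟩) h4
      rw [extendCurve_of_mem α hs]
      exact h5
    have hc : Continuous fun r => v (extendCurve α r) :=
      hv.continuous.comp (continuous_extendCurve α)
    refine ⟨by simpa using hint 0 (by norm_num), fun s hs => ?_⟩
    have h6 : HasDerivAt (fun s => p.2 + p.1 • ∫ r in (0 : ℝ)..s, v (extendCurve α r))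
        (p.1 • v (extendCurve α s)) s :=
      ((hc.integral_hasStrictDerivAt 0 s).hasDerivAt.const_smul p.1).const_add p.2
    refine h6.congr_of_eventuallyEq ?_
    filter_upwards [Icc_mem_nhds hs.1 hs.2] with r hr using hint r hr

end LocalFlow

/-! ### Derivatives of the preferred charts -/

section Charts

variable {n : ℕ} {M : Type*} [TopologicalSpace M] [ChartedSpace (Coord n) M]

theorem isOpen_chart_target (a : M) : IsOpen (extChartAt (𝓡 n) a).target :=
  isOpen_extChartAt_target a

theorem chart_target_mem_nhds (a : M) {y : Coord n} (hy : y ∈ (extChartAt (𝓡 n) a).target) :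
    (extChartAt (𝓡 n) a).target ∈ nhds y := (isOpen_chart_target a).mem_nhds hy

variable [IsManifold (𝓡 n) ∞ M]

theorem contMDiffAt_chart_symm (a : M) {y : Coord n} (hy : y ∈ (extChartAt (𝓡 n) a).target) :
    ContMDiffAt 𝓘(ℝ, Coord n) (𝓡 n) ∞ (extChartAt (𝓡 n) a).symm y :=
  (contMDiffOn_extChartAt_symm a).contMDiffAt (chart_target_mem_nhds a hy)

theorem contMDiffAt_chart (a : M) {x : M} (hx : x ∈ (extChartAt (𝓡 n) a).source) :
    ContMDiffAt (𝓡 n) 𝓘(ℝ, Coord n) ∞ (extChartAt (𝓡 n) a) x :=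
  contMDiffAt_extChartAt' (by rwa [extChartAt_source] at hx)

theorem mdifferentiableAt_chart_symm (a : M) {y : Coord n}
    (hy : y ∈ (extChartAt (𝓡 n) a).target) :
    MDifferentiableAt 𝓘(ℝ, Coord n) (𝓡 n) (extChartAt (𝓡 n) a).symm y :=
  (contMDiffAt_chart_symm a hy).mdifferentiableAt (by simp)

theorem mdifferentiableAt_chart (a : M) {x : M} (hx : x ∈ (extChartAt (𝓡 n) a).source) :
    MDifferentiableAt (𝓡 n) 𝓘(ℝ, Coord n) (extChartAt (𝓡 n) a) x :=
  (contMDiffAt_chart a hx).mdifferentiableAt (by simp)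

theorem mfderiv_chart_mfderiv_symm (a : M) {y : Coord n}
    (hy : y ∈ (extChartAt (𝓡 n) a).target) (v : Coord n) :
    mfderiv (𝓡 n) 𝓘(ℝ, Coord n) (extChartAt (𝓡 n) a) ((extChartAt (𝓡 n) a).symm y)
      (mfderiv 𝓘(ℝ, Coord n) (𝓡 n) (extChartAt (𝓡 n) a).symm y v) = v := by
  have h := mfderiv_extChartAt_comp_mfderivWithin_extChartAt_symm (I := 𝓡 n) hy
  rw [ModelWithCorners.range_eq_univ, mfderivWithin_univ] at h
  exact DFunLike.congr_fun h v

theorem mfderiv_symm_mfderiv_chart (a : M) {y : Coord n}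
    (hy : y ∈ (extChartAt (𝓡 n) a).target) (v : TangentSpace (𝓡 n) ((extChartAt (𝓡 n) a).symm y)) :
    mfderiv 𝓘(ℝ, Coord n) (𝓡 n) (extChartAt (𝓡 n) a).symm y
      (mfderiv (𝓡 n) 𝓘(ℝ, Coord n) (extChartAt (𝓡 n) a) ((extChartAt (𝓡 n) a).symm y) v) = v := by
  have h := mfderivWithin_extChartAt_symm_comp_mfderiv_extChartAt (I := 𝓡 n) hy
  rw [ModelWithCorners.range_eq_univ, mfderivWithin_univ] at h
  exact DFunLike.congr_fun h v

/-- The coordinate expression of a vector field in the preferred chart at `a`. -/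
noncomputable def chartField (X : ∀ x : M, TangentSpace (𝓡 n) x) (a : M) (y : Coord n) : Coord n :=
  mfderiv (𝓡 n) 𝓘(ℝ, Coord n) (extChartAt (𝓡 n) a) ((extChartAt (𝓡 n) a).symm y)
    (X ((extChartAt (𝓡 n) a).symm y))

theorem mfderiv_symm_chartField (X : ∀ x : M, TangentSpace (𝓡 n) x) (a : M) {y : Coord n}
    (hy : y ∈ (extChartAt (𝓡 n) a).target) :
    mfderiv 𝓘(ℝ, Coord n) (𝓡 n) (extChartAt (𝓡 n) a).symm y (chartField X a y) =
      X ((extChartAt (𝓡 n) a).symm y) := mfderiv_symm_mfderiv_chart a hy _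

/-- Smoothness of a vector field. -/
def IsSmoothField (X : ∀ x : M, TangentSpace (𝓡 n) x) : Prop :=
  ContMDiff (𝓡 n) (𝓡 n).tangent ∞ (fun x => (⟨x, X x⟩ : TangentBundle (𝓡 n) M))

/-- Over the chart domain the tangent bundle trivialization at `a` is the derivative of the chart at
`a`, so smoothness of a section is smoothness of its chart components. -/
theorem contMDiffOn_trivialization_iff (X : ∀ x : M, TangentSpace (𝓡 n) x) (a : M) :
    ContMDiffOn (𝓡 n) (𝓡 n).tangent ∞ (fun x => (⟨x, X x⟩ : TangentBundle (𝓡 n) M))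
      (extChartAt (𝓡 n) a).source ↔
    ContDiffOn ℝ ∞ (chartField X a) (extChartAt (𝓡 n) a).target := by
  have key : ContMDiffOn (𝓡 n) (𝓡 n).tangent ∞ (fun x => (⟨x, X x⟩ : TangentBundle (𝓡 n) M))
      (extChartAt (𝓡 n) a).source ↔ ContMDiffOn (𝓡 n) 𝓘(ℝ, Coord n) ∞
        (fun x => mfderiv (𝓡 n) 𝓘(ℝ, Coord n) (extChartAt (𝓡 n) a) x (X x))
          (extChartAt (𝓡 n) a).source := by
    rw [(trivializationAt (Coord n) (TangentSpace (𝓡 n)) a).contMDiffOn_iff (n := ∞)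
      (IB := 𝓡 n) (fun x hx => by
        rw [Bundle.Trivialization.mem_source]
        simpa [extChartAt_source] using hx)]
    have htriv : ∀ x ∈ (extChartAt (𝓡 n) a).source,
        mfderiv (𝓡 n) 𝓘(ℝ, Coord n) (extChartAt (𝓡 n) a) x (X x) =
          (trivializationAt (Coord n) (TangentSpace (𝓡 n)) a ⟨x, X x⟩).2 := by
      intro x hx
      rw [extChartAt_source] at hx
      have h1 := DFunLike.congr_fun
        (TangentBundle.continuousLinearMapAt_trivializationAt (I := 𝓡 n) hx) (X x)
      refine h1.symm.trans ?_
      rw [Bundle.Trivialization.continuousLinearMapAt_apply,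
        Bundle.Trivialization.coe_linearMapAt_of_mem _ (by simpa using hx)]
    exact ⟨fun h => h.2.congr htriv,
      fun h => ⟨contMDiffOn_id, h.congr fun x hx => (htriv x hx).symm⟩⟩
  rw [key, ← contMDiffOn_iff_contDiffOn]
  constructor
  · intro h
    exact h.comp (contMDiffOn_extChartAt_symm a) fun y hy => (extChartAt (𝓡 n) a).map_target hy
  · intro h
    have h2 := h.comp (s := (extChartAt (𝓡 n) a).source)
      (f := extChartAt (𝓡 n) a) (fun x hx => (contMDiffAt_chart a hx).contMDiffWithinAt)
      fun y hy => (extChartAt (𝓡 n) a).map_source hy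
    refine h2.congr fun x hx => ?_
    simp only [Function.comp_apply, chartField]
    rw [(extChartAt (𝓡 n) a).left_inv hx]

theorem IsSmoothField.contDiffOn {X : ∀ x : M, TangentSpace (𝓡 n) x} (hX : IsSmoothField X)
    (a : M) : ContDiffOn ℝ ∞ (chartField X a) (extChartAt (𝓡 n) a).target :=
  (contMDiffOn_trivialization_iff X a).1 hX.contMDiffOn

theorem isSmoothField_of_contDiffOn {X : ∀ x : M, TangentSpace (𝓡 n) x}
    (h : ∀ a, ContDiffOn ℝ ∞ (chartField X a) (extChartAt (𝓡 n) a).target) :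
    IsSmoothField X := fun a =>
  ((contMDiffOn_trivialization_iff X a).2 (h a)).contMDiffAt (extChartAt_source_mem_nhds a)

end Charts

/-! ### The flow of a complete smooth vector field -/

section Flow

variable {n : ℕ} {M : Type*} [TopologicalSpace M] [ChartedSpace (Coord n) M]

/-- The flow of a complete vector field. -/
noncomputable def fieldFlow {X : ∀ x : M, TangentSpace (𝓡 n) x} (hc : IsCompleteField X)
    (t : ℝ) (x : M) : M := Classical.choose (hc x) t

variable {X : ∀ x : M, TangentSpace (𝓡 n) x} (hc : IsCompleteField X)

theorem fieldFlow_zero (x : M) : fieldFlow hc 0 x = x := (Classical.choose_spec (hc x)).1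

theorem isMIntegralCurve_fieldFlow (x : M) :
    IsMIntegralCurve (fun t => fieldFlow hc t x) X := (Classical.choose_spec (hc x)).2

variable [IsManifold (𝓡 n) ∞ M]

theorem IsSmoothField.contMDiff_one (hX : IsSmoothField X) :
    ContMDiff (𝓡 n) (𝓡 n).tangent 1 (fun x => (⟨x, X x⟩ : TangentBundle (𝓡 n) M)) :=
  ContMDiff.of_le hX (by simp)

variable [T2Space M]

/-- The integral curves were chosen separately for each point; uniqueness of integral curves in a
Hausdorff manifold ties the choices together. -/
theorem fieldFlow_add (hX : IsSmoothField X) (s t : ℝ) (x : M) :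
    fieldFlow hc (s + t) x = fieldFlow hc s (fieldFlow hc t x) := by
  have h1 := (isMIntegralCurve_fieldFlow hc x).comp_add t
  have h2 := isMIntegralCurve_fieldFlow hc (fieldFlow hc t x)
  have h3 := isMIntegralCurve_Ioo_eq_of_contMDiff_boundaryless (t₀ := 0) hX.contMDiff_one h1 h2
    (by simp [fieldFlow_zero])
  exact congrFun h3 s

/-- Near time `0` the flow of a complete smooth vector field is smooth. -/
theorem contMDiffAt_fieldFlow_zero (hX : IsSmoothField X) (a : M) :
    ContMDiffAt (𝓘(ℝ, ℝ).prod (𝓡 n)) (𝓡 n) ∞ (fun p : ℝ × M => fieldFlow hc p.1 p.2) (0, a) := by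
  set e := extChartAt (𝓡 n) a with he
  have hat : e a ∈ e.target := mem_extChartAt_target a
  obtain ⟨r, hr, hball⟩ := Metric.nhds_basis_closedBall.mem_iff.1
    (chart_target_mem_nhds a hat)
  -- The local existence theorem wants a field on all of ℝⁿ. The cut-off equals 1 on the ball of
  -- radius r/2 and is supported in the closed ball of radius r, inside the chart target.
  let b : ContDiffBump (e a) := ⟨r / 2, r, by positivity, by linarith⟩
  have hv : ContDiff ℝ ∞ fun y => b y • chartField X a y := by
    rw [contDiff_iff_contDiffAt]
    intro y
    by_cases hy : y ∈ e.target
    · exact b.contDiffAt.smul ((hX.contDiffOn a).contDiffAt (chart_target_mem_nhds a hy))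
    · have hy' : y ∈ (tsupport b)ᶜ := fun h => by
        rw [b.tsupport_eq] at h
        exact hy (hball h)
      refine contDiffAt_const (c := (0 : Coord n)) |>.congr_of_eventuallyEq ?_
      filter_upwards [(isClosed_tsupport b).isOpen_compl.mem_nhds hy'] with z hz
      rw [image_eq_zero_of_notMem_tsupport hz, zero_smul]
  obtain ⟨Φ, hΦ, hΦ0, hsol⟩ := exists_smooth_local_solution hv (e a)
  have hpair : ContMDiffAt (𝓘(ℝ, ℝ).prod (𝓡 n)) 𝓘(ℝ, ℝ × Coord n) ∞
      (fun p : ℝ × M => (p.1, e p.2)) (0, a) := by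
    refine contMDiffAt_fst.prodMk_space ?_
    exact (contMDiffAt_chart a (mem_extChartAt_source a)).comp (0, a) contMDiffAt_snd
  -- The solution for (t, y) runs with speed t, so its value at s = 1 is the flow at time t. The
  -- time 1 lies in the open interval (-2, 2) on which uniqueness is applied.
  have hone : (1 : ℝ) ∈ Set.Icc (-2 : ℝ) 2 := by norm_num
  have hΦ' : ContMDiffAt (𝓘(ℝ, ℝ).prod (𝓡 n)) 𝓘(ℝ, C(Set.Icc (-2 : ℝ) 2, Coord n)) ∞
      (fun p : ℝ × M => Φ (p.1, e p.2)) (0, a) := hΦ.contMDiffAt.comp (0, a) hpair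
  have heval : ContMDiffAt (𝓘(ℝ, ℝ).prod (𝓡 n)) 𝓘(ℝ, Coord n) ∞
      (fun p : ℝ × M => Φ (p.1, e p.2) ⟨1, hone⟩) (0, a) :=
    (ContinuousMap.evalCLM ℝ (⟨1, hone⟩ : Set.Icc (-2 : ℝ) 2)).contDiff.contMDiff.contMDiffAt.comp
      (0, a) hΦ'
  have heval0 : Φ (0, e a) ⟨1, hone⟩ = e a := by rw [hΦ0]; rfl
  have hsmooth : ContMDiffAt (𝓘(ℝ, ℝ).prod (𝓡 n)) (𝓡 n) ∞
      (fun p : ℝ × M => e.symm (Φ (p.1, e p.2) ⟨1, hone⟩)) (0, a) := by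
    refine ContMDiffAt.comp (0, a) ?_ heval
    rw [heval0]
    exact contMDiffAt_chart_symm a hat
  refine hsmooth.congr_of_eventuallyEq ?_
  -- Sup-distance less than r/2 from the constant curve keeps the whole curve where the cut-off is
  -- 1.
  have hnear : ∀ᶠ p : ℝ × M in nhds (0, a), Φ (p.1, e p.2) ∈ Metric.ball (constCurve _ (e a))
      (r / 2) := by
    refine hΦ'.continuousAt.preimage_mem_nhds ?_
    rw [hΦ0]
    exact Metric.ball_mem_nhds _ (by positivity)
  have hsol' := hpair.continuousAt.eventually hsol
  have hsrc : ∀ᶠ p : ℝ × M in nhds (0, a), p.2 ∈ e.source :=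
    continuousAt_snd.preimage_mem_nhds (extChartAt_source_mem_nhds a)
  filter_upwards [hnear, hsol', hsrc] with p hp1 hp2 hp3
  obtain ⟨hinit, hder⟩ := hp2
  have hin : ∀ s : ℝ, extendCurve (Φ (p.1, e p.2)) s ∈ Metric.closedBall (e a) (r / 2) := by
    intro s
    exact ((ContinuousMap.dist_apply_le_dist _).trans (Metric.mem_ball.1 hp1).le)
  have htgt : ∀ s : ℝ, extendCurve (Φ (p.1, e p.2)) s ∈ e.target := fun s =>
    hball (Metric.closedBall_subset_closedBall (by linarith) (hin s))
  have hcurve : IsMIntegralCurveOn (fun s => e.symm (extendCurve (Φ (p.1, e p.2)) s)) (p.1 • X)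
      (Set.Ioo (-2) 2) := by
    intro s hs
    have h1 := (hder s hs).hasFDerivAt.hasMFDerivAt
    have h2 := (mdifferentiableAt_chart_symm a (htgt s)).hasMFDerivAt
    refine ((h2.comp s h1).congr_mfderiv ?_).hasMFDerivWithinAt
    rw [b.one_of_mem_closedBall (hin s), one_smul]
    ext
    have h3 := mfderiv_symm_chartField X a (htgt s)
    exact (congrArg _ (one_smul ℝ _)).trans
      (((map_smul _ p.1 _).trans (congrArg _ h3)).trans (one_smul ℝ _).symm)
  have hflow : IsMIntegralCurveOn (fun s => fieldFlow hc (s * p.1) p.2) (p.1 • X)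
      (Set.Ioo (-2) 2) :=
    ((isMIntegralCurve_fieldFlow hc p.2).comp_mul p.1).isMIntegralCurveOn _
  have heq := isMIntegralCurveOn_Ioo_eqOn_of_contMDiff_boundaryless (t₀ := 0) (by norm_num)
    (v := p.1 • X) (hX.contMDiff_one.const_smul_section (a := p.1)) hflow hcurve (by
      simp only [zero_mul, fieldFlow_zero]
      rw [hinit]
      exact (e.left_inv hp3).symm)
  have h1 := heq (show (1 : ℝ) ∈ Set.Ioo (-2 : ℝ) 2 by norm_num)
  simp only [one_mul] at h1
  rw [h1, extendCurve_of_mem _ hone]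

/-- The flow of a complete smooth vector field is smooth. -/
theorem contMDiff_fieldFlow (hX : IsSmoothField X) :
    ContMDiff (𝓘(ℝ, ℝ).prod (𝓡 n)) (𝓡 n) ∞ (fun p : ℝ × M => fieldFlow hc p.1 p.2) := by
  rintro ⟨t, x⟩
  -- For finite order k, being C^k at a point is an open condition; this is not available for order
  -- ∞.
  rw [contMDiffAt_infty]
  intro k
  have hcurve : Continuous fun s : ℝ => fieldFlow hc s x :=
    (isMIntegralCurve_fieldFlow hc x).continuous
  have hev : ∀ y : M, ∀ᶠ p : ℝ × M in nhds (0, y),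
      ContMDiffAt (𝓘(ℝ, ℝ).prod (𝓡 n)) (𝓡 n) k (fun p : ℝ × M => fieldFlow hc p.1 p.2) p :=
    fun y => (contMDiffAt_iff_contMDiffAt_nhds (by simp)).1
      ((contMDiffAt_fieldFlow_zero hc hX y).of_le (by exact_mod_cast le_top))
  -- Compactness of the orbit segment gives one time step t/N for which the step map is C^k at all
  -- its points; the time-t map is then an N-fold composition.
  have hK : IsCompact ((fun r : ℝ => fieldFlow hc (r * t) x) '' Set.Icc 0 1) :=
    isCompact_Icc.image (hcurve.comp (continuous_mul_const t))
  have hunif := hK.eventually_forall_of_forall_eventually (x₀ := (0 : ℝ))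
    (P := fun s y => ContMDiffAt (𝓘(ℝ, ℝ).prod (𝓡 n)) (𝓡 n) k
      (fun p : ℝ × M => fieldFlow hc p.1 p.2) (s, y)) fun y _ => hev y
  have hlim : Filter.Tendsto (fun N : ℕ => t / (N : ℝ)) Filter.atTop (nhds 0) :=
    tendsto_const_div_atTop_nhds_zero_nat t
  obtain ⟨N, hN, hNpos⟩ := ((hlim.eventually hunif).and (Filter.eventually_gt_atTop 0)).exists
  have hN' : (N : ℝ) ≠ 0 := by positivity
  have hstep : ∀ j : ℕ, j ≤ N →
      ContMDiffAt (𝓡 n) (𝓡 n) k (fun y => fieldFlow hc (j * (t / N)) y) x := by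
    intro j
    induction j with
    | zero =>
      intro _
      simp only [Nat.cast_zero, zero_mul, fieldFlow_zero]
      exact contMDiffAt_id
    | succ j ih =>
      intro hj
      have h1 := ih (by omega)
      have h2 := hN (fieldFlow hc (j * (t / N)) x) ⟨j / N, ⟨by positivity, by
        rw [div_le_one (by positivity)]; exact_mod_cast (by omega : j ≤ N)⟩, by
          simp only; congr 1; field_simp⟩
      have h3 : ContMDiffAt (𝓡 n) (𝓘(ℝ, ℝ).prod (𝓡 n)) k
          (fun y => (t / (N : ℝ), fieldFlow hc (j * (t / N)) y)) x := contMDiffAt_const.prodMk h1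
      have h4 := ContMDiffAt.comp x h2 h3
      refine h4.congr_of_eventuallyEq (Filter.Eventually.of_forall fun y => ?_)
      simp only [Function.comp_apply]
      rw [← fieldFlow_add hc hX]
      congr 1
      push_cast
      ring
  have ht : ContMDiffAt (𝓡 n) (𝓡 n) k (fun y => fieldFlow hc t y) x := by
    have h := hstep N le_rfl
    rwa [mul_div_cancel₀ t hN'] at h
  -- Near (t, x) the flow is the flow at the small time p.1 - t applied after the fixed time-t map.
  have h1 : ContMDiffAt (𝓘(ℝ, ℝ).prod (𝓡 n)) (𝓘(ℝ, ℝ).prod (𝓡 n)) k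
      (fun p : ℝ × M => (p.1 - t, fieldFlow hc t p.2)) (t, x) := by
    refine ContMDiffAt.prodMk ?_ (ContMDiffAt.comp (t, x) (g := fun y => fieldFlow hc t y) ht
      contMDiffAt_snd)
    exact (contDiff_id.sub contDiff_const).contMDiff.contMDiffAt.comp (t, x)
      (g := fun s : ℝ => s - t) contMDiffAt_fst
  have h2 : ContMDiffAt (𝓘(ℝ, ℝ).prod (𝓡 n)) (𝓡 n) k (fun p : ℝ × M => fieldFlow hc p.1 p.2)
      (t - t, fieldFlow hc t x) := by
    rw [sub_self]
    exact (hev _).self_of_nhds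
  refine (ContMDiffAt.comp (t, x) h2 h1).congr_of_eventuallyEq
    (Filter.Eventually.of_forall fun p => ?_)
  simp only [Function.comp_apply]
  rw [← fieldFlow_add hc hX, sub_add_cancel]

end Flow

/-! ### Matrices as bilinear forms on `ℝⁿ` -/

section Bilinear

variable {n : ℕ}

/-- The standard basis vectors of `ℝⁿ`. -/
noncomputable abbrev stdVec (i : Fin n) : Coord n := EuclideanSpace.single i (1 : ℝ)

theorem eq_sum_stdVec (v : Coord n) : v = ∑ i, v i • stdVec i := by
  ext j
  simp [Pi.single_apply]

theorem clm_ext_stdVec {F : Type*} [AddCommGroup F] [Module ℝ F] [TopologicalSpace F]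
    {A B : Coord n →L[ℝ] F} (h : ∀ i, A (stdVec i) = B (stdVec i)) : A = B := by
  ext v
  rw [eq_sum_stdVec v]
  simp [map_sum, h]

/-- The bilinear form with matrix `A`. -/
noncomputable def bil (A : Matrix (Fin n) (Fin n) ℝ) : Coord n →L[ℝ] Coord n →L[ℝ] ℝ :=
  ∑ i, ∑ j, A i j • (EuclideanSpace.proj i : Coord n →L[ℝ] ℝ).smulRight
    (EuclideanSpace.proj j : Coord n →L[ℝ] ℝ)

theorem bil_apply (A : Matrix (Fin n) (Fin n) ℝ) (v w : Coord n) :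
    bil A v w = ∑ i, ∑ j, A i j * (v i * w j) := by
  simp [bil]

theorem bil_stdVec (A : Matrix (Fin n) (Fin n) ℝ) (i j : Fin n) :
    bil A (stdVec i) (stdVec j) = A i j := by
  simp [bil_apply]

theorem bil_smul (c : ℝ) (A : Matrix (Fin n) (Fin n) ℝ) : bil (c • A) = c • bil A := by
  ext v w
  simp [bil_apply, Finset.mul_sum, mul_assoc]

theorem bil_injective : Function.Injective (bil : Matrix (Fin n) (Fin n) ℝ → _) := by
  intro A B h
  ext i j
  rw [← bil_stdVec A, h, bil_stdVec]

theorem bil_symm {A : Matrix (Fin n) (Fin n) ℝ} (hA : A.IsSymm) (v w : Coord n) :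
    bil A v w = bil A w v := by
  rw [bil_apply, bil_apply, Finset.sum_comm]
  refine Finset.sum_congr rfl fun i _ => Finset.sum_congr rfl fun j _ => ?_
  rw [hA.apply i j]
  ring

/-- The matrix of a linear map. -/
noncomputable def jac (L : Coord n →L[ℝ] Coord n) : Matrix (Fin n) (Fin n) ℝ :=
  Matrix.of fun k i => L (stdVec i) k

theorem apply_eq_sum_jac (L : Coord n →L[ℝ] Coord n) (v : Coord n) (k : Fin n) :
    L v k = ∑ i, jac L k i * v i := by
  conv_lhs => rw [eq_sum_stdVec v]
  simp [jac, map_sum, mul_comm]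

theorem bil_pull (L : Coord n →L[ℝ] Coord n) (A : Matrix (Fin n) (Fin n) ℝ) (v w : Coord n) :
    bil ((jac L).transpose * A * jac L) v w = bil A (L v) (L w) := by
  have h : bil ((jac L).transpose * A * jac L) = (bil A).bilinearComp L L := by
    refine clm_ext_stdVec fun i => clm_ext_stdVec fun j => ?_
    rw [bil_stdVec]
    simp only [ContinuousLinearMap.bilinearComp_apply, bil_apply, Matrix.mul_apply,
      Matrix.transpose_apply, Finset.sum_mul, jac, Matrix.of_apply]
    rw [Finset.sum_comm]
    refine Finset.sum_congr rfl fun a _ => Finset.sum_congr rfl fun b _ => ?_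
    ring
  rw [h]
  rfl

theorem jac_bijective {L : Coord n →L[ℝ] Coord n} (hL : IsUnit (jac L).det) :
    Function.Bijective L := by
  have h : (L : Coord n →ₗ[ℝ] Coord n) =
      Matrix.toLin (EuclideanSpace.basisFun (Fin n) ℝ).toBasis
        (EuclideanSpace.basisFun (Fin n) ℝ).toBasis (jac L) := by
    refine (EuclideanSpace.basisFun (Fin n) ℝ).toBasis.ext fun i => ?_
    rw [Matrix.toLin_self]
    ext k
    simp [jac, stdVec, Pi.single_apply]
  have hu : IsUnit (Matrix.toLin (EuclideanSpace.basisFun (Fin n) ℝ).toBasis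
        (EuclideanSpace.basisFun (Fin n) ℝ).toBasis (jac L)) := by
    have := ((Matrix.isUnit_iff_isUnit_det _).2 hL).map
      (Matrix.toLinAlgEquiv (EuclideanSpace.basisFun (Fin n) ℝ).toBasis)
    exact this
  rw [← h] at hu
  exact (Module.End.isUnit_iff _).1 hu

theorem bil_nondegenerate {A : Matrix (Fin n) (Fin n) ℝ} (hA : IsUnit A.det) {v v' : Coord n}
    (h : ∀ w, bil A v w = bil A v' w) : v = v' := by
  have key : ∀ u : Coord n, (∀ w, bil A u w = 0) → u = 0 := by
    intro u hu
    have h1 : Matrix.vecMul (fun i => u i) A = 0 := by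
      ext j
      have := hu (stdVec j)
      rw [bil_apply] at this
      simpa [Matrix.vecMul, dotProduct, Pi.single_apply, mul_comm] using this
    have h2 := Matrix.eq_zero_of_vecMul_eq_zero hA.ne_zero h1
    ext i
    exact congrFun h2 i
  rw [← sub_eq_zero]
  refine key _ fun w => ?_
  simp [h w]

end Bilinear

/-! ### Christoffel symbols as bilinear maps -/

section Christoffel

variable {n : ℕ}

/-- `G` is a smooth field of nondegenerate symmetric matrices on the open set `V`. -/
structure IsMetricOn (G : MatField n) (V : Set (Coord n)) : Prop where
  isOpen : IsOpen V
  smooth : ∀ i j, ContDiffOn ℝ ∞ (fun z => G z i j) V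
  symm : ∀ y ∈ V, (G y).IsSymm
  det : ∀ y ∈ V, IsUnit (G y).det

theorem contDiffOn_bil {X : Type*} [NormedAddCommGroup X] [NormedSpace ℝ X]
    {G : X → Matrix (Fin n) (Fin n) ℝ} {V : Set X}
    (h : ∀ i j, ContDiffOn ℝ ∞ (fun z => G z i j) V) : ContDiffOn ℝ ∞ (fun z => bil (G z)) V := by
  unfold bil
  exact ContDiffOn.sum fun i _ => ContDiffOn.sum fun j _ => 
    (ContinuousLinearMap.toSpanSingleton ℝ _).contDiff.comp_contDiffOn (h i j)

theorem IsMetricOn.contDiffAt_bil {G : MatField n} {V : Set (Coord n)} (hG : IsMetricOn G V)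
    {y : Coord n} (hy : y ∈ V) : ContDiffAt ℝ ∞ (fun z => bil (G z)) y :=
  (contDiffOn_bil hG.smooth).contDiffAt (hG.isOpen.mem_nhds hy)

theorem IsMetricOn.hasFDerivAt_bil {G : MatField n} {V : Set (Coord n)} (hG : IsMetricOn G V)
    {y : Coord n} (hy : y ∈ V) :
    HasFDerivAt (fun z => bil (G z)) (fderiv ℝ (fun z => bil (G z)) y) y :=
  ((hG.contDiffAt_bil hy).differentiableAt (by simp)).hasFDerivAt

theorem fderiv_bil_apply {G : MatField n} {y : Coord n}
    (h : DifferentiableAt ℝ (fun z => bil (G z)) y) (u v w : Coord n) :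
    fderiv ℝ (fun z => bil (G z)) y u v w = fderiv ℝ (fun z => bil (G z) v w) y u := by
  have h1 := (h.hasFDerivAt.clm_apply (hasFDerivAt_const v y)).clm_apply (hasFDerivAt_const w y)
  rw [h1.fderiv]
  simp

theorem fderiv_bil_stdVec {G : MatField n} {y : Coord n}
    (h : DifferentiableAt ℝ (fun z => bil (G z)) y) (i j k : Fin n) :
    fderiv ℝ (fun z => bil (G z)) y (stdVec k) (stdVec i) (stdVec j) =
      pderiv k (fun z => G z i j) y := by
  rw [fderiv_bil_apply h]
  simp only [bil_stdVec, pderiv]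

theorem fderiv_bil_symm {G : MatField n} {V : Set (Coord n)} (hG : IsMetricOn G V)
    {y : Coord n} (hy : y ∈ V) (u v w : Coord n) :
    fderiv ℝ (fun z => bil (G z)) y u v w = fderiv ℝ (fun z => bil (G z)) y u w v := by
  have hd := (hG.contDiffAt_bil hy).differentiableAt (by simp)
  rw [fderiv_bil_apply hd, fderiv_bil_apply hd]
  have : (fun z => bil (G z) v w) =ᶠ[nhds y] fun z => bil (G z) w v := by
    filter_upwards [hG.isOpen.mem_nhds hy] with z hz using bil_symm (hG.symm z hz) v w
  rw [this.fderiv_eq]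

/-- The bilinear map with coefficients `Γᵏᵢⱼ`. -/
noncomputable def bilVec (c : Fin n → Fin n → Fin n → ℝ) : Coord n →L[ℝ] Coord n →L[ℝ] Coord n :=
  ∑ k, ∑ i, ∑ j, c k i j • (EuclideanSpace.proj i : Coord n →L[ℝ] ℝ).smulRight
    ((EuclideanSpace.proj j : Coord n →L[ℝ] ℝ).smulRight (stdVec k))

theorem bilVec_apply (c : Fin n → Fin n → Fin n → ℝ) (v w : Coord n) (k : Fin n) :
    bilVec c v w k = ∑ i, ∑ j, c k i j * (v i * w j) := by
  simp [bilVec, Pi.single_apply]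

theorem bilVec_stdVec (c : Fin n → Fin n → Fin n → ℝ) (i j k : Fin n) :
    bilVec c (stdVec i) (stdVec j) k = c k i j := by
  simp [bilVec_apply]

/-- The Christoffel symbols as a bilinear map. -/
noncomputable def chr (G : MatField n) (y : Coord n) : Coord n →L[ℝ] Coord n →L[ℝ] Coord n :=
  bilVec fun k i j => christoffel G k i j y

theorem chr_stdVec (G : MatField n) (y : Coord n) (i j k : Fin n) :
    chr G y (stdVec i) (stdVec j) k = christoffel G k i j y := bilVec_stdVec _ i j k

/-- Allows a multilinear identity to be checked on basis vectors one argument at a time, without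
bundling its two sides. -/
theorem isLinearMap_ext_stdVec {f g : Coord n → ℝ} (hf : IsLinearMap ℝ f) (hg : IsLinearMap ℝ g)
    (h : ∀ i, f (stdVec i) = g (stdVec i)) (v : Coord n) : f v = g v := by
  have : hf.mk' f = hg.mk' g :=
    (EuclideanSpace.basisFun (Fin n) ℝ).toBasis.ext fun i => by simpa using h i
  exact LinearMap.congr_fun this v

/-- The Koszul formula. -/
theorem bil_chr {G : MatField n} {V : Set (Coord n)} (hG : IsMetricOn G V) {y : Coord n}
    (hy : y ∈ V) (v w z : Coord n) :
    bil (G y) (chr G y v w) z = (1 / 2) * (fderiv ℝ (fun z => bil (G z)) y v w z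
      + fderiv ℝ (fun z => bil (G z)) y w v z - fderiv ℝ (fun z => bil (G z)) y z v w) := by
  have hd := (hG.contDiffAt_bil hy).differentiableAt (by simp)
  set D := fderiv ℝ (fun z => bil (G z)) y with hD
  -- On basis vectors the factor G cancels the inverse Gram matrix in the definition of the
  -- Christoffel symbols.
  have key : ∀ i j k, bil (G y) (chr G y (stdVec i) (stdVec j)) (stdVec k) =
      (1 / 2) * (D (stdVec i) (stdVec j) (stdVec k) + D (stdVec j) (stdVec i) (stdVec k)
        - D (stdVec k) (stdVec i) (stdVec j)) := by
    intro i j k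
    simp only [hD, fderiv_bil_stdVec hd]
    rw [bil_apply]
    simp only [chr_stdVec, christoffel]
    have h1 : (G y).transpose * (G y)⁻¹ = 1 := by
      rw [(hG.symm y hy).eq, Matrix.mul_nonsing_inv _ (hG.det y hy)]
    have h2 : ∀ l, ∑ a, G y a k * (G y)⁻¹ a l = if k = l then 1 else 0 := by
      intro l
      have := congrFun (congrFun h1 k) l
      rwa [Matrix.mul_apply, Matrix.one_apply] at this
    have h3 : ∀ f : Fin n → ℝ, ∑ x, f x * (stdVec k : Coord n) x = f k := fun f => by
      simp
    simp only [← mul_assoc, h3]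
    set K : Fin n → ℝ := fun l => pderiv i (fun z => G z j l) y + pderiv j (fun z => G z i l) y
      - pderiv l (fun z => G z i j) y with hK
    simp only [mul_assoc]
    calc ∑ a, G y a k * (1 / 2 * ∑ l, (G y)⁻¹ a l * K l)
        = (1 / 2) * ∑ l, (∑ a, G y a k * (G y)⁻¹ a l) * K l := by
          simp only [Finset.mul_sum, Finset.sum_mul]
          rw [Finset.sum_comm]
          refine Finset.sum_congr rfl fun a _ => Finset.sum_congr rfl fun b _ => ?_
          ring
      _ = 1 / 2 * K k := by simp [h2]
  refine isLinearMap_ext_stdVec (f := fun z => bil (G y) (chr G y v w) z)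
    (g := fun z => 1 / 2 * (D v w z + D w v z - D z v w))
    ⟨?_, ?_⟩ ⟨?_, ?_⟩ (fun k => ?_) z
  rotate_right
  · refine isLinearMap_ext_stdVec (f := fun w => bil (G y) (chr G y v w) (stdVec k))
      (g := fun w => 1 / 2 * (D v w (stdVec k) + D w v (stdVec k) - D (stdVec k) v w))
      ⟨?_, ?_⟩ ⟨?_, ?_⟩ (fun j => ?_) w
    rotate_right
    · refine isLinearMap_ext_stdVec (f := fun v => bil (G y) (chr G y v (stdVec j)) (stdVec k))
        (g := fun v => 1 / 2 * (D v (stdVec j) (stdVec k) + D (stdVec j) v (stdVec k)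
          - D (stdVec k) v (stdVec j))) ⟨?_, ?_⟩ ⟨?_, ?_⟩ (fun i => key i j k) v
      all_goals intros; simp; try ring
    all_goals intros; simp; try ring
  all_goals intros; simp; try ring

end Christoffel

/-! ### Smoothness of the Christoffel symbols and of the curvature -/

section Smoothness

variable {n : ℕ}

theorem contDiffOn_det {X : Type*} [NormedAddCommGroup X] [NormedSpace ℝ X]
    {G : X → Matrix (Fin n) (Fin n) ℝ} {W : Set X}
    (h : ∀ i j, ContDiffOn ℝ ∞ (fun z => G z i j) W) : ContDiffOn ℝ ∞ (fun z => (G z).det) W := by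
  simp only [Matrix.det_apply']
  exact ContDiffOn.sum fun σ _ => contDiffOn_const.mul (contDiffOn_prod fun i _ => h _ _)

theorem contDiffOn_inv {X : Type*} [NormedAddCommGroup X] [NormedSpace ℝ X]
    {G : X → Matrix (Fin n) (Fin n) ℝ} {W : Set X}
    (h : ∀ i j, ContDiffOn ℝ ∞ (fun z => G z i j) W) (hdet : ∀ z ∈ W, IsUnit (G z).det)
    (i j : Fin n) : ContDiffOn ℝ ∞ (fun z => (G z)⁻¹ i j) W := by
  simp only [Matrix.inv_def, Ring.inverse_eq_inv', Matrix.smul_apply, smul_eq_mul,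
    Matrix.adjugate_apply]
  refine ((contDiffOn_det h).inv fun z hz => (hdet z hz).ne_zero).mul
    (contDiffOn_det fun k l => ?_)
  simp only [Matrix.updateRow_apply]
  split_ifs
  · exact contDiffOn_const
  · exact h k l

/-- A partial derivative at fixed ρ is the joint derivative in a direction (0, eᵢ). This yields
smoothness jointly in (ρ, y), needed because the curvature of γ_ρ is later differentiated in ρ. -/
theorem pderiv_param {f : ℝ × Coord n → ℝ} {W : Set (ℝ × Coord n)} (hW : IsOpen W)
    (hf : ContDiffOn ℝ ∞ f W) {p : ℝ × Coord n} (hp : p ∈ W) (i : Fin n) :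
    pderiv i (fun z => f (p.1, z)) p.2 = fderiv ℝ f p (0, stdVec i) := by
  have h1 : HasFDerivAt f (fderiv ℝ f p) (p.1, p.2) :=
    ((hf.contDiffAt (hW.mem_nhds hp)).differentiableAt (by simp)).hasFDerivAt
  have h2 := h1.comp p.2 (hasFDerivAt_prodMk_right p.1 p.2)
  have h3 : fderiv ℝ (fun z => f (p.1, z)) p.2 = _ := h2.fderiv
  rw [pderiv, h3]
  rfl

theorem contDiffOn_pderiv_param {f : ℝ × Coord n → ℝ} {W : Set (ℝ × Coord n)} (hW : IsOpen W)
    (hf : ContDiffOn ℝ ∞ f W) (i : Fin n) :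
    ContDiffOn ℝ ∞ (fun p : ℝ × Coord n => pderiv i (fun z => f (p.1, z)) p.2) W :=
  ((hf.fderiv_of_isOpen hW (m := ∞) (by simp)).clm_apply contDiffOn_const).congr
    fun _ hp => pderiv_param hW hf hp i

theorem contDiffOn_christoffel_param {γ : ℝ → MatField n} {W : Set (ℝ × Coord n)} (hW : IsOpen W)
    (h : ∀ i j, ContDiffOn ℝ ∞ (fun p : ℝ × Coord n => γ p.1 p.2 i j) W)
    (hdet : ∀ p ∈ W, IsUnit (γ p.1 p.2).det) (k i j : Fin n) :
    ContDiffOn ℝ ∞ (fun p : ℝ × Coord n => christoffel (γ p.1) k i j p.2) W := by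
  unfold christoffel
  have hp := fun a b c => contDiffOn_pderiv_param hW (h b c) a
  exact contDiffOn_const.mul (ContDiffOn.sum fun l _ =>
    (contDiffOn_inv h hdet k l).mul (((hp i j l).add (hp j i l)).sub (hp l i j)))

theorem contDiffOn_ricci_param {γ : ℝ → MatField n} {W : Set (ℝ × Coord n)} (hW : IsOpen W)
    (h : ∀ i j, ContDiffOn ℝ ∞ (fun p : ℝ × Coord n => γ p.1 p.2 i j) W)
    (hdet : ∀ p ∈ W, IsUnit (γ p.1 p.2).det) (i j : Fin n) :
    ContDiffOn ℝ ∞ (fun p : ℝ × Coord n => ricci (γ p.1) p.2 i j) W := by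
  have hc := contDiffOn_christoffel_param hW h hdet
  have hp := fun a k i j => contDiffOn_pderiv_param hW (hc k i j) a
  simp only [ricci, Matrix.of_apply]
  exact (ContDiffOn.sum fun k _ => (hp k k i j).sub (hp j k i k)).add
    (ContDiffOn.sum fun k _ => ContDiffOn.sum fun l _ =>
      ((hc k k l).mul (hc l i j)).sub ((hc k j l).mul (hc l i k)))

theorem contDiffOn_metricTrace {X : Type*} [NormedAddCommGroup X] [NormedSpace ℝ X]
    {G A : X → Matrix (Fin n) (Fin n) ℝ} {W : Set X}
    (h : ∀ i j, ContDiffOn ℝ ∞ (fun z => G z i j) W) (hdet : ∀ z ∈ W, IsUnit (G z).det)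
    (hA : ∀ i j, ContDiffOn ℝ ∞ (fun z => A z i j) W) :
    ContDiffOn ℝ ∞ (fun z => metricTrace (G z) (A z)) W := by
  unfold metricTrace
  exact ContDiffOn.sum fun i _ => ContDiffOn.sum fun j _ =>
    (contDiffOn_inv h hdet i j).mul (hA i j)

theorem contDiffOn_const_family {f : Coord n → ℝ} {V : Set (Coord n)} (hf : ContDiffOn ℝ ∞ f V) :
    ContDiffOn ℝ ∞ (fun p : ℝ × Coord n => f p.2) (Set.univ ×ˢ V) :=
  hf.comp contDiffOn_snd fun _ hp => hp.2

theorem contDiffOn_of_family {f : ℝ → Coord n → ℝ} {V : Set (Coord n)}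
    (hf : ContDiffOn ℝ ∞ (fun p : ℝ × Coord n => f p.1 p.2) (Set.univ ×ˢ V)) (ρ : ℝ) :
    ContDiffOn ℝ ∞ (f ρ) V :=
  hf.comp (contDiffOn_const (c := ρ) |>.prodMk contDiffOn_id) fun _ hy => ⟨trivial, hy⟩

theorem contDiffOn_pderiv {f : Coord n → ℝ} {V : Set (Coord n)} (hV : IsOpen V)
    (hf : ContDiffOn ℝ ∞ f V) (i : Fin n) : ContDiffOn ℝ ∞ (pderiv i f) V :=
  (hf.fderiv_of_isOpen hV (m := ∞) (by simp)).clm_apply contDiffOn_const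

variable {G : MatField n} {V : Set (Coord n)} (hG : IsMetricOn G V)

include hG

theorem IsMetricOn.contDiffOn_christoffel (k i j : Fin n) :
    ContDiffOn ℝ ∞ (christoffel G k i j) V :=
  contDiffOn_of_family (f := fun _ => christoffel G k i j)
    (contDiffOn_christoffel_param (γ := fun _ => G) (isOpen_univ.prod hG.isOpen)
      (fun i j => contDiffOn_const_family (hG.smooth i j)) (fun _ hp => hG.det _ hp.2) k i j) 0

theorem IsMetricOn.contDiffOn_ricci (i j : Fin n) :
    ContDiffOn ℝ ∞ (fun y => ricci G y i j) V :=
  contDiffOn_of_family (f := fun _ y => ricci G y i j)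
    (contDiffOn_ricci_param (γ := fun _ => G) (isOpen_univ.prod hG.isOpen)
      (fun i j => contDiffOn_const_family (hG.smooth i j)) (fun _ hp => hG.det _ hp.2) i j) 0

theorem IsMetricOn.contDiffOn_hessian {u : Coord n → ℝ} (hu : ContDiffOn ℝ ∞ u V) (i j : Fin n) :
    ContDiffOn ℝ ∞ (fun y => hessian G u y i j) V := by
  simp only [hessian, Matrix.of_apply]
  exact (contDiffOn_pderiv hG.isOpen (contDiffOn_pderiv hG.isOpen hu j) i).sub
    (ContDiffOn.sum fun k _ => (hG.contDiffOn_christoffel k i j).mul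
      (contDiffOn_pderiv hG.isOpen hu k))

theorem IsMetricOn.contDiffOn_chr : ContDiffOn ℝ ∞ (chr G) V := by
  unfold chr bilVec
  exact ContDiffOn.sum fun k _ => ContDiffOn.sum fun i _ => ContDiffOn.sum fun j _ =>
    (ContinuousLinearMap.toSpanSingleton ℝ _).contDiff.comp_contDiffOn
      (hG.contDiffOn_christoffel k i j)

theorem IsMetricOn.differentiableAt_chr {y : Coord n} (hy : y ∈ V) :
    DifferentiableAt ℝ (chr G) y :=
  ((hG.contDiffOn_chr).contDiffAt (hG.isOpen.mem_nhds hy)).differentiableAt (by simp)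

end Smoothness

/-! ### Naturality of the Christoffel symbols, the Hessian and the Ricci curvature -/

section Naturality

theorem two_le_infty : (2 : WithTop ℕ∞) ≤ ∞ := WithTop.coe_le_coe.2 (le_top : (2 : ℕ∞) ≤ ⊤)

variable {n : ℕ}

/-- `F` is a smooth map from the open set `U` to `V` with invertible derivative. -/
structure IsLocalDiffeo (F : Coord n → Coord n) (U V : Set (Coord n)) : Prop where
  isOpen : IsOpen U
  smooth : ContDiffOn ℝ ∞ F U
  mapsTo : Set.MapsTo F U V
  det : ∀ y ∈ U, IsUnit (jac (fderiv ℝ F y)).det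

/-- The pullback of a covariant 2-tensor. -/
noncomputable def pullMat (F : Coord n → Coord n) (A : MatField n) : MatField n := fun y =>
  (jac (fderiv ℝ F y)).transpose * A (F y) * jac (fderiv ℝ F y)

variable {F : Coord n → Coord n} {U V : Set (Coord n)}

namespace IsLocalDiffeo

variable (hF : IsLocalDiffeo F U V) {y : Coord n} (hy : y ∈ U)

include hF hy

theorem contDiffAt : ContDiffAt ℝ ∞ F y := hF.smooth.contDiffAt (hF.isOpen.mem_nhds hy)

theorem hasFDerivAt : HasFDerivAt F (fderiv ℝ F y) y :=
  ((hF.contDiffAt hy).differentiableAt (by simp)).hasFDerivAt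

theorem hasFDerivAt_fderiv : HasFDerivAt (fderiv ℝ F) (fderiv ℝ (fderiv ℝ F) y) y :=
  (((hF.contDiffAt hy).fderiv_right (m := ∞) (by simp)).differentiableAt (by simp)).hasFDerivAt

theorem fderiv_fderiv_symm (v w : Coord n) :
    fderiv ℝ (fderiv ℝ F) y v w = fderiv ℝ (fderiv ℝ F) y w v :=
  ((hF.contDiffAt hy).isSymmSndFDerivAt (by simpa using two_le_infty)) v w

theorem bijective : Function.Bijective (fderiv ℝ F y) := jac_bijective (hF.det y hy)

end IsLocalDiffeo

variable (hF : IsLocalDiffeo F U V) {G G' : MatField n} (hG : IsMetricOn G V)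
  (hG' : ∀ y ∈ U, G' y = pullMat F G y)

include hF in
theorem contDiffOn_pullMat {A : MatField n} (hA : ∀ i j, ContDiffOn ℝ ∞ (fun z => A z i j) V)
    (i j : Fin n) : ContDiffOn ℝ ∞ (fun y => pullMat F A y i j) U := by
  have hJ : ∀ k i, ContDiffOn ℝ ∞ (fun y => jac (fderiv ℝ F y) k i) U := fun k i => by
    have h1 : ContDiffOn ℝ ∞ (fun y => fderiv ℝ F y (stdVec i)) U :=
      (hF.smooth.fderiv_of_isOpen hF.isOpen (m := ∞) (by simp)).clm_apply contDiffOn_const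
    exact (EuclideanSpace.proj k : Coord n →L[ℝ] ℝ).contDiff.comp_contDiffOn h1
  simp only [pullMat, Matrix.mul_apply, Matrix.transpose_apply]
  exact ContDiffOn.sum fun k _ => (ContDiffOn.sum fun l _ => (hJ l i).mul
    ((hA l k).comp hF.smooth hF.mapsTo)).mul (hJ k j)

include hF hG hG' in
theorem IsMetricOn.pull : IsMetricOn G' U where
  isOpen := hF.isOpen
  smooth i j := (contDiffOn_pullMat hF hG.smooth i j).congr fun y hy => by rw [hG' y hy]
  symm y hy := by
    rw [hG' y hy, pullMat, Matrix.IsSymm, Matrix.transpose_mul, Matrix.transpose_mul,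
      Matrix.transpose_transpose, (hG.symm _ (hF.mapsTo hy)).eq, Matrix.mul_assoc]
  det y hy := by
    rw [hG' y hy, pullMat, Matrix.det_mul, Matrix.det_mul, Matrix.det_transpose]
    exact ((hF.det y hy).mul (hG.det _ (hF.mapsTo hy))).mul (hF.det y hy)

include hF hG hG' in
-- Product rule for G(F z)(dF v, dF w): one term from the moving base point and two from the second
-- derivative of F.
theorem fderiv_bil_pull {y : Coord n} (hy : y ∈ U) (u v w : Coord n) :
    fderiv ℝ (fun z => bil (G' z)) y u v w =
      fderiv ℝ (fun z => bil (G z)) (F y) (fderiv ℝ F y u) (fderiv ℝ F y v) (fderiv ℝ F y w)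
      + bil (G (F y)) (fderiv ℝ (fderiv ℝ F) y u v) (fderiv ℝ F y w)
      + bil (G (F y)) (fderiv ℝ F y v) (fderiv ℝ (fderiv ℝ F) y u w) := by
  have hd := ((IsMetricOn.pull hF hG hG').contDiffAt_bil hy).differentiableAt (by simp)
  rw [fderiv_bil_apply hd]
  have heq : (fun z => bil (G' z) v w) =ᶠ[nhds y]
      fun z => bil (G (F z)) (fderiv ℝ F z v) (fderiv ℝ F z w) := by
    filter_upwards [hF.isOpen.mem_nhds hy] with z hz
    rw [hG' z hz, pullMat, bil_pull]
  have h1 := HasFDerivAt.comp (g := fun z => bil (G z)) (f := F) y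
    (hG.hasFDerivAt_bil (hF.mapsTo hy)) (hF.hasFDerivAt hy)
  have h2 := fun v => (hF.hasFDerivAt_fderiv hy).clm_apply (hasFDerivAt_const v y)
  have h3 := (h1.clm_apply (h2 v)).clm_apply (h2 w)
  rw [heq.fderiv_eq, HasFDerivAt.fderiv (f := fun z => bil (G (F z)) (fderiv ℝ F z v)
    (fderiv ℝ F z w)) h3]
  simp
  ring

include hF hG hG' in
/-- The transformation law of the Christoffel symbols. -/
theorem fderiv_chr {y : Coord n} (hy : y ∈ U) (v w : Coord n) :
    fderiv ℝ F y (chr G' y v w) =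
      fderiv ℝ (fderiv ℝ F) y v w + chr G (F y) (fderiv ℝ F y v) (fderiv ℝ F y w) := by
  have hFy := hF.mapsTo hy
  -- It is enough to test against vectors dF z, since dF is onto. In the Koszul formula for G' six
  -- terms contain the second derivative of F. Symmetry cancels four of them and the other two add
  -- up to the inhomogeneous term.
  refine bil_nondegenerate (hG.det _ hFy) fun z' => ?_
  obtain ⟨z, rfl⟩ := (hF.bijective hy).2 z'
  have h1 : bil (G (F y)) (fderiv ℝ F y (chr G' y v w)) (fderiv ℝ F y z) =
      bil (G' y) (chr G' y v w) z := by rw [hG' y hy, pullMat, bil_pull]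
  rw [h1, bil_chr (IsMetricOn.pull hF hG hG') hy, map_add, add_apply,
    bil_chr hG hFy]
  simp only [fderiv_bil_pull hF hG hG' hy]
  rw [hF.fderiv_fderiv_symm hy w v, hF.fderiv_fderiv_symm hy z v, hF.fderiv_fderiv_symm hy z w,
    bil_symm (hG.symm _ hFy) (fderiv ℝ F y w) (fderiv ℝ (fderiv ℝ F) y v z)]
  ring

/-- `∇²u` as a bilinear form. -/
theorem bil_hessian {G : MatField n} {u : Coord n → ℝ} {y : Coord n}
    (hu : ContDiffAt ℝ ∞ u y) (v w : Coord n) :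
    bil (hessian G u y) v w = fderiv ℝ (fderiv ℝ u) y v w - fderiv ℝ u y (chr G y v w) := by
  have hd : DifferentiableAt ℝ (fderiv ℝ u) y :=
    (hu.fderiv_right (m := ∞) (by simp)).differentiableAt (by simp)
  have key : bil (hessian G u y) = fderiv ℝ (fderiv ℝ u) y -
      ((ContinuousLinearMap.compL ℝ (Coord n) (Coord n) ℝ) (fderiv ℝ u y)).comp (chr G y) := by
    refine clm_ext_stdVec fun i => clm_ext_stdVec fun j => ?_
    rw [bil_stdVec]
    have h1 : pderiv i (pderiv j u) y = fderiv ℝ (fderiv ℝ u) y (stdVec i) (stdVec j) := by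
      have := (hd.hasFDerivAt.clm_apply (hasFDerivAt_const (stdVec j) y)).fderiv
      rw [pderiv, show pderiv j u = fun z => fderiv ℝ u z (stdVec j) from rfl, this]
      simp
    have h2 : fderiv ℝ u y (chr G y (stdVec i) (stdVec j)) =
        ∑ k, christoffel G k i j y * pderiv k u y := by
      rw [eq_sum_stdVec (chr G y (stdVec i) (stdVec j)), map_sum]
      simp only [map_smul, chr_stdVec, smul_eq_mul, pderiv]
    simp only [hessian, Matrix.of_apply, h1, sub_apply,
      ContinuousLinearMap.comp_apply, ContinuousLinearMap.compL_apply, h2]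
  rw [key]
  rfl

theorem fderiv_fderiv_comp {F : Coord n → Coord n} {u : Coord n → ℝ} {y : Coord n}
    (hF : ContDiffAt ℝ ∞ F y) (hu : ContDiffAt ℝ ∞ u (F y)) (v w : Coord n) :
    fderiv ℝ (fderiv ℝ (u ∘ F)) y v w =
      fderiv ℝ (fderiv ℝ u) (F y) (fderiv ℝ F y v) (fderiv ℝ F y w)
        + fderiv ℝ u (F y) (fderiv ℝ (fderiv ℝ F) y v w) := by
  have hF1 : ∀ᶠ z in nhds y, DifferentiableAt ℝ F z := by
    have := (hF.of_le (m := 1) (by simp)).eventually (by simp)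
    filter_upwards [this] with z hz using hz.differentiableAt (by simp)
  have hu1 : ∀ᶠ z in nhds y, DifferentiableAt ℝ u (F z) := by
    have := (hu.of_le (m := 1) (by simp)).eventually (by simp)
    filter_upwards [hF.continuousAt.eventually this] with z hz using hz.differentiableAt (by simp)
  have heq : fderiv ℝ (u ∘ F) =ᶠ[nhds y] fun z => (fderiv ℝ u (F z)).comp (fderiv ℝ F z) := by
    filter_upwards [hF1, hu1] with z h1 h2 using fderiv_comp z h2 h1
  have h1 : HasFDerivAt (fderiv ℝ u) _ (F y) :=
    ((hu.fderiv_right (m := ∞) (by simp)).differentiableAt (by simp)).hasFDerivAt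
  have h2 : HasFDerivAt (fderiv ℝ F) _ y :=
    ((hF.fderiv_right (m := ∞) (by simp)).differentiableAt (by simp)).hasFDerivAt
  have h3 := (h1.comp y (hF.differentiableAt (by simp)).hasFDerivAt).clm_comp h2
  rw [heq.fderiv_eq, HasFDerivAt.fderiv (f := fun z => (fderiv ℝ u (F z)).comp (fderiv ℝ F z)) h3]
  simp [add_comm]

include hF hG hG' in
/-- Naturality of the Hessian. -/
theorem hessian_pull {u u' : Coord n → ℝ} (hu : ContDiffOn ℝ ∞ u V) (hu' : ∀ y ∈ U, u' y = u (F y))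
    {y : Coord n} (hy : y ∈ U) : hessian G' u' y = pullMat F (hessian G u) y := by
  have hFy := hF.mapsTo hy
  have huy := hu.contDiffAt (hG.isOpen.mem_nhds hFy)
  have heq : u' =ᶠ[nhds y] u ∘ F := by
    filter_upwards [hF.isOpen.mem_nhds hy] with z hz using hu' z hz
  have hu'y : ContDiffAt ℝ ∞ u' y := (huy.comp y (hF.contDiffAt hy)).congr_of_eventuallyEq heq
  refine bil_injective (ContinuousLinearMap.ext fun v => ContinuousLinearMap.ext fun w => ?_)
  -- The term du(d²F(v, w)) of the chain rule cancels the inhomogeneous term in the transformation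
  -- law of the Christoffel symbols.
  rw [bil_hessian hu'y, pullMat, bil_pull, bil_hessian huy, heq.fderiv.fderiv_eq,
    fderiv_fderiv_comp (hF.contDiffAt hy) huy, heq.fderiv_eq,
    fderiv_comp y (huy.differentiableAt (by simp)) (hF.hasFDerivAt hy).differentiableAt,
    ContinuousLinearMap.comp_apply, fderiv_chr hF hG hG' hy, map_add]
  ring

/-- The endomorphism `u ↦ (D_u Γ)(w,v) - (D_v Γ)(w,u) + Γ(u,Γ(w,v)) - Γ(v,Γ(w,u))`, whose trace is
the Ricci curvature. -/
noncomputable def curvEnd (G : MatField n) (y w v : Coord n) : Coord n →L[ℝ] Coord n :=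
  (((fderiv ℝ (chr G) y).flip w).flip v) - fderiv ℝ (chr G) y v w
    + (chr G y).flip (chr G y w v) - (chr G y v).comp (chr G y w)

theorem curvEnd_apply (G : MatField n) (y w v u : Coord n) :
    curvEnd G y w v u = fderiv ℝ (chr G) y u w v - fderiv ℝ (chr G) y v w u
      + chr G y u (chr G y w v) - chr G y v (chr G y w u) := rfl

theorem fderiv_chr_stdVec {G : MatField n} {y : Coord n} (hd : DifferentiableAt ℝ (chr G) y)
    (a i j k : Fin n) :
    fderiv ℝ (chr G) y (stdVec a) (stdVec i) (stdVec j) k = pderiv a (christoffel G k i j) y := by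
  have h1 := (hd.hasFDerivAt.clm_apply (hasFDerivAt_const (stdVec i) y)).clm_apply
    (hasFDerivAt_const (stdVec j) y)
  have h2 := ((EuclideanSpace.proj k : Coord n →L[ℝ] ℝ).hasFDerivAt.comp y h1).fderiv
  have h3 : christoffel G k i j = (EuclideanSpace.proj k : Coord n →L[ℝ] ℝ) ∘
      fun z => chr G z (stdVec i) (stdVec j) := by
    ext z
    exact (chr_stdVec G z i j k).symm
  rw [pderiv, h3, h2]
  simp

theorem chr_stdVec_left_apply (G : MatField n) (y : Coord n) (k j : Fin n) (v : Coord n) :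
    chr G y (stdVec k) v j = ∑ l, christoffel G j k l y * v l := by
  rw [chr, bilVec_apply]
  simp

include hG in
-- As the trace of an endomorphism, the Ricci curvature is easy to transport: dF conjugates the
-- endomorphism and the trace is unchanged.
theorem ricci_apply {y : Coord n} (hy : y ∈ V) (i j : Fin n) :
    ricci G y i j = (jac (curvEnd G y (stdVec i) (stdVec j))).trace := by
  have hd := hG.differentiableAt_chr hy
  simp only [ricci, Matrix.of_apply, Matrix.trace, Matrix.diag, jac, curvEnd_apply]
  rw [← Finset.sum_add_distrib]
  refine Finset.sum_congr rfl fun k _ => ?_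
  simp only [PiLp.add_apply, PiLp.sub_apply, fderiv_chr_stdVec hd]
  rw [chr_stdVec_left_apply G y k k (chr G y (stdVec i) (stdVec j)),
    chr_stdVec_left_apply G y j k (chr G y (stdVec i) (stdVec k))]
  simp only [chr_stdVec, Finset.sum_sub_distrib]
  ring

include hG in
theorem bil_ricci {y : Coord n} (hy : y ∈ V) (w v : Coord n) :
    bil (ricci G y) w v = (jac (curvEnd G y w v)).trace := by
  have hadd : ∀ A B : Coord n →L[ℝ] Coord n,
      (jac (A + B)).trace = (jac A).trace + (jac B).trace := fun A B => by
    simp [Matrix.trace, jac, Finset.sum_add_distrib]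
  have hsmul : ∀ (c : ℝ) (A : Coord n →L[ℝ] Coord n), (jac (c • A)).trace = c * (jac A).trace :=
    fun c A => by simp [Matrix.trace, jac, Finset.mul_sum]
  refine isLinearMap_ext_stdVec (f := fun v => bil (ricci G y) w v)
    (g := fun v => (jac (curvEnd G y w v)).trace) ⟨?_, ?_⟩ ⟨?_, ?_⟩ (fun j => ?_) v
  · simp
  · simp
  · intro a b
    rw [← hadd]
    congr 2
    ext u
    simp only [curvEnd_apply, map_add, add_apply, PiLp.add_apply,
      PiLp.sub_apply]
    ring
  · intro c a
    rw [smul_eq_mul, ← hsmul]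
    congr 2
    ext u
    simp only [curvEnd_apply, map_smul, smul_apply, PiLp.add_apply,
      PiLp.sub_apply, PiLp.smul_apply, smul_eq_mul]
    ring
  refine isLinearMap_ext_stdVec (f := fun w => bil (ricci G y) w (stdVec j))
    (g := fun w => (jac (curvEnd G y w (stdVec j))).trace) ⟨?_, ?_⟩ ⟨?_, ?_⟩ (fun i => ?_) w
  · simp
  · simp
  · intro a b
    rw [← hadd]
    congr 2
    ext u
    simp only [curvEnd_apply, map_add, add_apply, PiLp.add_apply,
      PiLp.sub_apply]
    ring
  · intro c a
    rw [smul_eq_mul, ← hsmul]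
    congr 2
    ext u
    simp only [curvEnd_apply, map_smul, smul_apply, PiLp.add_apply,
      PiLp.sub_apply, PiLp.smul_apply, smul_eq_mul]
    ring
  rw [bil_stdVec, ricci_apply hG hy]

include hG in
-- The Koszul formula is symmetric in its first two arguments, because the derivative of G takes
-- symmetric values.
theorem chr_symm {y : Coord n} (hy : y ∈ V) (v w : Coord n) : chr G y v w = chr G y w v := by
  refine bil_nondegenerate (hG.det y hy) fun z => ?_
  rw [bil_chr hG hy, bil_chr hG hy, fderiv_bil_symm hG hy z v w]
  ring

include hF in
-- Two transpositions generate the permutation. The first two slots commute by symmetry of the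
-- second derivative of `fderiv ℝ F`, and the last two by differentiating the symmetry of the second
-- derivative of F.
theorem IsLocalDiffeo.fderiv_fderiv_fderiv_symm {y : Coord n} (hy : y ∈ U) (u v w : Coord n) :
    fderiv ℝ (fderiv ℝ (fderiv ℝ F)) y u w v = fderiv ℝ (fderiv ℝ (fderiv ℝ F)) y v w u := by
  have h1 := (hF.contDiffAt hy).fderiv_right (m := ∞) (by simp)
  have hswap : ∀ a b c, fderiv ℝ (fderiv ℝ (fderiv ℝ F)) y a b c =
      fderiv ℝ (fderiv ℝ (fderiv ℝ F)) y b a c := fun a b c =>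
    congrArg (fun L => L c) ((h1.isSymmSndFDerivAt (by simpa using two_le_infty)) a b)
  have hd : HasFDerivAt (fderiv ℝ (fderiv ℝ F)) _ y :=
    ((h1.fderiv_right (m := ∞) (by simp)).differentiableAt (by simp)).hasFDerivAt
  have happ := fun b c => (hd.clm_apply (hasFDerivAt_const b y)).clm_apply (hasFDerivAt_const c y)
  have hswap' : ∀ a b c, fderiv ℝ (fderiv ℝ (fderiv ℝ F)) y a b c =
      fderiv ℝ (fderiv ℝ (fderiv ℝ F)) y a c b := by
    intro a b c
    have heq : (fun z => fderiv ℝ (fderiv ℝ F) z b c) =ᶠ[nhds y]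
        fun z => fderiv ℝ (fderiv ℝ F) z c b := by
      filter_upwards [hF.isOpen.mem_nhds hy] with z hz using hF.fderiv_fderiv_symm hz b c
    have := DFunLike.congr_fun ((happ b c).unique ((happ c b).congr_of_eventuallyEq heq)) a
    simpa using this
  rw [hswap, hswap', hswap]

include hF hG hG' in
/-- The derivative of the transformation law of the Christoffel symbols. -/
theorem fderiv_fderiv_chr {y : Coord n} (hy : y ∈ U) (a b c : Coord n) :
    fderiv ℝ (fderiv ℝ F) y a (chr G' y b c)
      + fderiv ℝ F y (fderiv ℝ (chr G') y a b c) =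
      fderiv ℝ (fderiv ℝ (fderiv ℝ F)) y a b c
      + (fderiv ℝ (chr G) (F y) (fderiv ℝ F y a) (fderiv ℝ F y b) (fderiv ℝ F y c)
        + chr G (F y) (fderiv ℝ (fderiv ℝ F) y a b) (fderiv ℝ F y c)
        + chr G (F y) (fderiv ℝ F y b) (fderiv ℝ (fderiv ℝ F) y a c)) := by
    have hFy := hF.mapsTo hy
    have hM' := IsMetricOn.pull hF hG hG'
    have h1 : HasFDerivAt (fun z => fderiv ℝ F z (chr G' z b c)) _ y :=
      (hF.hasFDerivAt_fderiv hy).clm_apply (((hM'.differentiableAt_chr hy).hasFDerivAt.clm_apply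
        (hasFDerivAt_const b y)).clm_apply (hasFDerivAt_const c y))
    have h2 := fun v => (hF.hasFDerivAt_fderiv hy).clm_apply (hasFDerivAt_const v y)
    have h3 : HasFDerivAt (fderiv ℝ (fderiv ℝ F)) _ y :=
      ((((hF.contDiffAt hy).fderiv_right (m := ∞) (by simp)).fderiv_right (m := ∞)
        (by simp)).differentiableAt (by simp)).hasFDerivAt
    have h4 := HasFDerivAt.comp (g := chr G) (f := F) y
      (hG.differentiableAt_chr hFy).hasFDerivAt (hF.hasFDerivAt hy)
    have h5 : HasFDerivAt (fun z => fderiv ℝ (fderiv ℝ F) z b c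
        + chr G (F z) (fderiv ℝ F z b) (fderiv ℝ F z c)) _ y :=
      ((h3.clm_apply (hasFDerivAt_const b y)).clm_apply (hasFDerivAt_const c y)).add
        ((h4.clm_apply (h2 b)).clm_apply (h2 c))
    have heq : (fun z => fderiv ℝ F z (chr G' z b c)) =ᶠ[nhds y] fun z =>
        fderiv ℝ (fderiv ℝ F) z b c + chr G (F z) (fderiv ℝ F z b) (fderiv ℝ F z c) := by
      filter_upwards [hF.isOpen.mem_nhds hy] with z hz using fderiv_chr hF hG hG' hz b c
    have h6 := DFunLike.congr_fun (h1.unique (h5.congr_of_eventuallyEq heq)) a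
    simp at h6
    rw [← sub_eq_zero] at h6 ⊢
    rw [← h6]
    abel

include hF hG hG' in
-- Antisymmetrize the differentiated transformation law in u and v. The third derivative of F drops
-- out by symmetry. Second derivatives evaluated on Christoffel terms are removed by the
-- transformation law itself (`hD2`), and the remaining mixed terms cancel in pairs since Γ and d²F
-- are symmetric.
theorem fderiv_curvEnd {y : Coord n} (hy : y ∈ U) (w v u : Coord n) :
    fderiv ℝ F y (curvEnd G' y w v u) =
      curvEnd G (F y) (fderiv ℝ F y w) (fderiv ℝ F y v) (fderiv ℝ F y u) := by
  have hFy := hF.mapsTo hy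
  have key := fderiv_fderiv_chr hF hG hG' hy
  have h1 := key u w v
  have h2 := key v w u
  have hD2 : ∀ a b c, fderiv ℝ (fderiv ℝ F) y a (chr G' y b c) =
      fderiv ℝ F y (chr G' y a (chr G' y b c)) -
        (chr G (F y) (fderiv ℝ F y a) (fderiv ℝ (fderiv ℝ F) y b c) +
          chr G (F y) (fderiv ℝ F y a) (chr G (F y) (fderiv ℝ F y b) (fderiv ℝ F y c))) := by
    intro a b c
    rw [fderiv_chr hF hG hG' hy a, fderiv_chr hF hG hG' hy b, map_add]
    abel
  rw [hD2, hF.fderiv_fderiv_symm hy u w, hF.fderiv_fderiv_fderiv_symm hy u v w,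
    chr_symm hG hFy (fderiv ℝ (fderiv ℝ F) y w u)] at h1
  rw [hD2, hF.fderiv_fderiv_symm hy v w, hF.fderiv_fderiv_symm hy v u,
    chr_symm hG hFy (fderiv ℝ (fderiv ℝ F) y w v)] at h2
  simp only [curvEnd_apply, map_add, map_sub]
  rw [← sub_eq_zero] at h1 h2 ⊢
  rw [← sub_self (0 : Coord n)]
  nth_rewrite 1 [← h1]
  rw [← h2]
  abel

theorem jac_comp (A B : Coord n →L[ℝ] Coord n) : jac (A.comp B) = jac A * jac B := by
  ext k i
  rw [Matrix.mul_apply]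
  exact apply_eq_sum_jac A (B (stdVec i)) k

include hF hG hG' in
/-- Naturality of the Ricci curvature. -/
theorem ricci_pull {y : Coord n} (hy : y ∈ U) : ricci G' y = pullMat F (ricci G) y := by
  refine bil_injective (ContinuousLinearMap.ext fun w => ContinuousLinearMap.ext fun v => ?_)
  rw [pullMat, bil_pull, bil_ricci (IsMetricOn.pull hF hG hG') hy, bil_ricci hG (hF.mapsTo hy)]
  -- The Jacobian of F intertwines the two curvature endomorphisms; being invertible, it conjugates
  -- one into the other.
  have h : jac (fderiv ℝ F y) * jac (curvEnd G' y w v) =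
      jac (curvEnd G (F y) (fderiv ℝ F y w) (fderiv ℝ F y v)) * jac (fderiv ℝ F y) := by
    rw [← jac_comp, ← jac_comp]
    congr 1
    ext1 u
    exact fderiv_curvEnd hF hG hG' hy w v u
  have hinv := hF.det y hy
  rw [← Matrix.mul_nonsing_inv_cancel_right _ (jac (curvEnd G (F y) _ _)) hinv, ← h,
    Matrix.mul_assoc, Matrix.trace_mul_comm, Matrix.mul_assoc, Matrix.nonsing_inv_mul _ hinv,
    Matrix.mul_one]

end Naturality

/-! ### Symmetry of the Ricci curvature -/

section RicciSymmetry

variable {n : ℕ}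

theorem pderiv_mul {f g : Coord n → ℝ} {y : Coord n} (hf : DifferentiableAt ℝ f y)
    (hg : DifferentiableAt ℝ g y) (i : Fin n) :
    pderiv i (fun z => f z * g z) y = pderiv i f y * g y + f y * pderiv i g y := by
  rw [pderiv, fderiv_fun_mul hf hg]
  simp [pderiv]
  ring

theorem pderiv_sum {ι : Type*} {s : Finset ι} {f : ι → Coord n → ℝ} {y : Coord n}
    (hf : ∀ a ∈ s, DifferentiableAt ℝ (f a) y) (i : Fin n) :
    pderiv i (fun z => ∑ a ∈ s, f a z) y = ∑ a ∈ s, pderiv i (f a) y := by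
  rw [pderiv, fderiv_fun_sum hf]
  simp [pderiv]

theorem pderiv_congr {f g : Coord n → ℝ} {y : Coord n} (h : f =ᶠ[nhds y] g) (i : Fin n) :
    pderiv i f y = pderiv i g y := by
  rw [pderiv, pderiv, h.fderiv_eq]

theorem pderiv_comm {f : Coord n → ℝ} {y : Coord n} (hf : ContDiffAt ℝ ∞ f y) (i j : Fin n) :
    pderiv i (pderiv j f) y = pderiv j (pderiv i f) y := by
  have hd : DifferentiableAt ℝ (fderiv ℝ f) y :=
    (hf.fderiv_right (m := ∞) (by simp)).differentiableAt (by simp)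
  have h : ∀ a b, pderiv a (pderiv b f) y = fderiv ℝ (fderiv ℝ f) y (stdVec a) (stdVec b) := by
    intro a b
    have := (hd.hasFDerivAt.clm_apply (hasFDerivAt_const (stdVec b) y)).fderiv
    rw [pderiv, show pderiv b f = fun z => fderiv ℝ f z (stdVec b) from rfl, this]
    simp
  rw [h, h]
  exact (hf.isSymmSndFDerivAt (by simpa using two_le_infty)) _ _

variable {G : MatField n} {V : Set (Coord n)} (hG : IsMetricOn G V) {y : Coord n} (hy : y ∈ V)

/-- The matrix of partial derivatives of the components. -/
noncomputable def matDeriv (i : Fin n) (G : MatField n) (y : Coord n) :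
    Matrix (Fin n) (Fin n) ℝ :=
  Matrix.of fun k l => pderiv i (fun z => G z k l) y

include hG hy

theorem IsMetricOn.differentiableAt (k l : Fin n) : DifferentiableAt ℝ (fun z => G z k l) y :=
  ((hG.smooth k l).contDiffAt (hG.isOpen.mem_nhds hy)).differentiableAt (by simp)

theorem IsMetricOn.differentiableAt_inv (k l : Fin n) :
    DifferentiableAt ℝ (fun z => (G z)⁻¹ k l) y :=
  ((contDiffOn_inv hG.smooth hG.det k l).contDiffAt (hG.isOpen.mem_nhds hy)).differentiableAt
    (by simp)

/-- Differentiate the identity G G⁻¹ = 1, which holds throughout the open set V. -/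
theorem matDeriv_inv (i : Fin n) :
    matDeriv i (fun z => (G z)⁻¹) y = -((G y)⁻¹ * matDeriv i G y * (G y)⁻¹) := by
  have h : matDeriv i G y * (G y)⁻¹ + G y * matDeriv i (fun z => (G z)⁻¹) y = 0 := by
    ext k l
    have h1 : pderiv i (fun z => ∑ a, G z k a * (G z)⁻¹ a l) y =
        pderiv i (fun _ => (1 : Matrix (Fin n) (Fin n) ℝ) k l) y := by
      refine pderiv_congr ?_ i
      filter_upwards [hG.isOpen.mem_nhds hy] with z hz
      rw [← Matrix.mul_nonsing_inv _ (hG.det z hz), Matrix.mul_apply]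
    have hdm : ∀ a, DifferentiableAt ℝ (fun z => G z k a * (G z)⁻¹ a l) y := fun a =>
      (hG.differentiableAt hy k a).mul (hG.differentiableAt_inv hy a l)
    rw [pderiv_sum fun a _ => hdm a] at h1
    simp only [pderiv_mul (hG.differentiableAt hy k _) (hG.differentiableAt_inv hy _ l),
      Finset.sum_add_distrib] at h1
    rw [Matrix.add_apply, Matrix.mul_apply, Matrix.mul_apply, Matrix.zero_apply]
    simp only [matDeriv, Matrix.of_apply]
    rw [h1]
    simp [pderiv]
  have h2 : G y * matDeriv i (fun z => (G z)⁻¹) y = -(matDeriv i G y * (G y)⁻¹) :=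
    eq_neg_of_add_eq_zero_right h
  rw [Matrix.mul_assoc, ← Matrix.mul_neg, ← h2,
    Matrix.nonsing_inv_mul_cancel_left _ _ (hG.det y hy)]

theorem matDeriv_isSymm (i : Fin n) : (matDeriv i G y).IsSymm := by
  ext k l
  refine pderiv_congr ?_ i
  filter_upwards [hG.isOpen.mem_nhds hy] with z hz using (hG.symm z hz).apply k l

/-- The other two derivative terms of the Christoffel symbol are antisymmetric in k, l and vanish
when contracted with the symmetric inverse. -/
theorem sum_christoffel_self (i : Fin n) :
    ∑ k, christoffel G k i k y =
      ∑ k, ∑ l, (1 / 2) * ((G y)⁻¹ k l * pderiv i (fun z => G z k l) y) := by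
  have hinv : ((G y)⁻¹).IsSymm := by
    rw [Matrix.IsSymm, Matrix.transpose_nonsing_inv, (hG.symm y hy).eq]
  have h0 : ∑ k, ∑ l, (1 / 2) * ((G y)⁻¹ k l * (pderiv k (fun z => G z i l) y
      - pderiv l (fun z => G z i k) y)) = 0 := by
    have h1 : ∑ k, ∑ l, (1 / 2) * ((G y)⁻¹ k l * (pderiv k (fun z => G z i l) y
      - pderiv l (fun z => G z i k) y)) = -∑ k, ∑ l, (1 / 2) * ((G y)⁻¹ k l *
        (pderiv k (fun z => G z i l) y - pderiv l (fun z => G z i k) y)) := by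
      conv_lhs => rw [Finset.sum_comm]
      simp only [← Finset.sum_neg_distrib]
      refine Finset.sum_congr rfl fun a _ => Finset.sum_congr rfl fun b _ => ?_
      rw [hinv.apply a b]
      ring
    linarith
  rw [← add_zero (∑ k, ∑ l, (1 / 2) * ((G y)⁻¹ k l * pderiv i (fun z => G z k l) y)), ← h0,
    ← Finset.sum_add_distrib]
  refine Finset.sum_congr rfl fun k _ => ?_
  rw [christoffel, Finset.mul_sum, ← Finset.sum_add_distrib]
  refine Finset.sum_congr rfl fun l _ => ?_
  ring

/-- This is the one part of Ricci whose symmetry in i, j is not visible: a second derivative of log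
√|det G|. The expanded form shows it, through cyclicity of the trace and commuting partial
derivatives. -/
theorem sum_pderiv_christoffel_self (i j : Fin n) :
    ∑ k, pderiv j (christoffel G k i k) y =
      -(1 / 2) * ((G y)⁻¹ * matDeriv j G y * (G y)⁻¹ * matDeriv i G y).trace
      + (1 / 2) * ∑ k, ∑ l, (G y)⁻¹ k l * pderiv j (pderiv i fun z => G z k l) y := by
  have hc : ∀ k, DifferentiableAt ℝ (christoffel G k i k) y := fun k =>
    ((hG.contDiffOn_christoffel k i k).contDiffAt (hG.isOpen.mem_nhds hy)).differentiableAt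
      (by simp)
  have hp : ∀ k l, DifferentiableAt ℝ (pderiv i fun z => G z k l) y := fun k l =>
    ((contDiffOn_pderiv hG.isOpen (hG.smooth k l) i).contDiffAt
      (hG.isOpen.mem_nhds hy)).differentiableAt (by simp)
  have hprod : ∀ k l, DifferentiableAt ℝ
      (fun z => (G z)⁻¹ k l * pderiv i (fun z => G z k l) z) y := fun k l =>
    (hG.differentiableAt_inv hy k l).mul (hp k l)
  have hhalf : ∀ k l, DifferentiableAt ℝ
      (fun z => (1 / 2) * ((G z)⁻¹ k l * pderiv i (fun z => G z k l) z)) y := fun k l =>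
    (differentiableAt_const _).mul (hprod k l)
  have hinner : ∀ k, DifferentiableAt ℝ
      (fun z => ∑ l, (1 / 2) * ((G z)⁻¹ k l * pderiv i (fun z => G z k l) z)) y := fun k =>
    DifferentiableAt.fun_sum fun l _ => hhalf k l
  have h1 : ∑ k, pderiv j (christoffel G k i k) y = pderiv j (fun z => ∑ k, ∑ l,
      (1 / 2) * ((G z)⁻¹ k l * pderiv i (fun z => G z k l) z)) y := by
    rw [← pderiv_sum fun k _ => hc k]
    refine pderiv_congr ?_ j
    filter_upwards [hG.isOpen.mem_nhds hy] with z hz using sum_christoffel_self hG hz i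
  have hconst : pderiv j (fun _ : Coord n => (1 / 2 : ℝ)) y = 0 := by simp [pderiv]
  have h2 : ∀ k l, pderiv j (fun z => (1 / 2) * ((G z)⁻¹ k l * pderiv i (fun z => G z k l) z)) y =
      (1 / 2) * (matDeriv j (fun z => (G z)⁻¹) y k l * matDeriv i G y k l) +
        (1 / 2) * ((G y)⁻¹ k l * pderiv j (pderiv i fun z => G z k l) y) := by
    intro k l
    rw [pderiv_mul (differentiableAt_const _) (hprod k l), hconst,
      pderiv_mul (hG.differentiableAt_inv hy k l) (hp k l)]
    simp only [matDeriv, Matrix.of_apply]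
    ring
  rw [h1, pderiv_sum fun k _ => hinner k]
  simp only [fun k => pderiv_sum (i := j) fun l (_ : l ∈ Finset.univ) => hhalf k l, h2]
  simp only [Finset.sum_add_distrib, ← Finset.mul_sum]
  congr 1
  have h3 : ∑ k, ∑ l, matDeriv j (fun z => (G z)⁻¹) y k l * matDeriv i G y k l =
      (matDeriv j (fun z => (G z)⁻¹) y * matDeriv i G y).trace := by
    simp only [Matrix.trace, Matrix.diag, Matrix.mul_apply]
    refine Finset.sum_congr rfl fun k _ => Finset.sum_congr rfl fun l _ => ?_
    rw [(matDeriv_isSymm hG hy i).apply k l]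
  rw [h3, matDeriv_inv hG hy, Matrix.neg_mul, Matrix.trace_neg]
  ring

theorem christoffel_symm (k i j : Fin n) : christoffel G k i j y = christoffel G k j i y := by
  rw [← chr_stdVec, chr_symm hG hy, chr_stdVec]

/-- The divergence term is symmetric because Γ is, the quadratic terms after renaming summation
indices, and the rest by the contracted formula. Symmetry is needed so that the Fefferman–Graham
coefficients, built from Ricci, are again symmetric matrices. -/
theorem ricci_isSymm : (ricci G y).IsSymm := by
  ext i j
  have hc : ∀ k, pderiv k (christoffel G k j i) y = pderiv k (christoffel G k i j) y := fun k => by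
    refine pderiv_congr ?_ k
    filter_upwards [hG.isOpen.mem_nhds hy] with z hz using christoffel_symm hG hz k j i
  have hq : ∑ k, ∑ l, christoffel G k i l y * christoffel G l j k y =
      ∑ k, ∑ l, christoffel G k j l y * christoffel G l i k y := by
    rw [Finset.sum_comm]
    refine Finset.sum_congr rfl fun k _ => Finset.sum_congr rfl fun l _ => mul_comm _ _
  have htr : ((G y)⁻¹ * matDeriv i G y * (G y)⁻¹ * matDeriv j G y).trace =
      ((G y)⁻¹ * matDeriv j G y * (G y)⁻¹ * matDeriv i G y).trace := by
    rw [Matrix.mul_assoc, Matrix.trace_mul_comm, ← Matrix.mul_assoc]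
  have hd : ∀ k l, pderiv i (pderiv j fun z => G z k l) y =
      pderiv j (pderiv i fun z => G z k l) y := fun k l =>
    pderiv_comm ((hG.smooth k l).contDiffAt (hG.isOpen.mem_nhds hy)) i j
  rw [Matrix.transpose_apply]
  simp only [ricci, Matrix.of_apply, Finset.sum_sub_distrib, hc, hq,
    sum_pderiv_christoffel_self hG hy, htr, hd, christoffel_symm hG hy _ j i]

end RicciSymmetry

/-! ### Congruence of matrices -/

section Congruence

variable {n : ℕ} (J : Matrix (Fin n) (Fin n) ℝ)

theorem congruence_apply (A : Matrix (Fin n) (Fin n) ℝ) (i j : Fin n) :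
    (J.transpose * A * J) i j = ∑ l, ∑ k, (J k i * J l j) * A k l := by
  simp only [Matrix.mul_apply, Matrix.transpose_apply, Finset.sum_mul]
  refine Finset.sum_congr rfl fun l _ => Finset.sum_congr rfl fun k _ => ?_
  ring

theorem metricTrace_eq_trace (G A : Matrix (Fin n) (Fin n) ℝ) :
    metricTrace G A = (G⁻¹ * A.transpose).trace := by
  simp [metricTrace, Matrix.trace, Matrix.mul_apply]

theorem metricTrace_smul_right (c : ℝ) (G A : Matrix (Fin n) (Fin n) ℝ) :
    metricTrace G (c • A) = c * metricTrace G A := by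
  simp [metricTrace_eq_trace]

variable {J}

/-- A need not be invertible: `Matrix.mul_inv_rev` holds also under the convention that a singular
matrix has inverse 0. -/
theorem inv_congruence (hJ : IsUnit J.det) (A : Matrix (Fin n) (Fin n) ℝ) :
    J * (J.transpose * A * J)⁻¹ * J.transpose = A⁻¹ := by
  rw [Matrix.mul_inv_rev, Matrix.mul_inv_rev, ← Matrix.mul_assoc, ← Matrix.mul_assoc,
    Matrix.mul_nonsing_inv _ hJ, Matrix.one_mul, Matrix.mul_assoc,
    Matrix.nonsing_inv_mul _ (by rwa [Matrix.det_transpose]), Matrix.mul_one]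

theorem metricTrace_congruence (hJ : IsUnit J.det) (G A : Matrix (Fin n) (Fin n) ℝ) :
    metricTrace (J.transpose * G * J) (J.transpose * A * J) = metricTrace G A := by
  rw [metricTrace_eq_trace, metricTrace_eq_trace, ← inv_congruence hJ G, Matrix.transpose_mul,
    Matrix.transpose_mul, Matrix.transpose_transpose, ← Matrix.mul_assoc, ← Matrix.mul_assoc,
    Matrix.trace_mul_comm, ← Matrix.mul_assoc, ← Matrix.mul_assoc]

theorem congruence_mul_inv_mul (hJ : IsUnit J.det) (G A : Matrix (Fin n) (Fin n) ℝ) :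
    (J.transpose * A * J) * (J.transpose * G * J)⁻¹ * (J.transpose * A * J).transpose =
      J.transpose * (A * G⁻¹ * A.transpose) * J := by
  rw [← inv_congruence hJ G]
  simp only [Matrix.transpose_mul, Matrix.transpose_transpose, Matrix.mul_assoc]

end Congruence

/-! ### Families of metrics -/

section Families

variable {n : ℕ}

/-- A smooth family of symmetric matrix fields that is nondegenerate at the parameter `0`. -/
structure IsFamilyOn (γ : ℝ → MatField n) (V : Set (Coord n)) : Prop where
  isOpen : IsOpen V
  smooth : ∀ i j, ContDiffOn ℝ ∞ (fun p : ℝ × Coord n => γ p.1 p.2 i j) (Set.univ ×ˢ V)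
  symm : ∀ ρ, ∀ y ∈ V, (γ ρ y).IsSymm
  det : ∀ y ∈ V, IsUnit (γ 0 y).det

/-- The set on which a family of matrix fields is nondegenerate. -/
def nondegSet (γ : ℝ → MatField n) (V : Set (Coord n)) : Set (ℝ × Coord n) :=
  {p | p.2 ∈ V ∧ IsUnit (γ p.1 p.2).det}

theorem deriv_param {f : ℝ × Coord n → ℝ} {W : Set (ℝ × Coord n)} (hW : IsOpen W)
    (hf : ContDiffOn ℝ ∞ f W) {p : ℝ × Coord n} (hp : p ∈ W) :
    HasDerivAt (fun s => f (s, p.2)) (fderiv ℝ f p (1, 0)) p.1 := by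
  have h1 : HasFDerivAt f (fderiv ℝ f p) (p.1, p.2) :=
    ((hf.contDiffAt (hW.mem_nhds hp)).differentiableAt (by simp)).hasFDerivAt
  have h2 := HasFDerivAt.comp (g := f) (f := fun s : ℝ => (s, p.2)) p.1 h1
    (hasFDerivAt_prodMk_left p.1 p.2)
  have h3 := h2.hasDerivAt
  rwa [ContinuousLinearMap.comp_apply, ContinuousLinearMap.inl_apply] at h3

theorem contDiffOn_deriv_param {f : ℝ × Coord n → ℝ} {W : Set (ℝ × Coord n)} (hW : IsOpen W)
    (hf : ContDiffOn ℝ ∞ f W) :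
    ContDiffOn ℝ ∞ (fun p : ℝ × Coord n => deriv (fun s => f (s, p.2)) p.1) W :=
  ((hf.fderiv_of_isOpen hW (m := ∞) (by simp)).clm_apply contDiffOn_const).congr
    fun _ hp => (deriv_param hW hf hp).deriv

theorem contDiffOn_iteratedDeriv_param {f : ℝ × Coord n → ℝ} {W : Set (ℝ × Coord n)}
    (hW : IsOpen W) (hf : ContDiffOn ℝ ∞ f W) (m : ℕ) :
    ContDiffOn ℝ ∞ (fun p : ℝ × Coord n => iteratedDeriv m (fun s => f (s, p.2)) p.1) W := by
  induction m with
  | zero => simpa using hf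
  | succ m ih =>
    simp only [iteratedDeriv_succ]
    exact contDiffOn_deriv_param hW ih

theorem contDiffAt_param {f : ℝ × Coord n → ℝ} {W : Set (ℝ × Coord n)} (hW : IsOpen W)
    (hf : ContDiffOn ℝ ∞ f W) {p : ℝ × Coord n} (hp : p ∈ W) :
    ContDiffAt ℝ ∞ (fun s => f (s, p.2)) p.1 := by
  have h1 : ContDiffAt ℝ ∞ f (p.1, p.2) := hf.contDiffAt (hW.mem_nhds hp)
  exact h1.comp p.1 (contDiffAt_id.prodMk contDiffAt_const)

variable {γ : ℝ → MatField n} {V : Set (Coord n)} (hγ : IsFamilyOn γ V)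

include hγ

/-- A truncated expansion may degenerate away from ρ = 0. Jets at ρ = 0 only see this open
neighbourhood of {0} × V, so the curvature of γ_ρ is controlled there and nowhere else. -/
theorem IsFamilyOn.isOpen_nondegSet : IsOpen (nondegSet γ V) := by
  have h1 : ContinuousOn (fun p : ℝ × Coord n => (γ p.1 p.2).det) (Set.univ ×ˢ V) :=
    (contDiffOn_det hγ.smooth).continuousOn
  have h2 := h1.isOpen_inter_preimage (isOpen_univ.prod hγ.isOpen) (isOpen_compl_singleton (x := 0))
  convert! h2 using 1
  ext p
  simp [nondegSet]

theorem IsFamilyOn.zero_mem {y : Coord n} (hy : y ∈ V) : ((0 : ℝ), y) ∈ nondegSet γ V :=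
  ⟨hy, hγ.det y hy⟩

theorem IsFamilyOn.eventually_mem {y : Coord n} (hy : y ∈ V) :
    ∀ᶠ ρ in nhds (0 : ℝ), (ρ, y) ∈ nondegSet γ V :=
  (Continuous.prodMk_left y).continuousAt.preimage_mem_nhds
    (hγ.isOpen_nondegSet.mem_nhds (hγ.zero_mem hy))

theorem IsFamilyOn.isMetricOn (ρ : ℝ) : IsMetricOn (γ ρ) {y | (ρ, y) ∈ nondegSet γ V} where
  isOpen := hγ.isOpen_nondegSet.preimage (Continuous.prodMk_right ρ)
  smooth i j := (contDiffOn_of_family (f := fun ρ y => γ ρ y i j) (hγ.smooth i j) ρ).mono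
    fun _ hy => hy.1
  symm y hy := hγ.symm ρ y hy.1
  det _ hy := hy.2

theorem IsFamilyOn.smooth_nondegSet (i j : Fin n) :
    ContDiffOn ℝ ∞ (fun p : ℝ × Coord n => γ p.1 p.2 i j) (nondegSet γ V) :=
  (hγ.smooth i j).mono fun _ hp => ⟨trivial, hp.1⟩

theorem IsFamilyOn.contDiffOn_rhoDeriv (i j : Fin n) :
    ContDiffOn ℝ ∞ (fun p : ℝ × Coord n => rhoDeriv γ p.1 p.2 i j) (Set.univ ×ˢ V) :=
  contDiffOn_deriv_param (isOpen_univ.prod hγ.isOpen) (hγ.smooth i j)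

theorem IsFamilyOn.contDiffOn_rhoDeriv_rhoDeriv (i j : Fin n) :
    ContDiffOn ℝ ∞ (fun p : ℝ × Coord n => rhoDeriv (rhoDeriv γ) p.1 p.2 i j) (Set.univ ×ˢ V) :=
  contDiffOn_deriv_param (isOpen_univ.prod hγ.isOpen) (hγ.contDiffOn_rhoDeriv i j)

theorem IsFamilyOn.contDiffOn_ambientRicci (i j : Fin n) :
    ContDiffOn ℝ ∞ (fun p : ℝ × Coord n => ambientRicci γ p.1 p.2 i j) (nondegSet γ V) := by
  have hsub : nondegSet γ V ⊆ Set.univ ×ˢ V := fun _ hp => ⟨trivial, hp.1⟩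
  have hdet : ∀ p ∈ nondegSet γ V, IsUnit (γ p.1 p.2).det := fun _ hp => hp.2
  have h0 := hγ.smooth_nondegSet
  have h1 := fun i j => (hγ.contDiffOn_rhoDeriv i j).mono hsub
  have h2 := fun i j => (hγ.contDiffOn_rhoDeriv_rhoDeriv i j).mono hsub
  have htr := contDiffOn_metricTrace h0 hdet h1
  have hinv := contDiffOn_inv h0 hdet
  have hρ : ContDiffOn ℝ ∞ (fun p : ℝ × Coord n => p.1) (nondegSet γ V) := contDiffOn_fst
  have hric := contDiffOn_ricci_param hγ.isOpen_nondegSet h0 hdet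
  simp only [ambientRicci, Matrix.add_apply, Matrix.sub_apply, Matrix.smul_apply, smul_eq_mul,
    Matrix.mul_apply, Matrix.transpose_apply]
  exact ((((hρ.mul (h2 i j)).sub (hρ.mul (ContDiffOn.sum fun a _ =>
    (ContDiffOn.sum fun b _ => (h1 i b).mul (hinv b a)).mul (h1 j a)))).add
    (((hρ.div_const 2).mul htr).mul (h1 i j))).sub (contDiffOn_const.mul (h1 i j))).sub
    ((contDiffOn_const.mul htr).mul (h0 i j)) |>.add (hric i j)

theorem IsFamilyOn.rhoDeriv_isSymm (ρ : ℝ) {y : Coord n} (hy : y ∈ V) :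
    (rhoDeriv γ ρ y).IsSymm := by
  ext i j
  have h : (fun s => γ s y j i) = fun s => γ s y i j := funext fun s => (hγ.symm s y hy).apply i j
  simp only [rhoDeriv, Matrix.transpose_apply, Matrix.of_apply, h]

theorem IsFamilyOn.rhoDeriv_rhoDeriv_isSymm (ρ : ℝ) {y : Coord n} (hy : y ∈ V) :
    (rhoDeriv (rhoDeriv γ) ρ y).IsSymm := by
  ext i j
  have h : (fun s => rhoDeriv γ s y j i) = fun s => rhoDeriv γ s y i j :=
    funext fun s => (hγ.rhoDeriv_isSymm s hy).apply i j
  rw [Matrix.transpose_apply, rhoDeriv, Matrix.of_apply, Matrix.of_apply, h]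

theorem IsFamilyOn.ambientRicci_isSymm {ρ : ℝ} {y : Coord n} (hp : (ρ, y) ∈ nondegSet γ V) :
    (ambientRicci γ ρ y).IsSymm := by
  have hy : y ∈ V := hp.1
  have h0 := hγ.symm ρ y hy
  have h1 := hγ.rhoDeriv_isSymm ρ hy
  have h2 := hγ.rhoDeriv_rhoDeriv_isSymm ρ hy
  have hinv : ((γ ρ y)⁻¹).transpose = (γ ρ y)⁻¹ := by
    rw [Matrix.transpose_nonsing_inv, h0.eq]
  have hric := ricci_isSymm (hγ.isMetricOn ρ) hp
  simp only [Matrix.IsSymm, ambientRicci, Matrix.transpose_add, Matrix.transpose_sub,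
    Matrix.transpose_smul, Matrix.transpose_mul, h0.eq, h1.eq, h2.eq,
    hinv, hric.eq, Matrix.mul_assoc]

theorem IsFamilyOn.contDiffOn_ambientRicciJet (m : ℕ) (i j : Fin n) :
    ContDiffOn ℝ ∞ (fun y => ambientRicciJet γ m y i j) V := by
  have h1 := contDiffOn_iteratedDeriv_param (f := fun p => ambientRicci γ p.1 p.2 i j)
    hγ.isOpen_nondegSet (hγ.contDiffOn_ambientRicci i j) m
  have h2 : ContDiffOn ℝ ∞ (fun y : Coord n => ((0 : ℝ), y)) V :=
    contDiffOn_const.prodMk contDiffOn_id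
  have h3 := ContDiffOn.comp (g := fun p : ℝ × Coord n =>
    iteratedDeriv m (fun s => ambientRicci γ s p.2 i j) p.1) h1 h2 fun _ hy => hγ.zero_mem hy
  exact h3

theorem IsFamilyOn.ambientRicciJet_isSymm (m : ℕ) {y : Coord n} (hy : y ∈ V) :
    (ambientRicciJet γ m y).IsSymm := by
  ext i j
  refine Filter.EventuallyEq.iteratedDeriv_eq m ?_
  filter_upwards [hγ.eventually_mem hy] with ρ hρ using (hγ.ambientRicci_isSymm hρ).apply i j

end Families

/-! ### Smoothness and symmetry of the Fefferman–Graham expansion. -/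

section Expansion

variable {n : ℕ} {G : MatField n} {V : Set (Coord n)}

theorem fgExpansion_zero (G : MatField n) (m : ℕ) (y : Coord n) : fgExpansion G m 0 y = G y := by
  induction m with
  | zero => rfl
  | succ m ih => simp [fgExpansion, ih]

/-- Each new coefficient is a combination of G and a jet of the ambient Ricci components of the
previous stage, hence smooth and symmetric. Nondegeneracy at ρ = 0 costs nothing, because the value
there is always G. -/
theorem IsMetricOn.isFamilyOn_fgExpansion (hG : IsMetricOn G V) (m : ℕ) :
    IsFamilyOn (fgExpansion G m) V := by
  induction m with
  | zero =>
    exact ⟨hG.isOpen, fun i j => contDiffOn_const_family (hG.smooth i j), fun _ => hG.symm, hG.det⟩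
  | succ m ih =>
    have hjet := ih.contDiffOn_ambientRicciJet m
    have hsmul : ∀ i j, ContDiffOn ℝ ∞ (fun y => ((1 / (m.factorial : ℝ)) •
        ambientRicciJet (fgExpansion G m) m y) i j) V := fun i j =>
      contDiffOn_const.mul (hjet i j)
    have htr := contDiffOn_metricTrace hG.smooth hG.det hsmul
    refine ⟨hG.isOpen, fun i j => ?_, fun ρ y hy => ?_, fun y hy => ?_⟩
    · simp only [fgExpansion, Matrix.add_apply, Matrix.smul_apply, smul_eq_mul]
      refine (ih.smooth i j).add ((contDiffOn_fst.pow _).mul ?_)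
      exact contDiffOn_const_family (contDiffOn_const.mul ((hsmul i j).add
        ((htr.div_const _).mul (hG.smooth i j))))
    · simp only [Matrix.IsSymm, fgExpansion, Matrix.transpose_add, Matrix.transpose_smul,
        (ih.symm ρ y hy).eq, (ih.ambientRicciJet_isSymm m hy).eq, (hG.symm y hy).eq]
    · rw [fgExpansion_zero]
      exact hG.det y hy

end Expansion

/-! ### Naturality of the Fefferman–Graham expansion -/

section Naturality

variable {n : ℕ} {F : Coord n → Coord n} {U V : Set (Coord n)} (hF : IsLocalDiffeo F U V)

/-- The Jacobian of the coordinate change does not depend on ρ, so congruence by it commutes with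
derivatives in ρ. -/
theorem deriv_congruence (J : Matrix (Fin n) (Fin n) ℝ) {A : ℝ → Matrix (Fin n) (Fin n) ℝ} {ρ : ℝ}
    (hA : ∀ i j, DifferentiableAt ℝ (fun s => A s i j) ρ) (i j : Fin n) :
    deriv (fun s => (J.transpose * A s * J) i j) ρ =
      (J.transpose * Matrix.of (fun i j => deriv (fun s => A s i j) ρ) * J) i j := by
  simp only [congruence_apply]
  have h1 : ∀ l k, DifferentiableAt ℝ (fun s => (J k i * J l j) * A s k l) ρ := fun l k =>
    (hA k l).const_mul _
  rw [deriv_fun_sum fun l _ => DifferentiableAt.fun_sum fun k _ => h1 l k]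
  refine Finset.sum_congr rfl fun l _ => ?_
  rw [deriv_fun_sum fun k _ => h1 l k]
  refine Finset.sum_congr rfl fun k _ => ?_
  rw [deriv_const_mul _ (hA k l), Matrix.of_apply]

theorem iteratedDeriv_congruence (J : Matrix (Fin n) (Fin n) ℝ)
    {A : ℝ → Matrix (Fin n) (Fin n) ℝ} {ρ : ℝ} (m : ℕ)
    (hA : ∀ i j, ContDiffAt ℝ m (fun s => A s i j) ρ) (i j : Fin n) :
    iteratedDeriv m (fun s => (J.transpose * A s * J) i j) ρ =
      (J.transpose * Matrix.of (fun i j => iteratedDeriv m (fun s => A s i j) ρ) * J) i j := by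
  simp only [congruence_apply]
  have h1 : ∀ l k, ContDiffAt ℝ m (fun s => (J k i * J l j) * A s k l) ρ := fun l k =>
    contDiffAt_const.mul (hA k l)
  rw [iteratedDeriv_fun_sum fun l _ => ContDiffAt.sum fun k _ => h1 l k]
  refine Finset.sum_congr rfl fun l _ => ?_
  rw [iteratedDeriv_fun_sum fun k _ => h1 l k]
  refine Finset.sum_congr rfl fun k _ => ?_
  rw [iteratedDeriv_const_mul_field, Matrix.of_apply]

variable {γ γ' : ℝ → MatField n} (hγ : IsFamilyOn γ V)
  (hγ' : ∀ ρ, ∀ y ∈ U, γ' ρ y = pullMat F (γ ρ) y)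

include hF in
theorem rhoDeriv_pull (hsm : ∀ i j, ContDiffOn ℝ ∞ (fun p : ℝ × Coord n => γ p.1 p.2 i j)
      (Set.univ ×ˢ V)) (hV : IsOpen V) (hγ' : ∀ ρ, ∀ y ∈ U, γ' ρ y = pullMat F (γ ρ) y)
    (ρ : ℝ) {y : Coord n} (hy : y ∈ U) : rhoDeriv γ' ρ y = pullMat F (rhoDeriv γ ρ) y := by
  ext i j
  have h1 : (fun s => γ' s y i j) = fun s => ((jac (fderiv ℝ F y)).transpose * γ s (F y) *
      jac (fderiv ℝ F y)) i j := funext fun s => by rw [hγ' s y hy]; rfl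
  rw [rhoDeriv, Matrix.of_apply, h1, deriv_congruence]
  · rfl
  · exact fun i j => ((contDiffAt_param (isOpen_univ.prod hV) (hsm i j) (p := (ρ, F y))
      ⟨trivial, hF.mapsTo hy⟩).differentiableAt (by simp))

include hF hγ hγ' in
theorem ambientRicci_pull {ρ : ℝ} {y : Coord n} (hy : y ∈ U) (hp : (ρ, F y) ∈ nondegSet γ V) :
    ambientRicci γ' ρ y = pullMat F (ambientRicci γ ρ) y := by
  have hJ := hF.det y hy
  have h1 := rhoDeriv_pull hF hγ.smooth hγ.isOpen hγ'
  have h2 := rhoDeriv_pull hF hγ.contDiffOn_rhoDeriv hγ.isOpen fun ρ y hy => h1 ρ hy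
  -- For fixed ρ the Ricci transformation law applies only where γ_ρ is nondegenerate, so U is
  -- shrunk to the preimage of that open slice.
  have hU : IsLocalDiffeo F (U ∩ F ⁻¹' {z | (ρ, z) ∈ nondegSet γ V})
      {z | (ρ, z) ∈ nondegSet γ V} :=
    ⟨hF.smooth.continuousOn.isOpen_inter_preimage hF.isOpen (hγ.isMetricOn ρ).isOpen,
      hF.smooth.mono Set.inter_subset_left, fun z hz => hz.2, fun z hz => hF.det z hz.1⟩
  have h3 := ricci_pull hU (hγ.isMetricOn ρ) (G' := γ' ρ) (fun z hz => hγ' ρ z hz.1) ⟨hy, hp⟩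
  rw [ambientRicci, h1 ρ hy, h2 ρ hy, h3, hγ' ρ y hy]
  simp only [pullMat, congruence_mul_inv_mul hJ, metricTrace_congruence hJ, ambientRicci]
  simp only [Matrix.mul_add, Matrix.add_mul, Matrix.mul_sub, Matrix.sub_mul, Matrix.mul_smul,
    Matrix.smul_mul]

include hF hγ hγ' in
theorem ambientRicciJet_pull (m : ℕ) {y : Coord n} (hy : y ∈ U) :
    ambientRicciJet γ' m y = pullMat F (ambientRicciJet γ m) y := by
  ext i j
  have hFy := hF.mapsTo hy
  have h1 : (fun ρ => ambientRicci γ' ρ y i j) =ᶠ[nhds 0] fun ρ =>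
      ((jac (fderiv ℝ F y)).transpose * ambientRicci γ ρ (F y) * jac (fderiv ℝ F y)) i j := by
    filter_upwards [hγ.eventually_mem hFy] with ρ hρ
    rw [ambientRicci_pull hF hγ hγ' hy hρ]
    rfl
  rw [ambientRicciJet, Matrix.of_apply, h1.iteratedDeriv_eq, iteratedDeriv_congruence]
  · rfl
  · exact fun i j => (contDiffAt_param hγ.isOpen_nondegSet (hγ.contDiffOn_ambientRicci i j)
      (hγ.zero_mem hFy)).of_le (by exact_mod_cast le_top)

variable {G G' : MatField n} (hG : IsMetricOn G V) (hG' : ∀ y ∈ U, G' y = pullMat F G y)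

include hF hG hG' in
theorem fgExpansion_pull (m : ℕ) (ρ : ℝ) {y : Coord n} (hy : y ∈ U) :
    fgExpansion G' m ρ y = pullMat F (fgExpansion G m ρ) y := by
  -- The next coefficient involves derivatives in both ρ and y, so the previous stage must be known
  -- for all ρ and all points of U.
  induction m generalizing ρ y with
  | zero => exact hG' y hy
  | succ m ih =>
    have hJ := hF.det y hy
    have hjet := ambientRicciJet_pull hF (hG.isFamilyOn_fgExpansion m) (fun ρ y hy => ih ρ hy) m hy
    simp only [fgExpansion, ih ρ hy, hjet, hG' y hy]
    simp only [pullMat, metricTrace_smul_right, metricTrace_congruence hJ]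
    simp only [Matrix.mul_add, Matrix.add_mul, Matrix.mul_smul, Matrix.smul_mul]

include hF hG hG' in
/-- Naturality of the obstruction tensor in coordinates. -/
theorem localObstruction_pull {y : Coord n} (hy : y ∈ U) :
    localObstruction G' y = pullMat F (localObstruction G) y := by
  have hJ := hF.det y hy
  have hjet := ambientRicciJet_pull hF (hG.isFamilyOn_fgExpansion (n / 2 - 1))
    (fun ρ y hy => fgExpansion_pull hF hG hG' (n / 2 - 1) ρ hy) (n / 2 - 1) hy
  simp only [localObstruction, hjet, hG' y hy]
  simp only [pullMat, metricTrace_congruence hJ, localObstruction]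
  simp only [Matrix.mul_sub, Matrix.sub_mul, Matrix.mul_smul, Matrix.smul_mul]

end Naturality

/-! ### Behaviour under constant scaling -/

section Scaling

variable {n : ℕ} {r : ℝ} (hr : r ≠ 0)

include hr in
-- For singular A both sides are 0 by convention. This frees the scaling laws below from any
-- nondegeneracy assumption.
theorem inv_smul_matrix (A : Matrix (Fin n) (Fin n) ℝ) : (r • A)⁻¹ = r⁻¹ • A⁻¹ := by
  by_cases h : IsUnit A.det
  · refine Matrix.inv_eq_left_inv ?_
    rw [Matrix.smul_mul, Matrix.mul_smul, Matrix.nonsing_inv_mul _ h, smul_smul,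
      inv_mul_cancel₀ hr, one_smul]
  · rw [Matrix.nonsing_inv_apply_not_isUnit _ h, smul_zero, Matrix.nonsing_inv_apply_not_isUnit]
    rw [Matrix.det_smul, isUnit_iff_ne_zero]
    rw [isUnit_iff_ne_zero, not_not] at h
    simp [h]

include hr in
theorem metricTrace_smul_left (G A : Matrix (Fin n) (Fin n) ℝ) :
    metricTrace (r • G) A = r⁻¹ * metricTrace G A := by
  simp [metricTrace_eq_trace, inv_smul_matrix hr]

theorem pderiv_const_mul (i : Fin n) (u : Coord n → ℝ) (y : Coord n) :
    pderiv i (fun z => r * u z) y = r * pderiv i u y := by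
  have h : fderiv ℝ (r • u) y = r • fderiv ℝ u y := congrFun (fderiv_const_smul_field r) y
  exact congrArg (fun L : Coord n →L[ℝ] ℝ => L (EuclideanSpace.single i (1 : ℝ))) h

include hr in
theorem christoffel_smul (G : MatField n) (k i j : Fin n) :
    christoffel (fun y => r • G y) k i j = christoffel G k i j := by
  funext y
  simp only [christoffel, inv_smul_matrix hr, Matrix.smul_apply, smul_eq_mul, pderiv_const_mul]
  congr 1
  refine Finset.sum_congr rfl fun l _ => ?_
  field_simp

include hr in
theorem ricci_smul (G : MatField n) : ricci (fun y => r • G y) = ricci G := by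
  funext y
  simp only [ricci, christoffel_smul hr]

include hr in
theorem hessian_smul (G : MatField n) (u : Coord n → ℝ) :
    hessian (fun y => r • G y) u = hessian G u := by
  funext y
  simp only [hessian, christoffel_smul hr]

include hr in
theorem scalarCurv_smul (G : MatField n) (y : Coord n) :
    scalarCurv (fun y => r • G y) y = r⁻¹ * scalarCurv G y := by
  simp only [scalarCurv, ricci_smul hr, metricTrace_smul_left hr]

theorem hessian_const_mul (G : MatField n) (u : Coord n → ℝ) (c : ℝ) :
    hessian G (fun y => c * u y) = fun y => c • hessian G u y := by
  funext y
  ext i j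
  have h : ∀ j, pderiv j (fun y => c * u y) = fun y => c * pderiv j u y :=
    fun j => funext fun y => pderiv_const_mul j u y
  simp only [hessian, h, pderiv_const_mul, Matrix.of_apply, Matrix.smul_apply, smul_eq_mul, mul_sub,
    Finset.mul_sum]
  congr 1
  exact Finset.sum_congr rfl fun k _ => by ring

theorem iteratedDeriv_comp_mul_left (f : ℝ → ℝ) (c : ℝ) (m : ℕ) :
    iteratedDeriv m (fun s => f (c * s)) = fun s => c ^ m * iteratedDeriv m f (c * s) := by
  induction m with
  | zero => simp
  | succ m ih =>
    funext s
    rw [iteratedDeriv_succ, ih, deriv_const_mul_field,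
      deriv_comp_mul_left c (iteratedDeriv m f) s, iteratedDeriv_succ, smul_eq_mul, pow_succ,
      mul_assoc]

include hr in
theorem rhoDeriv_smul (γ : ℝ → MatField n) :
    rhoDeriv (fun ρ y => r • γ (r⁻¹ * ρ) y) = fun ρ y => rhoDeriv γ (r⁻¹ * ρ) y := by
  funext ρ y
  ext i j
  simp only [rhoDeriv, Matrix.of_apply, Matrix.smul_apply, smul_eq_mul, deriv_const_mul_field]
  rw [deriv_comp_mul_left r⁻¹ (fun s => γ s y i j) ρ, smul_eq_mul, mul_inv_cancel_left₀ hr]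

theorem rhoDeriv_comp_mul_left (γ : ℝ → MatField n) (c : ℝ) :
    rhoDeriv (fun ρ y => γ (c * ρ) y) = fun ρ y => c • rhoDeriv γ (c * ρ) y := by
  funext ρ y
  ext i j
  simp only [rhoDeriv, Matrix.of_apply, Matrix.smul_apply]
  exact deriv_comp_mul_left c (fun s => γ s y i j) ρ

include hr in
-- For r > 0 the substitution (t, ρ) ↦ (√r t, ρ/r) carries the ambient metric of γ to that of r
-- γ(ρ/r). Algebraically, the first ρ-derivative keeps its size, and the second gains r⁻¹, absorbed
-- by the explicit factor ρ.
theorem ambientRicci_smul (γ : ℝ → MatField n) :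
    ambientRicci (fun ρ y => r • γ (r⁻¹ * ρ) y) = fun ρ y => ambientRicci γ (r⁻¹ * ρ) y := by
  funext ρ y
  have h : ricci (fun y => r • γ (r⁻¹ * ρ) y) = ricci (γ (r⁻¹ * ρ)) := ricci_smul hr _
  simp only [ambientRicci, rhoDeriv_smul hr, rhoDeriv_comp_mul_left, h, inv_smul_matrix hr,
    metricTrace_smul_left hr, Matrix.mul_smul, Matrix.smul_mul, smul_smul]
  congr 3
  · congr 2 <;> first | rw [mul_comm ρ] | ring
  · field_simp

include hr in
theorem ambientRicciJet_smul (γ : ℝ → MatField n) (m : ℕ) (y : Coord n) :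
    ambientRicciJet (fun ρ y => r • γ (r⁻¹ * ρ) y) m y = r⁻¹ ^ m • ambientRicciJet γ m y := by
  ext i j
  simp only [ambientRicciJet, ambientRicci_smul hr, Matrix.of_apply, Matrix.smul_apply]
  have h := congrFun (iteratedDeriv_comp_mul_left (fun s => ambientRicci γ s y i j) r⁻¹ m) 0
  simpa using h

include hr in
-- The m-th jet of the ambient Ricci components scales by r⁻ᵐ, which is exactly the factor r ·
-- r⁻⁽ᵐ⁺¹⁾ carried by the coefficient of ρ^{m+1} in r γ(ρ/r).
theorem fgExpansion_smul (G : MatField n) (m : ℕ) :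
    fgExpansion (fun y => r • G y) m = fun ρ y => r • fgExpansion G m (r⁻¹ * ρ) y := by
  induction m with
  | zero => rfl
  | succ m ih =>
    funext ρ y
    simp only [fgExpansion, ih, ambientRicciJet_smul hr, metricTrace_smul_left hr,
      metricTrace_smul_right]
    ext i j
    simp only [Matrix.add_apply, Matrix.smul_apply, smul_eq_mul, mul_pow]
    generalize (1 / (m.factorial : ℝ)) = a
    generalize -(1 / (((m : ℝ) + 1) * ((m : ℝ) + 1 - (n : ℝ) / 2))) = b
    rw [pow_succ r⁻¹]
    have h := mul_inv_cancel₀ hr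
    generalize r⁻¹ = s at *
    generalize s ^ m = t
    generalize metricTrace (G y) (ambientRicciJet (fgExpansion G m) m y) = T
    generalize ambientRicciJet (fgExpansion G m) m y i j = D
    generalize 2 * ((m : ℝ) + 1 - n) = d
    linear_combination -(ρ ^ (m + 1) * b * t * a * D) * h

include hr in
-- The power of r is that of the jet of order n/2 - 1; in the trace term the scaling of the trace
-- and of G cancel.
theorem localObstruction_smul (G : MatField n) (y : Coord n) :
    localObstruction (fun y => r • G y) y = r⁻¹ ^ (n / 2 - 1) • localObstruction G y := by
  simp only [localObstruction, fgExpansion_smul hr, ambientRicciJet_smul hr,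
    metricTrace_smul_left hr, metricTrace_smul_right, smul_sub, smul_smul]
  congr 2
  field_simp

end Scaling

section ChartMap

variable {n : ℕ} {M : Type*} [TopologicalSpace M] [ChartedSpace (Coord n) M]

/-! ### Tensors and diffeomorphisms in charts -/

/-- The components of a covariant 2-tensor field in the preferred chart at `a`. -/
noncomputable def tensorMat (T : TwoTensor n M) (a : M) : MatField n := fun y =>
  Matrix.of fun i j => T ((extChartAt (𝓡 n) a).symm y)
    (mfderiv 𝓘(ℝ, Coord n) (𝓡 n) (extChartAt (𝓡 n) a).symm y (EuclideanSpace.single i (1 : ℝ)))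
    (mfderiv 𝓘(ℝ, Coord n) (𝓡 n) (extChartAt (𝓡 n) a).symm y (EuclideanSpace.single j (1 : ℝ)))

theorem bil_tensorMat (T : TwoTensor n M) (a : M) (y v w : Coord n) :
    bil (tensorMat T a y) v w = T ((extChartAt (𝓡 n) a).symm y)
      (mfderiv 𝓘(ℝ, Coord n) (𝓡 n) (extChartAt (𝓡 n) a).symm y v)
      (mfderiv 𝓘(ℝ, Coord n) (𝓡 n) (extChartAt (𝓡 n) a).symm y w) := by
  let L : Coord n →L[ℝ] Coord n := mfderiv 𝓘(ℝ, Coord n) (𝓡 n) (extChartAt (𝓡 n) a).symm y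
  let B : Coord n →L[ℝ] Coord n →L[ℝ] ℝ := T ((extChartAt (𝓡 n) a).symm y)
  have h : bil (tensorMat T a y) = B.bilinearComp L L := by
    refine clm_ext_stdVec fun i => clm_ext_stdVec fun j => ?_
    rw [bil_stdVec]
    rfl
  rw [h]
  rfl

/-- The derivative of the preferred chart at `a`. -/
noncomputable def chartDeriv (a x : M) : TangentSpace (𝓡 n) x →L[ℝ] Coord n :=
  mfderiv (𝓡 n) 𝓘(ℝ, Coord n) (extChartAt (𝓡 n) a) x

theorem ofComponents_apply (x : M) (A : Matrix (Fin n) (Fin n) ℝ) (v w : TangentSpace (𝓡 n) x) :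
    ofComponents x A v w = bil A (chartDeriv x x v)
      (chartDeriv x x w) := by
  have h : ofComponents x A v w =
      ∑ i, ∑ j, A i j * (component x i v * component x j w) := by
    simp [ofComponents]
  rw [h, bil_apply]
  rfl

variable [IsManifold (𝓡 n) ∞ M]

theorem tensor_eq_bil (T : TwoTensor n M) {a x : M} (hx : x ∈ (extChartAt (𝓡 n) a).source)
    (v w : TangentSpace (𝓡 n) x) :
    T x v w = bil (tensorMat T a (extChartAt (𝓡 n) a x))
      (chartDeriv a x v)
      (chartDeriv a x w) := by
  obtain ⟨y, hy, rfl⟩ : ∃ y ∈ (extChartAt (𝓡 n) a).target, (extChartAt (𝓡 n) a).symm y = x :=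
    ⟨_, (extChartAt (𝓡 n) a).map_source hx, (extChartAt (𝓡 n) a).left_inv hx⟩
  rw [(extChartAt (𝓡 n) a).right_inv hy]
  refine Eq.trans ?_ (bil_tensorMat T a y _ _).symm
  have h1 := mfderiv_symm_mfderiv_chart a hy v
  have h2 := mfderiv_symm_mfderiv_chart a hy w
  exact (congrArg₂ (fun v w => T ((extChartAt (𝓡 n) a).symm y) v w) h1 h2).symm

theorem chartDeriv_surjective {a x : M} (hx : x ∈ (extChartAt (𝓡 n) a).source) (v : Coord n) :
    ∃ v' : TangentSpace (𝓡 n) x,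
      chartDeriv a x v' = v := by
  have h1 := mfderiv_chart_mfderiv_symm a ((extChartAt (𝓡 n) a).map_source hx) v
  rw [(extChartAt (𝓡 n) a).left_inv hx] at h1
  exact ⟨_, h1⟩

/-- The coordinate expression of a map in the preferred charts at `a` and `b`. -/
noncomputable def chartMap (φ : M → M) (a b : M) (y : Coord n) : Coord n :=
  extChartAt (𝓡 n) b (φ ((extChartAt (𝓡 n) a).symm y))

/-- The domain of `chartMap`. -/
def chartDom (φ : M → M) (a b : M) : Set (Coord n) :=
  (extChartAt (𝓡 n) a).target ∩
    (fun y => φ ((extChartAt (𝓡 n) a).symm y)) ⁻¹' (extChartAt (𝓡 n) b).source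

variable {φ : M → M} (hφ : ContMDiff (𝓡 n) (𝓡 n) ∞ φ)

omit [IsManifold (𝓡 n) ∞ M] in
theorem mem_chartDom {a b x : M} (hx : x ∈ (extChartAt (𝓡 n) a).source)
    (hb : φ x ∈ (extChartAt (𝓡 n) b).source) : extChartAt (𝓡 n) a x ∈ chartDom φ a b :=
  ⟨(extChartAt (𝓡 n) a).map_source hx, by
    rw [Set.mem_preimage, (extChartAt (𝓡 n) a).left_inv hx]; exact hb⟩

omit [IsManifold (𝓡 n) ∞ M] in
theorem chartMap_chart {a b x : M} (hx : x ∈ (extChartAt (𝓡 n) a).source) :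
    chartMap φ a b (extChartAt (𝓡 n) a x) = extChartAt (𝓡 n) b (φ x) := by
  rw [chartMap, (extChartAt (𝓡 n) a).left_inv hx]

include hφ

omit [IsManifold (𝓡 n) ∞ M] in
theorem isOpen_chartDom (a b : M) : IsOpen (chartDom (n := n) φ a b) :=
  (hφ.continuous.comp_continuousOn (continuousOn_extChartAt_symm a)).isOpen_inter_preimage
    (isOpen_chart_target a) (isOpen_extChartAt_source b)

theorem contDiffOn_chartMap (a b : M) : 
    ContDiffOn ℝ ∞ (chartMap (n := n) φ a b) (chartDom φ a b) := by
  rw [← contMDiffOn_iff_contDiffOn]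
  intro y hy
  exact (((contMDiffAt_chart b hy.2).comp y
    ((hφ _).comp y (contMDiffAt_chart_symm a hy.1)))).contMDiffWithinAt

/-- The chain rule on the two ways of writing the chart at b after φ. -/
theorem fderiv_chartMap_apply {a b x : M} (hx : x ∈ (extChartAt (𝓡 n) a).source)
    (hb : φ x ∈ (extChartAt (𝓡 n) b).source) (v : TangentSpace (𝓡 n) x) :
    fderiv ℝ (chartMap φ a b) (extChartAt (𝓡 n) a x)
      (chartDeriv a x v) =
    chartDeriv b (φ x) (mfderiv (𝓡 n) (𝓡 n) φ x v) := by
  have hF : MDifferentiableAt 𝓘(ℝ, Coord n) 𝓘(ℝ, Coord n) (chartMap φ a b)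
      (extChartAt (𝓡 n) a x) :=
    (((contDiffOn_chartMap hφ a b).contDiffAt ((isOpen_chartDom (φ := φ) hφ a b).mem_nhds
      (mem_chartDom hx hb))).differentiableAt (by simp)).mdifferentiableAt
  have h1 := mfderiv_comp x hF (mdifferentiableAt_chart a hx)
  have h2 := mfderiv_comp x (mdifferentiableAt_chart b hb) ((hφ x).mdifferentiableAt (by simp))
  have heq : chartMap φ a b ∘ extChartAt (𝓡 n) a =ᶠ[nhds x] extChartAt (𝓡 n) b ∘ φ := by
    filter_upwards [(isOpen_extChartAt_source (I := 𝓡 n) a).mem_nhds hx] with z hz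
    exact chartMap_chart hz
  rw [heq.mfderiv_eq, h2, mfderiv_eq_fderiv] at h1
  exact (DFunLike.congr_fun h1 v).symm

omit hφ in
theorem isLocalDiffeo_chartMap (φ : M ≃ₘ⟮𝓡 n, 𝓡 n⟯ M) (a b : M) :
    IsLocalDiffeo (chartMap φ a b) (chartDom φ a b) (extChartAt (𝓡 n) b).target where
  isOpen := isOpen_chartDom φ.contMDiff a b
  smooth := contDiffOn_chartMap φ.contMDiff a b
  mapsTo y hy := (extChartAt (𝓡 n) b).map_source hy.2
  det y hy := by
    have h0 : chartMap φ a b y ∈ chartDom φ.symm b a := by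
      refine ⟨(extChartAt (𝓡 n) b).map_source hy.2, ?_⟩
      rw [Set.mem_preimage, chartMap, (extChartAt (𝓡 n) b).left_inv hy.2, φ.symm_apply_apply]
      exact (extChartAt (𝓡 n) a).map_target hy.1
    have h1 := (((contDiffOn_chartMap φ.contMDiff a b).contDiffAt
      ((isOpen_chartDom φ.contMDiff a b).mem_nhds hy)).differentiableAt (by simp)).hasFDerivAt
    have h2 := (((contDiffOn_chartMap φ.symm.contMDiff b a).contDiffAt
      ((isOpen_chartDom φ.symm.contMDiff b a).mem_nhds h0)).differentiableAt (by simp)).hasFDerivAt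
    have h3 := h2.comp y h1
    have heq : chartMap φ.symm b a ∘ chartMap φ a b =ᶠ[nhds y] id := by
      filter_upwards [(isOpen_chartDom φ.contMDiff a b).mem_nhds hy] with z hz
      simp only [Function.comp_apply, chartMap, id]
      rw [(extChartAt (𝓡 n) b).left_inv hz.2, φ.symm_apply_apply,
        (extChartAt (𝓡 n) a).right_inv hz.1]
    have h4 := h3.unique ((hasFDerivAt_id y).congr_of_eventuallyEq heq)
    have h5 : jac (fderiv ℝ (chartMap φ.symm b a) (chartMap φ a b y)) *
        jac (fderiv ℝ (chartMap φ a b) y) = 1 := by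
      rw [← jac_comp, h4]
      ext i j
      simp [jac, Matrix.one_apply]
    exact Matrix.isUnit_det_of_left_inverse h5

omit hφ in
theorem IsPullback.tensorMat_eq {φ : M ≃ₘ⟮𝓡 n, 𝓡 n⟯ M} {T S : TwoTensor n M}
    (h : IsPullback φ T S) (a b : M) :
    ∀ y ∈ chartDom φ a b, tensorMat S a y = pullMat (chartMap φ a b) (tensorMat T b) y := by
  intro y hy
  obtain ⟨x, hx, rfl⟩ : ∃ x ∈ (extChartAt (𝓡 n) a).source, extChartAt (𝓡 n) a x = y :=
    ⟨_, (extChartAt (𝓡 n) a).map_target hy.1, (extChartAt (𝓡 n) a).right_inv hy.1⟩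
  have hb : φ x ∈ (extChartAt (𝓡 n) b).source := by
    have := hy.2
    rwa [Set.mem_preimage, (extChartAt (𝓡 n) a).left_inv hx] at this
  refine bil_injective (ContinuousLinearMap.ext fun v => ContinuousLinearMap.ext fun w => ?_)
  obtain ⟨v, rfl⟩ := chartDeriv_surjective hx v
  obtain ⟨w, rfl⟩ := chartDeriv_surjective hx w
  rw [pullMat, bil_pull]
  refine (tensor_eq_bil S hx v w).symm.trans ?_
  rw [h, tensor_eq_bil T hb, chartMap_chart hx]
  exact (congrArg₂ (fun v w => bil (tensorMat T b (extChartAt (𝓡 n) b (φ x))) v w)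
    (fderiv_chartMap_apply φ.contMDiff hx hb v) (fderiv_chartMap_apply φ.contMDiff hx hb w)).symm

omit hφ in
-- Tensors such as `hess` are defined at each x by components in the chart centred there, so only
-- the charts at x and φ x have to be compared, and only at the centre.
theorem isPullback_ofComponents {φ : M ≃ₘ⟮𝓡 n, 𝓡 n⟯ M} {T S : TwoTensor n M} {A B : M → MatField n}
    (hS : ∀ x, S x = ofComponents x (A x (extChartAt (𝓡 n) x x)))
    (hT : ∀ x, T x = ofComponents x (B x (extChartAt (𝓡 n) x x)))
    (h : ∀ x, A x (extChartAt (𝓡 n) x x) =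
      pullMat (chartMap φ x (φ x)) (B (φ x)) (extChartAt (𝓡 n) x x)) : IsPullback φ T S := by
  intro x v w
  have hx := mem_extChartAt_source (I := 𝓡 n) x
  have hb := mem_extChartAt_source (I := 𝓡 n) (φ x)
  rw [hS, hT, ofComponents_apply, ofComponents_apply, h, pullMat, bil_pull, chartMap_chart hx]
  exact congrArg₂ (fun v w => bil (B (φ x) (extChartAt (𝓡 n) (φ x) (φ x))) v w)
    (fderiv_chartMap_apply φ.contMDiff hx hb v) (fderiv_chartMap_apply φ.contMDiff hx hb w)

end ChartMap

section TensorSmooth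

variable {n : ℕ} {M : Type*} [TopologicalSpace M] [ChartedSpace (Coord n) M]
  [IsManifold (𝓡 n) ∞ M]

/-! ### Smoothness of tensor fields in charts -/

/-- Smoothness of a covariant 2-tensor field. -/
def IsSmoothTensor (T : TwoTensor n M) : Prop :=
  ContMDiff (𝓡 n) ((𝓡 n).prod 𝓘(ℝ, Coord n →L[ℝ] Coord n →L[ℝ] ℝ)) ∞
    (fun b => Bundle.TotalSpace.mk' (Coord n →L[ℝ] Coord n →L[ℝ] ℝ)
      (E := fun x : M => TangentSpace (𝓡 n) x →L[ℝ] TangentSpace (𝓡 n) x →L[ℝ] ℝ) b (T b))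

/-- The coordinate vector field of the chart at `a` with constant component `v`. -/
noncomputable def constField (a : M) (v : Coord n) (x : M) : TangentSpace (𝓡 n) x :=
  mfderiv 𝓘(ℝ, Coord n) (𝓡 n) (extChartAt (𝓡 n) a).symm (extChartAt (𝓡 n) a x) v

theorem contMDiffOn_constField (a : M) (v : Coord n) :
    ContMDiffOn (𝓡 n) (𝓡 n).tangent ∞
      (fun x => (⟨x, constField a v x⟩ : TangentBundle (𝓡 n) M)) (extChartAt (𝓡 n) a).source := by
  rw [contMDiffOn_trivialization_iff]
  refine (contDiffOn_const (c := v)).congr fun y hy => ?_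
  have h := mfderiv_chart_mfderiv_symm a hy v
  rw [chartField, constField, (extChartAt (𝓡 n) a).right_inv hy]
  exact h

/-- The components are the values of T on coordinate vector fields, which are smooth sections over
the chart domain. -/
theorem IsSmoothTensor.contDiffOn {T : TwoTensor n M} (hT : IsSmoothTensor T) (a : M)
    (i j : Fin n) : ContDiffOn ℝ ∞ (fun y => tensorMat T a y i j) (extChartAt (𝓡 n) a).target := by
  have h1 : ContMDiffOn (𝓡 n) ((𝓡 n).prod 𝓘(ℝ, ℝ)) ∞
      (fun m ↦ Bundle.TotalSpace.mk' ℝ (E := Bundle.Trivial M ℝ) m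
        (T m (constField a (stdVec i) m) (constField a (stdVec j) m)))
        (extChartAt (𝓡 n) a).source := by
    apply ContMDiffOn.clm_bundle_apply₂ (F₁ := Coord n) (F₂ := Coord n)
    · exact hT.contMDiffOn
    · exact contMDiffOn_constField a (stdVec i)
    · exact contMDiffOn_constField a (stdVec j)
  have h2 : ContMDiffOn (𝓡 n) 𝓘(ℝ, ℝ) ∞
      (fun m ↦ T m (constField a (stdVec i) m) (constField a (stdVec j) m))
        (extChartAt (𝓡 n) a).source := by
    intro x hx
    have := h1 x hx
    simp only [Bundle.contMDiffWithinAt_totalSpace] at this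
    exact this.2
  rw [← contMDiffOn_iff_contDiffOn]
  refine (h2.comp (contMDiffOn_extChartAt_symm a)
    fun y hy => (extChartAt (𝓡 n) a).map_target hy).congr fun y hy => ?_
  simp only [Function.comp_apply, constField]
  rw [(extChartAt (𝓡 n) a).right_inv hy]
  rfl

/-- The hom-bundle trivialization at `a` reads T x through the derivative of the chart at `a`, so
its coordinate expression is the bilinear form of the component matrix. -/
theorem isSmoothTensor_of_contDiffOn {T : TwoTensor n M}
    (h : ∀ a i j, ContDiffOn ℝ ∞ (fun y => tensorMat T a y i j) (extChartAt (𝓡 n) a).target) :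
    IsSmoothTensor T := by
  intro a
  rw [contMDiffAt_hom_bundle]
  refine ⟨contMDiffAt_id, ?_⟩
  have h1 : ContDiffOn ℝ ∞ (fun y => bil (tensorMat T a y)) (extChartAt (𝓡 n) a).target :=
    contDiffOn_bil (h a)
  have h2 := (contMDiffOn_iff_contDiffOn.2 h1).comp (s := (extChartAt (𝓡 n) a).source)
      (f := extChartAt (𝓡 n) a) (fun x hx => (contMDiffAt_chart a hx).contMDiffWithinAt)
      fun y hy => (extChartAt (𝓡 n) a).map_source hy
  refine (h2.contMDiffAt (extChartAt_source_mem_nhds a)).congr_of_eventuallyEq ?_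
  filter_upwards [extChartAt_source_mem_nhds (I := 𝓡 n) a] with x hx
  have hx' : x ∈ (chartAt (Coord n) a).source := by rwa [extChartAt_source] at hx
  refine ContinuousLinearMap.ext fun v => ContinuousLinearMap.ext fun w => ?_
  have hb : x ∈ (trivializationAt (Coord n) (TangentSpace (𝓡 n)) a).baseSet := by simpa using hx'
  have h3 := inCoordinates_apply_eq₂ (𝕜 := ℝ) (F₁ := Coord n)
    (F₂ := Coord n) (F₃ := ℝ) (E₁ := fun x : M => TangentSpace (𝓡 n) x)
    (E₂ := fun x : M => TangentSpace (𝓡 n) x) (E₃ := Bundle.Trivial M ℝ) (x₀ := a) (x := x)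
    (ϕ := T x) (v := v) (w := w) hb hb (Set.mem_univ _)
  refine h3.trans ?_
  have h4 : ∀ v : Coord n, chartDeriv a x
      ((trivializationAt (Coord n) (TangentSpace (𝓡 n)) a).symmL ℝ x v) = v := fun v => by
    have h5 := (trivializationAt (Coord n) (TangentSpace (𝓡 n)) a).continuousLinearMapAt_symmL
      (R := ℝ) hb v
    rw [TangentBundle.continuousLinearMapAt_trivializationAt (I := 𝓡 n) hx'] at h5
    exact h5
  have h6 := tensor_eq_bil T hx
    ((trivializationAt (Coord n) (TangentSpace (𝓡 n)) a).symmL ℝ x v)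
    ((trivializationAt (Coord n) (TangentSpace (𝓡 n)) a).symmL ℝ x w)
  rw [h4, h4, Bundle.Trivialization.symmL_apply (hb := hb),
    Bundle.Trivialization.symmL_apply (hb := hb)] at h6
  exact (LinearMap.congr_fun (Bundle.Trivial.linearMapAt_trivialization ℝ M ℝ x) _).trans h6

theorem IsSmoothTensor.smul {T : TwoTensor n M} (hT : IsSmoothTensor T) (r : ℝ) :
    IsSmoothTensor fun x => r • T x :=
  isSmoothTensor_of_contDiffOn fun a i j => contDiffOn_const.mul (hT.contDiffOn a i j)

theorem IsPullback.isSmoothTensor {φ : M ≃ₘ⟮𝓡 n, 𝓡 n⟯ M} {T S : TwoTensor n M}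
    (h : IsPullback φ T S) (hT : IsSmoothTensor T) : IsSmoothTensor S := by
  refine isSmoothTensor_of_contDiffOn fun a i j y hy => ?_
  have hmem : y ∈ chartDom φ a (φ ((extChartAt (𝓡 n) a).symm y)) :=
    ⟨hy, mem_extChartAt_source (I := 𝓡 n) _⟩
  have hF := isLocalDiffeo_chartMap φ a (φ ((extChartAt (𝓡 n) a).symm y))
  have h1 := (contDiffOn_pullMat hF (hT.contDiffOn _) i j).congr fun z hz =>
    congrFun₂ (h.tensorMat_eq a _ z hz) i j
  exact (h1.contDiffAt (hF.isOpen.mem_nhds hmem)).contDiffWithinAt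

/-! ### Construction of metrics -/

/-- On the compact unit sphere B(v, v) has a positive minimum m, so B(v, v) < 1 forces ‖v‖² < 1/m.
The structure of a Riemannian metric asks for this boundedness. -/
theorem isVonNBounded_of_pos (B : Coord n →L[ℝ] Coord n →L[ℝ] ℝ) (hB : ∀ v, v ≠ 0 → 0 < B v v) :
    Bornology.IsVonNBounded ℝ {v | B v v < 1} := by
  rw [NormedSpace.isVonNBounded_iff]
  -- The sphere is empty in dimension 0.
  rcases (Metric.sphere (0 : Coord n) 1).eq_empty_or_nonempty with he | hne
  · refine (Metric.isBounded_closedBall (x := (0 : Coord n)) (r := 0)).subset fun v _ => ?_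
    by_contra hv
    have hv0 : ‖v‖ ≠ 0 := by simpa using hv
    have : ‖v‖⁻¹ • v ∈ Metric.sphere (0 : Coord n) 1 := by
      simp [norm_smul, hv0]
    rw [he] at this
    exact this
  have hcont : Continuous fun v => B v v := by fun_prop
  obtain ⟨e, he, hmin⟩ := (isCompact_sphere (0 : Coord n) 1).exists_isMinOn hne hcont.continuousOn
  have he1 : ‖e‖ = 1 := by simpa using he
  have hm : 0 < B e e := hB e fun h => by simp [h] at he1
  -- The radius avoids a square root: ‖v‖ ≤ ‖v‖² + 1.
  refine (Metric.isBounded_closedBall (x := (0 : Coord n)) (r := 1 / B e e + 1)).subset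
    fun v hv => ?_
  rw [mem_closedBall_zero_iff]
  by_cases hv0 : ‖v‖ = 0
  · rw [hv0]; positivity
  have h1 : B e e ≤ B (‖v‖⁻¹ • v) (‖v‖⁻¹ • v) :=
    hmin (by simp [norm_smul, hv0])
  simp only [map_smul, smul_apply, smul_eq_mul] at h1
  have h2 : 0 < ‖v‖ := lt_of_le_of_ne (norm_nonneg v) (Ne.symm hv0)
  have h3 : B e e * ‖v‖ ^ 2 < 1 := by
    calc B e e * ‖v‖ ^ 2 ≤ (‖v‖⁻¹ * (‖v‖⁻¹ * B v v)) * ‖v‖ ^ 2 := by gcongr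
      _ = B v v := by field_simp
      _ < 1 := hv
  have h4 : ‖v‖ ^ 2 < 1 / B e e := by rw [lt_div_iff₀ hm]; linarith
  nlinarith

/-- The Riemannian metric given by a smooth, symmetric, positive definite tensor field. -/
noncomputable def metricOfTensor (T : TwoTensor n M) (hsymm : ∀ x v w, T x v w = T x w v)
    (hpos : ∀ x v, v ≠ 0 → 0 < T x v v) (hsm : IsSmoothTensor T) : Metric n M where
  inner := T
  symm := hsymm
  pos := hpos
  isVonNBounded x := isVonNBounded_of_pos (n := n) (T x) (hpos x)
  contMDiff := hsm

/-- The pullback `φ^* T`. -/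
noncomputable def pullTensor (φ : M ≃ₘ⟮𝓡 n, 𝓡 n⟯ M) (T : TwoTensor n M) : TwoTensor n M := fun x =>
  let L : Coord n →L[ℝ] Coord n := mfderiv (𝓡 n) (𝓡 n) φ x
  let B : Coord n →L[ℝ] Coord n →L[ℝ] ℝ := T (φ x)
  B.bilinearComp L L

omit [IsManifold (𝓡 n) ∞ M] in
theorem isPullback_pullTensor (φ : M ≃ₘ⟮𝓡 n, 𝓡 n⟯ M) (T : TwoTensor n M) :
    IsPullback φ T (pullTensor φ T) := fun _ _ _ => rfl

omit [IsManifold (𝓡 n) ∞ M] in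
theorem mfderiv_diffeomorph_ne_zero (φ : M ≃ₘ⟮𝓡 n, 𝓡 n⟯ M) {x : M} {v : TangentSpace (𝓡 n) x}
    (hv : v ≠ 0) : mfderiv (𝓡 n) (𝓡 n) φ x v ≠ 0 := by
  intro h
  apply hv
  have h1 := mfderiv_comp x ((φ.symm.contMDiff (φ x)).mdifferentiableAt (by simp))
    ((φ.contMDiff x).mdifferentiableAt (by simp))
  have h2 : φ.symm ∘ φ = id := funext φ.symm_apply_apply
  rw [h2, mfderiv_id] at h1
  have h3 := DFunLike.congr_fun h1 v
  refine h3.trans ?_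
  exact (congrArg (mfderiv (𝓡 n) (𝓡 n) φ.symm (φ x)) h).trans (map_zero _)

/-- The metric `r φ^* h`. -/
noncomputable def pullMetric {r : ℝ} (hr : 0 < r) (φ : M ≃ₘ⟮𝓡 n, 𝓡 n⟯ M) (h : Metric n M) :
    Metric n M :=
  metricOfTensor (fun x => r • pullTensor φ h.inner x)
    (fun x _ _ => congrArg (r * ·) (h.symm (φ x) _ _))
    (fun x _ hv => mul_pos hr (h.pos (φ x) _ (mfderiv_diffeomorph_ne_zero φ hv)))
    (((isPullback_pullTensor φ h.inner).isSmoothTensor h.contMDiff).smul r)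

theorem isScaling_pullMetric {r : ℝ} (hr : 0 < r) (φ : M ≃ₘ⟮𝓡 n, 𝓡 n⟯ M) (h : Metric n M) :
    IsScaling r (pullMetric one_pos φ h) (pullMetric hr φ h) := fun x => by
  simp [pullMetric, metricOfTensor]

theorem isPullback_pullMetric_one (φ : M ≃ₘ⟮𝓡 n, 𝓡 n⟯ M) (h : Metric n M) :
    IsPullback φ h.inner (pullMetric one_pos φ h).inner := fun x v w => by
  simp [pullMetric, metricOfTensor, isPullback_pullTensor φ h.inner x v w]

theorem isMetricOn_gram (g : Metric n M) (a : M) :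
    IsMetricOn (gram g a) (extChartAt (𝓡 n) a).target where
  isOpen := isOpen_chart_target a
  smooth := IsSmoothTensor.contDiffOn (T := g.inner) g.contMDiff a
  symm y _ := Matrix.IsSymm.ext fun i j => g.symm _ _ _
  det y hy := by
    rw [isUnit_iff_ne_zero]
    intro h0
    obtain ⟨u, hu, hu0⟩ := Matrix.exists_vecMul_eq_zero_iff.2 h0
    -- A null vector of the Gram matrix would represent a nonzero tangent vector of length 0.
    let v : Coord n := WithLp.toLp 2 u
    have h1 : bil (gram g a y) v v = 0 := by
      rw [bil_apply, Finset.sum_comm]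
      have h2 : ∀ j, ∑ i, u i * gram g a y i j = 0 := fun j => congrFun hu0 j
      calc ∑ j, ∑ i, gram g a y i j * (v i * v j)
          = ∑ j, (∑ i, u i * gram g a y i j) * u j := by
            refine Finset.sum_congr rfl fun j _ => ?_
            rw [Finset.sum_mul]
            refine Finset.sum_congr rfl fun i _ => ?_
            simp only [v]
            ring
        _ = 0 := by simp [h2]
    have h3 : bil (gram g a y) v v = _ := bil_tensorMat g.inner a y v v
    rw [h1] at h3
    refine (g.pos _ _ ?_).ne h3
    intro h4
    apply hu
    have h5 := mfderiv_chart_mfderiv_symm a hy v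
    have h6 : v = 0 := h5.symm.trans ((congrArg _ h4).trans (map_zero _))
    exact congrArg WithLp.ofLp h6

end TensorSmooth

section Operators

variable {n : ℕ} {M : Type*} [TopologicalSpace M] [ChartedSpace (Coord n) M]
  [IsManifold (𝓡 n) ∞ M]

/-! ### Naturality of the geometric operators -/

theorem contDiffOn_chartFun {u : M → ℝ} (hu : ContMDiff (𝓡 n) 𝓘(ℝ, ℝ) ∞ u) (a : M) :
    ContDiffOn ℝ ∞ (chartFun u a) (extChartAt (𝓡 n) a).target := by
  rw [← contMDiffOn_iff_contDiffOn]
  exact hu.comp_contMDiffOn (contMDiffOn_extChartAt_symm a)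

theorem contMDiff_of_contDiffOn_chartFun {u : M → ℝ}
    (h : ∀ a, ContDiffOn ℝ ∞ (chartFun u a) (extChartAt (𝓡 n) a).target) :
    ContMDiff (𝓡 n) 𝓘(ℝ, ℝ) ∞ u := by
  intro a
  have h2 := (contMDiffOn_iff_contDiffOn.2 (h a)).comp (s := (extChartAt (𝓡 n) a).source)
      (f := extChartAt (𝓡 n) a) (fun x hx => (contMDiffAt_chart a hx).contMDiffWithinAt)
      fun y hy => (extChartAt (𝓡 n) a).map_source hy
  refine (h2.contMDiffAt (extChartAt_source_mem_nhds a)).congr_of_eventuallyEq ?_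
  filter_upwards [extChartAt_source_mem_nhds (I := 𝓡 n) a] with x hx
  simp only [Function.comp_apply, chartFun]
  rw [(extChartAt (𝓡 n) a).left_inv hx]

variable {φ : M ≃ₘ⟮𝓡 n, 𝓡 n⟯ M} {g g' : Metric n M} (h : IsPullback φ g.inner g'.inner)

omit [IsManifold (𝓡 n) ∞ M] in
theorem chartFun_comp (u : M → ℝ) (φ : M → M) (a b : M) : ∀ y ∈ chartDom (n := n) φ a b,
    chartFun (n := n) (u ∘ φ) a y = chartFun u b (chartMap φ a b y) := fun y hy => by
  simp only [chartFun, chartMap, Function.comp_apply]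
  rw [(extChartAt (𝓡 n) b).left_inv hy.2]

include h in
theorem gram_pullback (a b : M) :
    ∀ y ∈ chartDom φ a b, gram g' a y = pullMat (chartMap φ a b) (gram g b) y :=
  h.tensorMat_eq a b

include h in
theorem hessian_chart {u : M → ℝ} (hu : ContMDiff (𝓡 n) 𝓘(ℝ, ℝ) ∞ u) (a b : M) {y : Coord n}
    (hy : y ∈ chartDom φ a b) :
    hessian (gram g' a) (chartFun (u ∘ φ) a) y =
      pullMat (chartMap φ a b) (hessian (gram g b) (chartFun u b)) y :=
  hessian_pull (isLocalDiffeo_chartMap φ a b) (isMetricOn_gram g b) (gram_pullback h a b)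
    (contDiffOn_chartFun hu b) (chartFun_comp u φ a b) hy

include h in
theorem hess_natural {u : M → ℝ} (hu : ContMDiff (𝓡 n) 𝓘(ℝ, ℝ) ∞ u) :
    IsPullback φ (hess g u) (hess g' (u ∘ φ)) :=
  isPullback_ofComponents (A := fun x => hessian (gram g' x) (chartFun (u ∘ φ) x))
    (B := fun x => hessian (gram g x) (chartFun u x)) (fun _ => rfl) (fun _ => rfl)
    fun x => hessian_chart h hu x (φ x)
      (mem_chartDom (mem_extChartAt_source x) (mem_extChartAt_source (φ x)))

include h in
-- The chart b around φ x is free for two uses: b = φ x gives naturality, and φ = id with b fixed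
-- gives independence of the chart. The latter is what makes the Laplacian, defined with a chart
-- varying with x, a smooth function.
theorem laplacian_comp_eq {u : M → ℝ} (hu : ContMDiff (𝓡 n) 𝓘(ℝ, ℝ) ∞ u) {x b : M}
    (hb : φ x ∈ (extChartAt (𝓡 n) b).source) :
    laplacian g' (u ∘ φ) x = metricTrace (gram g b (extChartAt (𝓡 n) b (φ x)))
      (hessian (gram g b) (chartFun u b) (extChartAt (𝓡 n) b (φ x))) := by
  have hx := mem_extChartAt_source (I := 𝓡 n) x
  have hmem := mem_chartDom (φ := φ) hx hb
  rw [laplacian, hessian_chart h hu x b hmem, gram_pullback h x b _ hmem, pullMat, pullMat,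
    metricTrace_congruence ((isLocalDiffeo_chartMap φ x b).det _ hmem), chartMap_chart hx]

include h in
theorem scalarCurvature_comp_eq {x b : M} (hb : φ x ∈ (extChartAt (𝓡 n) b).source) :
    scalarCurvature g' x = scalarCurv (gram g b) (extChartAt (𝓡 n) b (φ x)) := by
  have hx := mem_extChartAt_source (I := 𝓡 n) x
  have hmem := mem_chartDom (φ := φ) hx hb
  rw [scalarCurvature, scalarCurv, ricci_pull (isLocalDiffeo_chartMap φ x b)
    (isMetricOn_gram g b) (gram_pullback h x b) hmem, gram_pullback h x b _ hmem, pullMat, pullMat,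
    metricTrace_congruence ((isLocalDiffeo_chartMap φ x b).det _ hmem), chartMap_chart hx]
  rfl

omit [IsManifold (𝓡 n) ∞ M] in
theorem isPullback_refl (T : TwoTensor n M) :
    IsPullback (Diffeomorph.refl (𝓡 n) M ∞) T T := fun x v w => by
  have h1 : mfderiv (𝓡 n) (𝓡 n) (Diffeomorph.refl (𝓡 n) M ∞) x = ContinuousLinearMap.id ℝ _ :=
    mfderiv_id
  rw [h1]
  rfl

theorem contMDiff_laplacian (g : Metric n M) {u : M → ℝ} (hu : ContMDiff (𝓡 n) 𝓘(ℝ, ℝ) ∞ u) :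
    ContMDiff (𝓡 n) 𝓘(ℝ, ℝ) ∞ (laplacian g u) := by
  refine contMDiff_of_contDiffOn_chartFun fun b => ?_
  have hG := isMetricOn_gram g b
  refine (contDiffOn_metricTrace hG.smooth hG.det
    (hG.contDiffOn_hessian (contDiffOn_chartFun hu b))).congr fun y hy => ?_
  have h1 := laplacian_comp_eq (isPullback_refl g.inner) hu
    (x := (extChartAt (𝓡 n) b).symm y) (b := b) ((extChartAt (𝓡 n) b).map_target hy)
  have h0 : Diffeomorph.refl (𝓡 n) M ∞ ((extChartAt (𝓡 n) b).symm y) =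
      (extChartAt (𝓡 n) b).symm y := rfl
  rw [h0, (extChartAt (𝓡 n) b).right_inv hy] at h1
  exact h1

theorem contMDiff_scalarCurvature (g : Metric n M) :
    ContMDiff (𝓡 n) 𝓘(ℝ, ℝ) ∞ (scalarCurvature g) := by
  refine contMDiff_of_contDiffOn_chartFun fun b => ?_
  have hG := isMetricOn_gram g b
  refine (contDiffOn_metricTrace hG.smooth hG.det hG.contDiffOn_ricci).congr fun y hy => ?_
  have h1 := scalarCurvature_comp_eq (isPullback_refl g.inner)
    (x := (extChartAt (𝓡 n) b).symm y) (b := b) ((extChartAt (𝓡 n) b).map_target hy)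
  have h0 : Diffeomorph.refl (𝓡 n) M ∞ ((extChartAt (𝓡 n) b).symm y) =
      (extChartAt (𝓡 n) b).symm y := rfl
  rw [h0, (extChartAt (𝓡 n) b).right_inv hy] at h1
  exact h1

include h in
theorem laplacian_natural {u : M → ℝ} (hu : ContMDiff (𝓡 n) 𝓘(ℝ, ℝ) ∞ u) :
    laplacian g' (u ∘ φ) = laplacian g u ∘ φ :=
  funext fun x => laplacian_comp_eq h hu (mem_extChartAt_source (φ x))

include h in
theorem scalarCurvature_natural : scalarCurvature g' = scalarCurvature g ∘ φ :=
  funext fun x => scalarCurvature_comp_eq h (mem_extChartAt_source (φ x))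

theorem contMDiff_iterate_laplacian (g : Metric n M) {u : M → ℝ}
    (hu : ContMDiff (𝓡 n) 𝓘(ℝ, ℝ) ∞ u) (k : ℕ) :
    ContMDiff (𝓡 n) 𝓘(ℝ, ℝ) ∞ ((laplacian g)^[k] u) := by
  induction k with
  | zero => exact hu
  | succ k ih =>
    rw [Function.iterate_succ_apply']
    exact contMDiff_laplacian g ih

include h in
theorem iterate_laplacian_natural {u : M → ℝ} (hu : ContMDiff (𝓡 n) 𝓘(ℝ, ℝ) ∞ u) (k : ℕ) :
    (laplacian g')^[k] (u ∘ φ) = (laplacian g)^[k] u ∘ φ := by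
  induction k with
  | zero => rfl
  | succ k ih =>
    rw [Function.iterate_succ_apply', Function.iterate_succ_apply', ih,
      laplacian_natural h (contMDiff_iterate_laplacian g hu k)]

include h in
theorem obstruction_natural : IsPullback φ (obstruction g) (obstruction g') :=
  isPullback_ofComponents (A := fun x => localObstruction (gram g' x))
    (B := fun x => localObstruction (gram g x)) (fun _ => rfl) (fun _ => rfl)
    fun x => localObstruction_pull (isLocalDiffeo_chartMap φ x (φ x)) (isMetricOn_gram g (φ x))
      (gram_pullback h x (φ x))
      (mem_chartDom (mem_extChartAt_source x) (mem_extChartAt_source (φ x)))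

theorem isNatural_ambientObstructionFlowTensor :
    IsNatural (ambientObstructionFlowTensor (n := n) (M := M)) := by
  intro φ g g' h x v w
  have h1 := obstruction_natural h x v w
  have h2 := congrFun (iterate_laplacian_natural h (contMDiff_scalarCurvature g) (n / 2 - 1)) x
  rw [← scalarCurvature_natural h] at h2
  simp only [ambientObstructionFlowTensor, add_apply, smul_apply, h1, h2, h x v w,
    Function.comp_apply]

/-! ### Weights of the geometric operators -/

section Weights

variable {r : ℝ} (hs : IsScaling r g g')

include hs

theorem gram_scaling (a : M) : gram g' a = fun y => r • gram g a y := by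
  funext y
  ext i j
  exact DFunLike.congr_fun (DFunLike.congr_fun (hs _) _) _

variable (hr : r ≠ 0)

include hr

theorem hess_scaling (u : M → ℝ) : hess g' u = hess g u := by
  funext x
  rw [hess, hess, gram_scaling hs, hessian_smul hr]

theorem laplacian_scaling (u : M → ℝ) : laplacian g' u = fun x => r⁻¹ * laplacian g u x := by
  funext x
  rw [laplacian, laplacian, gram_scaling hs, hessian_smul hr, metricTrace_smul_left hr]

theorem scalarCurvature_scaling :
    scalarCurvature g' = fun x => r⁻¹ * scalarCurvature g x := by
  funext x
  rw [scalarCurvature, scalarCurvature, gram_scaling hs, scalarCurv_smul hr]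

omit hs hr in
theorem laplacian_const_mul (g : Metric n M) (c : ℝ) (u : M → ℝ) :
    laplacian g (fun x => c * u x) = fun x => c * laplacian g u x := by
  funext x
  have h1 : chartFun (n := n) (fun x => c * u x) x = fun y => c * chartFun u x y := rfl
  rw [laplacian, laplacian, h1, hessian_const_mul, metricTrace_smul_right]

/-- The constant c is carried along because the iteration is applied to the scalar curvature, which
itself scales by r⁻¹. -/
theorem iterate_laplacian_scaling (c : ℝ) (u : M → ℝ) (k : ℕ) :
    (laplacian g')^[k] (fun x => c * u x) = fun x => r⁻¹ ^ k * c * (laplacian g)^[k] u x := by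
  induction k with
  | zero => simp
  | succ k ih =>
    rw [Function.iterate_succ_apply', ih, laplacian_scaling hs hr, laplacian_const_mul]
    funext x
    rw [Function.iterate_succ_apply', pow_succ]
    ring

theorem obstruction_scaling (x : M) :
    obstruction g' x = r⁻¹ ^ (n / 2 - 1) • obstruction g x := by
  have h1 : ∀ (c : ℝ) (A : Matrix (Fin n) (Fin n) ℝ),
      ofComponents x (c • A) = c • ofComponents x A := fun c A => by
    refine ContinuousLinearMap.ext fun v => ContinuousLinearMap.ext fun w => ?_
    rw [smul_apply, smul_apply, ofComponents_apply, ofComponents_apply, bil_smul]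
    rfl
  rw [obstruction, obstruction, gram_scaling hs, localObstruction_smul hr, h1]

end Weights

/-- With n = 2m both summands scale by r^{-(m-1)}: the obstruction tensor through its jet order, and
the other because Δ^{m-1}S contributes r^{-m} and the metric r. -/
theorem hasWeight_ambientObstructionFlowTensor (hn : 4 ≤ n) (he : Even n) :
    HasWeight (2 - (n : ℝ)) (ambientObstructionFlowTensor (n := n) (M := M)) := by
  intro r hr g g' hs x
  obtain ⟨m, rfl⟩ := he
  have hpow : r ^ ((2 - ((m + m : ℕ) : ℝ)) / 2) = r⁻¹ ^ ((m + m) / 2 - 1) := by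
    have h1 : (m + m) / 2 - 1 = m - 1 := by omega
    rw [h1, inv_pow, ← Real.rpow_natCast, ← Real.rpow_neg hr.le, Nat.cast_sub (by omega)]
    congr 1
    push_cast
    ring
  rw [hpow, ambientObstructionFlowTensor, ambientObstructionFlowTensor,
    obstruction_scaling hs hr.ne', scalarCurvature_scaling hs hr.ne',
    iterate_laplacian_scaling hs hr.ne', hs x]
  refine ContinuousLinearMap.ext fun v => ContinuousLinearMap.ext fun w => ?_
  simp only [add_apply, smul_apply, smul_eq_mul]
  field_simp

end Operators

/-! ### The Lie derivative of the metric along a gradient field in coordinates -/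

section LocalLie

variable {n : ℕ} {G : MatField n} {V : Set (Coord n)} (hG : IsMetricOn G V) {u : Coord n → ℝ}
  (hu : ContDiffOn ℝ ∞ u V) {X : Coord n → Coord n} (hX : ContDiffOn ℝ ∞ X V)
  (hgrad : ∀ y ∈ V, ∀ w, bil (G y) (X y) w = fderiv ℝ u y w) {y : Coord n} (hy : y ∈ V)

include hG hu hX hgrad hy

/-- The left side is the Lie derivative of G along X, the gradient of u. Differentiating G(X, b) =
du(b) in the direction a and adding the instances (v, w) and (w, v) gives twice the second
derivative of u plus derivatives of G, which the Koszul formula turns into the Christoffel term. -/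
theorem lieDeriv_metric_eq (v w : Coord n) :
    fderiv ℝ (fun z => bil (G z)) y (X y) v w + bil (G y) (fderiv ℝ X y v) w
      + bil (G y) v (fderiv ℝ X y w) = 2 * bil (hessian G u y) v w := by
  have hXd := ((hX.contDiffAt (hG.isOpen.mem_nhds hy)).differentiableAt (by simp)).hasFDerivAt
  have huy := hu.contDiffAt (hG.isOpen.mem_nhds hy)
  have hud : HasFDerivAt (fderiv ℝ u) (fderiv ℝ (fderiv ℝ u) y) y :=
    ((huy.fderiv_right (m := ∞) (by simp)).differentiableAt (by simp)).hasFDerivAt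
  have hsymm : fderiv ℝ (fderiv ℝ u) y v w = fderiv ℝ (fderiv ℝ u) y w v :=
    (huy.isSymmSndFDerivAt (by simpa using two_le_infty)) v w
  have key : ∀ a b, fderiv ℝ (fun z => bil (G z)) y a (X y) b + bil (G y) (fderiv ℝ X y a) b =
      fderiv ℝ (fderiv ℝ u) y a b := fun a b => by
    have h1 := ((hG.hasFDerivAt_bil hy).clm_apply hXd).clm_apply (hasFDerivAt_const b y)
    have h2 := hud.clm_apply (hasFDerivAt_const b y)
    have heq : (fun z => bil (G z) (X z) b) =ᶠ[nhds y] fun z => fderiv ℝ u z b := by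
      filter_upwards [hG.isOpen.mem_nhds hy] with z hz using hgrad z hz b
    have h3 := DFunLike.congr_fun (h1.unique (h2.congr_of_eventuallyEq heq)) a
    simpa [add_comm] using h3
  have h1 := key v w
  have h2 := key w v
  have h3 := bil_symm (hG.symm y hy) v (fderiv ℝ X y w)
  have h4 : bil (G y) (chr G y v w) (X y) = fderiv ℝ u y (chr G y v w) := by
    rw [bil_symm (hG.symm y hy), hgrad y hy]
  rw [bil_chr hG hy] at h4
  have h5 := fderiv_bil_symm hG hy v w (X y)
  have h6 := fderiv_bil_symm hG hy w v (X y)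
  rw [bil_hessian huy]
  linarith

/-- P is a flow read in a chart, smooth only near (0, y). The derivative at time 0 of its pullback
of G is the Lie derivative of the preceding lemma. -/
theorem hasDerivAt_pullback_metric {P : ℝ × Coord n → Coord n} (hP : ContDiffAt ℝ ∞ P (0, y))
    (hP0 : ∀ z ∈ V, P (0, z) = z) (hPX : ∀ z ∈ V, HasDerivAt (fun r => P (r, z)) (X z) 0)
    (v w : Coord n) :
    HasDerivAt (fun r => bil (G (P (r, y))) (fderiv ℝ (fun z => P (r, z)) y v)
      (fderiv ℝ (fun z => P (r, z)) y w)) (2 * bil (hessian G u y) v w) 0 := by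
  have hV := hG.isOpen.mem_nhds hy
  have hev : ∀ᶠ p in nhds ((0 : ℝ), y), DifferentiableAt ℝ P p := by
    filter_upwards [(hP.of_le (m := 1) (by simp)).eventually (by simp)] with p hp
      using hp.differentiableAt (by simp)
  have hpart : ∀ p, DifferentiableAt ℝ P p → ∀ v,
      fderiv ℝ (fun z => P (p.1, z)) p.2 v = fderiv ℝ P p (0, v) := fun p hp v => by
    have h1 := HasFDerivAt.comp (g := P) (f := fun z => (p.1, z)) p.2 hp.hasFDerivAt
      (hasFDerivAt_prodMk_right p.1 p.2)
    have h2 : HasFDerivAt (fun z => P (p.1, z)) _ p.2 := h1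
    rw [h2.fderiv]
    simp
  have hDP : HasFDerivAt (fderiv ℝ P) (fderiv ℝ (fderiv ℝ P) (0, y)) (0, y) :=
    ((hP.fderiv_right (m := ∞) (by simp)).differentiableAt (by simp)).hasFDerivAt
  have hsymm := hP.isSymmSndFDerivAt (by simpa using two_le_infty)
  have hPd : DifferentiableAt ℝ P (0, y) := hev.self_of_nhds
  have hr : ∀ p : ℝ × Coord n, DifferentiableAt ℝ P p →
      HasDerivAt (fun r => P (r, p.2)) (fderiv ℝ P p (1, 0)) p.1 := fun p hp => by
    have h1 := HasFDerivAt.comp (g := P) (f := fun s : ℝ => (s, p.2)) p.1 hp.hasFDerivAt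
      (hasFDerivAt_prodMk_left p.1 p.2)
    have h3 := h1.hasDerivAt
    rwa [ContinuousLinearMap.comp_apply, ContinuousLinearMap.inl_apply] at h3
  -- Time and space derivatives of P commute, so the spatial differential changes at rate dX.
  have hmixed : ∀ v, fderiv ℝ (fderiv ℝ P) (0, y) (1, 0) (0, v) = fderiv ℝ X y v := fun v => by
    rw [hsymm]
    have h1 := HasFDerivAt.comp (g := fderiv ℝ P) (f := fun z => ((0 : ℝ), z)) y hDP
      (hasFDerivAt_prodMk_right 0 y)
    have h2 := h1.clm_apply (hasFDerivAt_const ((1 : ℝ), (0 : Coord n)) y)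
    have heq : X =ᶠ[nhds y] fun z => fderiv ℝ P (0, z) (1, 0) := by
      filter_upwards [hV, (Continuous.prodMk_right (0 : ℝ)).continuousAt.eventually hev]
        with z hz hz'
      exact (hPX z hz).unique (hr (0, z) hz')
    have h3 : HasFDerivAt X _ y := h2.congr_of_eventuallyEq heq
    rw [h3.fderiv]
    simp
  have hcurve : ∀ v, HasDerivAt (fun r => fderiv ℝ (fun z => P (r, z)) y v) (fderiv ℝ X y v) 0 :=
    fun v => by
      have h1 := HasFDerivAt.comp (g := fderiv ℝ P) (f := fun s : ℝ => (s, y)) 0 hDP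
        (hasFDerivAt_prodMk_left 0 y)
      have h2 := (h1.clm_apply (hasFDerivAt_const ((0 : ℝ), v) (0 : ℝ))).hasDerivAt
      have heq : (fun r => fderiv ℝ (fun z => P (r, z)) y v) =ᶠ[nhds 0]
          fun r => fderiv ℝ P (r, y) (0, v) := by
        filter_upwards [(Continuous.prodMk_left y).continuousAt.eventually hev] with r hr'
        exact hpart (r, y) hr' v
      refine (h2.congr_of_eventuallyEq heq).congr_deriv ?_
      rw [← hmixed]
      simp
  have hzero : ∀ v, fderiv ℝ (fun z => P (0, z)) y v = v := fun v => by
    have heq : (fun z => P (0, z)) =ᶠ[nhds y] id := by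
      filter_upwards [hV] with z hz using hP0 z hz
    rw [heq.fderiv_eq, fderiv_id]
    rfl
  have hG1 : HasFDerivAt (fun z => bil (G z)) (fderiv ℝ (fun z => bil (G z)) y) (P (0, y)) := by
    rw [hP0 y hy]
    exact hG.hasFDerivAt_bil hy
  have hG2 : HasDerivAt (fun r => bil (G (P (r, y)))) (fderiv ℝ (fun z => bil (G z)) y (X y)) 0 :=
    HasFDerivAt.comp_hasDerivAt (l := fun z => bil (G z)) (f := fun r => P (r, y)) (0 : ℝ) hG1
      (hPX y hy)
  refine ((hG2.clm_apply (hcurve v)).clm_apply (hcurve w)).congr_deriv ?_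
  rw [hzero, hzero, hP0 y hy, ← lieDeriv_metric_eq hG hu hX hgrad hy v w]
  simp

end LocalLie

/-! ### The gradient field -/

section Gradient

variable {n : ℕ} {M : Type*} [TopologicalSpace M] [ChartedSpace (Coord n) M]
  [IsManifold (𝓡 n) ∞ M] (h : Metric n M) {u : M → ℝ}

theorem inner_grad (u : M → ℝ) (x : M) (v : TangentSpace (𝓡 n) x) :
    h.inner x (grad h u x) v = mfderiv (𝓡 n) 𝓘(ℝ, ℝ) u x v :=
  Classical.choose_spec (exists_gradient h u x) v

variable (hu : ContMDiff (𝓡 n) 𝓘(ℝ, ℝ) ∞ u)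

include hu

theorem bil_gram_chartField_grad (a : M) {y : Coord n} (hy : y ∈ (extChartAt (𝓡 n) a).target)
    (w : Coord n) :
    bil (gram h a y) (chartField (grad h u) a y) w = fderiv ℝ (chartFun u a) y w := by
  have h1 : bil (gram h a y) (chartField (grad h u) a y) w = _ := bil_tensorMat h.inner a y _ _
  rw [h1]
  have h2 := mfderiv_symm_chartField (grad h u) a hy
  refine (congrArg (fun X => h.inner ((extChartAt (𝓡 n) a).symm y) X _) h2).trans ?_
  refine (inner_grad h u _ _).trans ?_
  have h3 := mfderiv_comp y ((hu ((extChartAt (𝓡 n) a).symm y)).mdifferentiableAt (by simp))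
    (mdifferentiableAt_chart_symm a hy)
  have h4 := DFunLike.congr_fun h3 w
  refine h4.symm.trans ?_
  rw [mfderiv_eq_fderiv]
  rfl

/-- The gradient is chosen point by point, but its chart components are forced to be ∂ⱼu contracted
with the inverse Gram matrix. -/
theorem isSmoothField_grad : IsSmoothField (grad h u) := by
  refine isSmoothField_of_contDiffOn fun a => ?_
  have hG := isMetricOn_gram h a
  have hu' := contDiffOn_chartFun hu a
  rw [contDiffOn_euclidean]
  intro i
  have h1 : ContDiffOn ℝ ∞ (fun y => ∑ j, pderiv j (chartFun u a) y * (gram h a y)⁻¹ j i)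
      (extChartAt (𝓡 n) a).target :=
    ContDiffOn.sum fun j _ => (contDiffOn_pderiv hG.isOpen hu' j).mul
      (contDiffOn_inv hG.smooth hG.det j i)
  refine h1.congr fun y hy => ?_
  have h2 : Matrix.vecMul (fun i => chartField (grad h u) a y i) (gram h a y) =
      fun j => pderiv j (chartFun u a) y := by
    funext j
    have h3 := bil_gram_chartField_grad h hu a hy (stdVec j)
    rw [bil_apply] at h3
    rw [pderiv, ← h3]
    simp [Matrix.vecMul, dotProduct, mul_comm]
  have h4 : (fun i => chartField (grad h u) a y i) =
      Matrix.vecMul (fun j => pderiv j (chartFun u a) y) (gram h a y)⁻¹ := by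
    rw [← h2, Matrix.vecMul_vecMul, Matrix.mul_nonsing_inv _ (hG.det y hy), Matrix.vecMul_one]
  exact congrFun h4 i

end Gradient

section FlowDiffeo

variable {n : ℕ} {M : Type*} [TopologicalSpace M] [ChartedSpace (Coord n) M]
  [IsManifold (𝓡 n) ∞ M] [T2Space M] {X : ∀ x : M, TangentSpace (𝓡 n) x}
  (hc : IsCompleteField X) (hX : IsSmoothField X)

/-! ### The flow as a family of diffeomorphisms -/

include hX in
theorem contMDiff_fieldFlow_time (s : ℝ) : ContMDiff (𝓡 n) (𝓡 n) ∞ (fieldFlow hc s) :=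
  (contMDiff_fieldFlow hc hX).comp (contMDiff_const.prodMk contMDiff_id)

/-- The time-`s` map of a complete smooth vector field. -/
noncomputable def flowDiffeo (s : ℝ) : M ≃ₘ⟮𝓡 n, 𝓡 n⟯ M where
  toFun := fieldFlow hc s
  invFun := fieldFlow hc (-s)
  left_inv x := by rw [← fieldFlow_add hc hX, neg_add_cancel, fieldFlow_zero]
  right_inv x := by rw [← fieldFlow_add hc hX, add_neg_cancel, fieldFlow_zero]
  contMDiff_toFun := contMDiff_fieldFlow_time hc hX s
  contMDiff_invFun := contMDiff_fieldFlow_time hc hX (-s)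

omit [T2Space M] in
theorem hasDerivAt_chart_fieldFlow (a x : M)
    (hx : x ∈ (extChartAt (𝓡 n) a).source) :
    HasDerivAt (fun r => extChartAt (𝓡 n) a (fieldFlow hc r x))
      (chartField X a (extChartAt (𝓡 n) a x)) 0 := by
  have h0 := isMIntegralCurve_fieldFlow hc x 0
  have hx0 : fieldFlow hc 0 x ∈ (extChartAt (𝓡 n) a).source := by rwa [fieldFlow_zero]
  have h1 := HasMFDerivAt.comp (0 : ℝ) (mdifferentiableAt_chart a hx0).hasMFDerivAt h0
  let L : ℝ →L[ℝ] Coord n := (chartDeriv a (fieldFlow hc 0 x)).comp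
    ((1 : ℝ →L[ℝ] ℝ).smulRight (X (fieldFlow hc 0 x)))
  have h2 : HasFDerivAt (fun r => extChartAt (𝓡 n) a (fieldFlow hc r x)) L 0 := h1.hasFDerivAt
  refine h2.hasDerivAt.congr_deriv ?_
  have h3 : ∀ z, z = x → chartDeriv a z (X z) = chartField X a (extChartAt (𝓡 n) a x) := by
    rintro z rfl
    rw [chartField, (extChartAt (𝓡 n) a).left_inv hx]
    rfl
  rw [← h3 _ (fieldFlow_zero hc x)]
  exact congrArg (chartDeriv a (fieldFlow hc 0 x)) (one_smul ℝ _)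

end FlowDiffeo

/-! ### The derivative of the pulled-back metric along the gradient flow. -/

section LieDerivative

variable {n : ℕ} {M : Type*} [TopologicalSpace M] [ChartedSpace (Coord n) M]
  [IsManifold (𝓡 n) ∞ M] [T2Space M] (h : Metric n M) {u : M → ℝ}
  (hu : ContMDiff (𝓡 n) 𝓘(ℝ, ℝ) ∞ u) (hc : IsCompleteField (grad h u))

include hu

theorem hasDerivAt_pullback_flow_zero (x : M) (v w : TangentSpace (𝓡 n) x) :
    HasDerivAt (fun r => h.inner (fieldFlow hc r x)
      (mfderiv (𝓡 n) (𝓡 n) (fieldFlow hc r) x v) (mfderiv (𝓡 n) (𝓡 n) (fieldFlow hc r) x w))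
      (2 * hess h u x v w) 0 := by
  have hX := isSmoothField_grad h hu
  have hx := mem_extChartAt_source (I := 𝓡 n) x
  have hy := mem_extChartAt_target (I := 𝓡 n) x
  have hflow := contMDiff_fieldFlow hc hX
  let P : ℝ × Coord n → Coord n := fun p => chartMap (fieldFlow hc p.1) x x p.2
  have hP : ContDiffAt ℝ ∞ P (0, extChartAt (𝓡 n) x x) := by
    have h1 : ContMDiffAt (𝓘(ℝ, ℝ).prod 𝓘(ℝ, Coord n)) (𝓘(ℝ, ℝ).prod (𝓡 n)) ∞
        (fun p : ℝ × Coord n => (p.1, (extChartAt (𝓡 n) x).symm p.2))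
        (0, extChartAt (𝓡 n) x x) :=
      contMDiffAt_fst.prodMk (ContMDiffAt.comp (g := (extChartAt (𝓡 n) x).symm)
        (f := Prod.snd) (0, extChartAt (𝓡 n) x x) (contMDiffAt_chart_symm x hy) contMDiffAt_snd)
    have h2 := ContMDiffAt.comp (g := fun p : ℝ × M => fieldFlow hc p.1 p.2)
      (f := fun p : ℝ × Coord n => (p.1, (extChartAt (𝓡 n) x).symm p.2))
      (0, extChartAt (𝓡 n) x x) (hflow _) h1
    have h3 : ContMDiffAt (𝓘(ℝ, ℝ).prod 𝓘(ℝ, Coord n)) 𝓘(ℝ, Coord n) ∞ P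
        (0, extChartAt (𝓡 n) x x) := by
      refine ContMDiffAt.comp (g := extChartAt (𝓡 n) x) (0, extChartAt (𝓡 n) x x)
        (contMDiffAt_chart x ?_) h2
      rw [fieldFlow_zero]
      exact (extChartAt (𝓡 n) x).map_target hy
    rw [← contMDiffAt_iff_contDiffAt, modelWithCornersSelf_prod, ← chartedSpaceSelf_prod]
    exact h3
  have hP0 : ∀ z ∈ (extChartAt (𝓡 n) x).target, P (0, z) = z := fun z hz => by
    simp only [P, chartMap, fieldFlow_zero]
    exact (extChartAt (𝓡 n) x).right_inv hz
  have hPX : ∀ z ∈ (extChartAt (𝓡 n) x).target,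
      HasDerivAt (fun r => P (r, z)) (chartField (grad h u) x z) 0 := fun z hz => by
    have h1 := hasDerivAt_chart_fieldFlow hc x _ ((extChartAt (𝓡 n) x).map_target hz)
    rwa [(extChartAt (𝓡 n) x).right_inv hz] at h1
  have key := hasDerivAt_pullback_metric (isMetricOn_gram h x) (contDiffOn_chartFun hu x)
    (hX.contDiffOn x) (fun y hy w => bil_gram_chartField_grad h hu x hy w) hy hP hP0 hPX
    (chartDeriv x x v) (chartDeriv x x w)
  have hcont : Continuous fun r => fieldFlow hc r x :=
    hflow.continuous.comp (Continuous.prodMk_left x)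
  have hev : ∀ᶠ r in nhds (0 : ℝ), fieldFlow hc r x ∈ (extChartAt (𝓡 n) x).source :=
    hcont.continuousAt.preimage_mem_nhds ((isOpen_extChartAt_source x).mem_nhds
      (by rw [fieldFlow_zero]; exact hx))
  -- For small r the orbit stays in the chart at x, the same chart in which `hess h u x` is defined.
  have heq : (fun r => h.inner (fieldFlow hc r x)
      (mfderiv (𝓡 n) (𝓡 n) (fieldFlow hc r) x v) (mfderiv (𝓡 n) (𝓡 n) (fieldFlow hc r) x w))
      =ᶠ[nhds 0] fun r => bil (gram h x (P (r, extChartAt (𝓡 n) x x)))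
        (fderiv ℝ (fun z => P (r, z)) (extChartAt (𝓡 n) x x) (chartDeriv x x v))
        (fderiv ℝ (fun z => P (r, z)) (extChartAt (𝓡 n) x x) (chartDeriv x x w)) := by
    filter_upwards [hev] with r hr
    have h1 := contMDiff_fieldFlow_time hc hX r
    have h2 := fderiv_chartMap_apply h1 hx hr
    have h3 := tensor_eq_bil h.inner hr (mfderiv (𝓡 n) (𝓡 n) (fieldFlow hc r) x v)
      (mfderiv (𝓡 n) (𝓡 n) (fieldFlow hc r) x w)
    rw [h3, ← h2, ← h2, ← chartMap_chart hx]
    rfl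
  refine (key.congr_of_eventuallyEq heq).congr_deriv ?_
  rw [hess, ofComponents_apply]

/-- By the group law the flow at time r is the flow at time r - s after that at time s, so the
time-zero formula applies at the image point to the pushed-forward vectors. -/
theorem hasDerivAt_pullback_flow (s : ℝ) (x : M) (v w : TangentSpace (𝓡 n) x) :
    HasDerivAt (fun r => h.inner (fieldFlow hc r x)
      (mfderiv (𝓡 n) (𝓡 n) (fieldFlow hc r) x v) (mfderiv (𝓡 n) (𝓡 n) (fieldFlow hc r) x w))
      (2 * hess h u (fieldFlow hc s x) (mfderiv (𝓡 n) (𝓡 n) (fieldFlow hc s) x v)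
        (mfderiv (𝓡 n) (𝓡 n) (fieldFlow hc s) x w)) s := by
  have hX := isSmoothField_grad h hu
  have h1 := hasDerivAt_pullback_flow_zero h hu hc (fieldFlow hc s x)
    (mfderiv (𝓡 n) (𝓡 n) (fieldFlow hc s) x v) (mfderiv (𝓡 n) (𝓡 n) (fieldFlow hc s) x w)
  rw [← sub_self s] at h1
  refine (HasDerivAt.comp_sub_const s s h1).congr_of_eventuallyEq
    (Filter.Eventually.of_forall fun r => ?_)
  have h2 : fieldFlow hc r = fieldFlow hc (r - s) ∘ fieldFlow hc s := funext fun z => by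
    rw [Function.comp_apply, ← fieldFlow_add hc hX, sub_add_cancel]
  have h3 := mfderiv_comp x
    ((contMDiff_fieldFlow_time hc hX (r - s) (fieldFlow hc s x)).mdifferentiableAt (by simp))
    ((contMDiff_fieldFlow_time hc hX s x).mdifferentiableAt (by simp))
  -- A generic f lets the equality of maps be substituted in the tangent space types as well.
  have h4 : ∀ f : M → M, f = fieldFlow hc (r - s) ∘ fieldFlow hc s →
      h.inner (f x) (mfderiv (𝓡 n) (𝓡 n) f x v) (mfderiv (𝓡 n) (𝓡 n) f x w) =
      h.inner (fieldFlow hc (r - s) (fieldFlow hc s x))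
        (mfderiv (𝓡 n) (𝓡 n) (fieldFlow hc (r - s)) (fieldFlow hc s x)
          (mfderiv (𝓡 n) (𝓡 n) (fieldFlow hc s) x v))
        (mfderiv (𝓡 n) (𝓡 n) (fieldFlow hc (r - s)) (fieldFlow hc s x)
          (mfderiv (𝓡 n) (𝓡 n) (fieldFlow hc s) x w)) := by
    rintro f rfl
    rw [h3]
    rfl
  exact h4 _ h2

end LieDerivative

/-! ### The time change -/

section TimeChange

variable {w c t : ℝ}

theorem isOpen_tauDomain (w c : ℝ) : IsOpen (tauDomain w c) :=
  isOpen_lt continuous_const (by fun_prop)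

theorem zero_mem_tauDomain (w c : ℝ) : (0 : ℝ) ∈ tauDomain w c := by
  simp [tauDomain]

theorem exists_Ioo_subset_tauDomain (w c : ℝ) :
    ∃ ε > 0, Set.Ioo (-ε) ε ⊆ tauDomain w c := by
  obtain ⟨ε, hε, h⟩ := Metric.isOpen_iff.1 (isOpen_tauDomain w c) 0 (zero_mem_tauDomain w c)
  refine ⟨ε, hε, ?_⟩
  rwa [Real.ball_eq_Ioo, zero_sub, zero_add] at h

theorem tau_zero (w c : ℝ) : tau w c 0 = 1 := by
  unfold tau
  split_ifs <;> simp

theorem tau_pos (ht : t ∈ tauDomain w c) : 0 < tau w c t := by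
  unfold tau
  split_ifs
  · exact Real.exp_pos _
  · exact Real.rpow_pos_of_pos ht _

/-- Both branches of `tau` agree here: for w = 2 each side is 1. Thus the time change needs no
separate case w = 2. -/
theorem tau_rpow (ht : t ∈ tauDomain w c) :
    tau w c t ^ (w / 2 - 1) = (1 - 2 * c * (1 - w / 2) * t)⁻¹ := by
  unfold tau
  split_ifs with hw
  · simp [hw]
  · have h1 : 1 - w / 2 ≠ 0 := fun h => hw (by linarith)
    rw [← Real.rpow_mul (le_of_lt ht), ← Real.rpow_neg_one]
    congr 1
    field_simp
    ring

theorem tau_mul_rpow (ht : t ∈ tauDomain w c) :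
    tau w c t * tau w c t ^ (w / 2 - 1) = tau w c t ^ (w / 2) := by
  rw [Real.rpow_sub_one (tau_pos ht).ne', mul_div_cancel₀ _ (tau_pos ht).ne']

/-- This differential equation is what the soliton equation demands of the scale factor: it cancels
the c h term. -/
theorem hasDerivAt_tau (ht : t ∈ tauDomain w c) :
    HasDerivAt (tau w c) (-2 * c * tau w c t ^ (w / 2)) t := by
  by_cases hw : w = 2
  · have h1 : tau w c = fun t => Real.exp (-2 * c * t) := funext fun t => by simp [tau, hw]
    rw [h1, hw]
    have h2 := ((hasDerivAt_id t).const_mul (-2 * c)).exp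
    refine h2.congr_deriv ?_
    simp [mul_comm]
  · have h1 : tau w c = fun t => (1 - 2 * c * (1 - w / 2) * t) ^ (1 / (1 - w / 2)) :=
      funext fun t => by simp [tau, hw]
    have hne : 1 - w / 2 ≠ 0 := fun h => hw (by linarith)
    have hpos : 0 < 1 - 2 * c * (1 - w / 2) * t := ht
    have h2 := (((hasDerivAt_id t).const_mul (2 * c * (1 - w / 2))).const_sub 1).rpow_const
      (p := 1 / (1 - w / 2)) (Or.inl hpos.ne')
    rw [← tau_mul_rpow ht, tau_rpow ht, h1]
    refine h2.congr_deriv ?_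
    simp only [id]
    rw [Real.rpow_sub_one hpos.ne']
    field_simp

/-- The primitive of `τₜ^{w/2-1}` vanishing at `0`. -/
noncomputable def flowTime (w c t : ℝ) : ℝ :=
  if 2 * c * (1 - w / 2) = 0 then t
  else -Real.log (1 - 2 * c * (1 - w / 2) * t) / (2 * c * (1 - w / 2))

theorem flowTime_zero (w c : ℝ) : flowTime w c 0 = 0 := by
  simp [flowTime]

theorem contDiffOn_flowTime (w c : ℝ) : ContDiffOn ℝ ∞ (flowTime w c) (tauDomain w c) := by
  unfold flowTime
  split_ifs
  · exact contDiffOn_id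
  · refine ContDiffOn.div_const (ContDiffOn.neg (ContDiffOn.log ?_ fun t ht => ne_of_gt ht)) _
    exact contDiffOn_const.sub (contDiffOn_const.mul contDiffOn_id)

theorem hasDerivAt_flowTime (ht : t ∈ tauDomain w c) :
    HasDerivAt (flowTime w c) (tau w c t ^ (w / 2 - 1)) t := by
  rw [tau_rpow ht]
  by_cases hk : 2 * c * (1 - w / 2) = 0
  · have h1 : flowTime w c = id := funext fun t => by simp [flowTime, hk]
    rw [h1, hk]
    simpa using hasDerivAt_id t
  · have h1 : flowTime w c = fun t =>
        -Real.log (1 - 2 * c * (1 - w / 2) * t) / (2 * c * (1 - w / 2)) :=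
      funext fun t => by rw [flowTime, if_neg hk]
    have hpos : 0 < 1 - 2 * c * (1 - w / 2) * t := ht
    have h2 := ((((hasDerivAt_id t).const_mul (2 * c * (1 - w / 2))).const_sub 1).log
      hpos.ne').neg.div_const (2 * c * (1 - w / 2))
    rw [h1]
    refine h2.congr_deriv ?_
    simp only [id]
    generalize 2 * c * (1 - w / 2) = k at *
    field_simp

end TimeChange

/-! ### The self-similar solution -/

section Solution

variable {n : ℕ} {M : Type*} [TopologicalSpace M] [ChartedSpace (Coord n) M]
  [IsManifold (𝓡 n) ∞ M]

theorem metric_ext {g g' : Metric n M} (h : ∀ x v w, g.inner x v w = g'.inner x v w) : g = g' := by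
  cases g
  cases g'
  congr 1
  exact funext fun x => ContinuousLinearMap.ext fun v => ContinuousLinearMap.ext fun w => h x v w

theorem pullMetric_apply {r : ℝ} (hr : 0 < r) (φ : M ≃ₘ⟮𝓡 n, 𝓡 n⟯ M) (h : Metric n M) (x : M)
    (v w : TangentSpace (𝓡 n) x) : (pullMetric hr φ h).inner x v w =
      r * h.inner (φ x) (mfderiv (𝓡 n) (𝓡 n) φ x v) (mfderiv (𝓡 n) (𝓡 n) φ x w) := rfl

omit [IsManifold (𝓡 n) ∞ M] in
theorem mfderiv_diffeomorph_surjective (φ : M ≃ₘ⟮𝓡 n, 𝓡 n⟯ M) (x : M)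
    (z : TangentSpace (𝓡 n) (φ x)) : ∃ v, mfderiv (𝓡 n) (𝓡 n) φ x v = z := by
  have h1 := mfderiv_comp (φ x) ((φ.contMDiff (φ.symm (φ x))).mdifferentiableAt (by simp))
    ((φ.symm.contMDiff (φ x)).mdifferentiableAt (by simp))
  have h2 : φ ∘ φ.symm = id := funext φ.apply_symm_apply
  rw [h2, mfderiv_id] at h1
  have h3 := DFunLike.congr_fun h1 z
  rw [φ.symm_apply_apply] at h3
  exact ⟨_, h3.symm⟩

/-- The new gradient need not be identified. Choose z with dφ z = ∇_h u; pairing the new gradient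
with z through the metric and through d(u ∘ φ) gives the norm up to the factor r. -/
theorem inner_grad_pullMetric {r : ℝ} (hr : 0 < r) (φ : M ≃ₘ⟮𝓡 n, 𝓡 n⟯ M) (h : Metric n M)
    {u : M → ℝ} (hu : ContMDiff (𝓡 n) 𝓘(ℝ, ℝ) ∞ u) (x : M) :
    (pullMetric hr φ h).inner x (grad (pullMetric hr φ h) (u ∘ φ) x)
      (grad (pullMetric hr φ h) (u ∘ φ) x) =
      r⁻¹ * h.inner (φ x) (grad h u (φ x)) (grad h u (φ x)) := by
  have h1 : ∀ v, mfderiv (𝓡 n) 𝓘(ℝ, ℝ) (u ∘ φ) x v =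
      h.inner (φ x) (grad h u (φ x)) (mfderiv (𝓡 n) (𝓡 n) φ x v) := fun v => by
    rw [mfderiv_comp x ((hu (φ x)).mdifferentiableAt (by simp))
      ((φ.contMDiff x).mdifferentiableAt (by simp))]
    exact (inner_grad h u (φ x) _).symm
  obtain ⟨z, hz⟩ := mfderiv_diffeomorph_surjective φ x (grad h u (φ x))
  have h2 := inner_grad (pullMetric hr φ h) (u ∘ φ) x z
  have h3 := inner_grad (pullMetric hr φ h) (u ∘ φ) x (grad (pullMetric hr φ h) (u ∘ φ) x)
  rw [h1] at h2 h3
  rw [pullMetric_apply, hz] at h2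
  rw [h3, h.symm, ← h2, inv_mul_cancel_left₀ hr.ne']

/-- Naturality handles φ^*h, and the weight handles the constant factor r. -/
theorem tensor_pullMetric {q : Metric n M → TwoTensor n M} {w : ℝ} (hq : IsNatural q)
    (hw : HasWeight w q) {r : ℝ} (hr : 0 < r) (φ : M ≃ₘ⟮𝓡 n, 𝓡 n⟯ M) (h : Metric n M) (x : M)
    (v v' : TangentSpace (𝓡 n) x) : q (pullMetric hr φ h) x v v' =
      r ^ (w / 2) * q h (φ x) (mfderiv (𝓡 n) (𝓡 n) φ x v) (mfderiv (𝓡 n) (𝓡 n) φ x v') := by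
  rw [hw r hr _ _ (isScaling_pullMetric hr φ h), ← hq φ _ _ (isPullback_pullMetric_one φ h) x v v']
  rfl

theorem hess_pullMetric {r : ℝ} (hr : 0 < r) (φ : M ≃ₘ⟮𝓡 n, 𝓡 n⟯ M) (h : Metric n M)
    {u : M → ℝ} (hu : ContMDiff (𝓡 n) 𝓘(ℝ, ℝ) ∞ u) (x : M) (v v' : TangentSpace (𝓡 n) x) :
    hess (pullMetric hr φ h) (u ∘ φ) x v v' =
      hess h u (φ x) (mfderiv (𝓡 n) (𝓡 n) φ x v) (mfderiv (𝓡 n) (𝓡 n) φ x v') := by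
  rw [hess_scaling (isScaling_pullMetric hr φ h) hr.ne',
    hess_natural (isPullback_pullMetric_one φ h) hu x v v']

open Classical in
/-- The metrics `τₜ φₜ^* h`, extended by `h` to the times outside the domain of `τ`. -/
noncomputable def solitonMetric (w c : ℝ) (φ : ℝ → (M ≃ₘ⟮𝓡 n, 𝓡 n⟯ M)) (h : Metric n M) (t : ℝ) :
    Metric n M :=
  if ht : t ∈ tauDomain w c then pullMetric (tau_pos ht) (φ t) h else h

theorem solitonMetric_of_mem {w c : ℝ} {φ : ℝ → (M ≃ₘ⟮𝓡 n, 𝓡 n⟯ M)} {h : Metric n M} {t : ℝ}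
    (ht : t ∈ tauDomain w c) :
    solitonMetric w c φ h t = pullMetric (tau_pos ht) (φ t) h := dif_pos ht

variable [T2Space M]

omit [TopologicalSpace M] [ChartedSpace (Coord n) M] [IsManifold (𝓡 n) ∞ M] [T2Space M] in
theorem smulRight_smul_eq_comp (Z : Coord n) (a : ℝ) : (1 : ℝ →L[ℝ] ℝ).smulRight (a • Z) =
    ((1 : ℝ →L[ℝ] ℝ).smulRight Z).comp (ContinuousLinearMap.toSpanSingleton ℝ a) := by
  ext
  simp

theorem generatesSelfSimilarSolution {q : Metric n M → TwoTensor n M} {w : ℝ} (hq : IsNatural q)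
    (hw : HasWeight w q) {h : Metric n M} {f₀ : M → ℝ} {c : ℝ}
    (hs : IsCompleteGradientSoliton q h f₀ c) : GeneratesSelfSimilarSolution q w h f₀ c := by
  refine ⟨exists_Ioo_subset_tauDomain w c, ?_⟩
  have hX := isSmoothField_grad h hs.smooth
  -- X_t is a time-dependent multiple of one fixed field, so its flow is a time change of the flow
  -- of ∇_h f₀. Times outside the domain still give diffeomorphisms.
  let φ : ℝ → (M ≃ₘ⟮𝓡 n, 𝓡 n⟯ M) := fun t => flowDiffeo hs.complete hX (flowTime w c t)
  have hφ0 : ∀ x, φ 0 x = x := fun x => by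
    change fieldFlow hs.complete (flowTime w c 0) x = x
    rw [flowTime_zero, fieldFlow_zero]
  have hsol : ∀ x v v', hess h f₀ x v v' = c * h.inner x v v' + 1 / 2 * q h x v v' :=
    fun x v v' => by rw [hs.equation x]; rfl
  have hφd : ∀ t ∈ tauDomain w c, ∀ x : M, HasMFDerivAt 𝓘(ℝ, ℝ) (𝓡 n) (fun s : ℝ => φ s x) t
      ((1 : ℝ →L[ℝ] ℝ).smulRight (tau w c t ^ (w / 2 - 1) • grad h f₀ (φ t x))) := fun t ht x => by
    have h1 := isMIntegralCurve_fieldFlow hs.complete x (flowTime w c t)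
    have h2 := (hasDerivAt_flowTime ht).hasFDerivAt.hasMFDerivAt
    have h3 := HasMFDerivAt.comp t h1 h2
    exact HasMFDerivAt.congr_mfderiv h3 (smulRight_smul_eq_comp (grad h f₀ (φ t x)) _).symm
  refine ⟨solitonMetric w c φ h, φ, fun t => f₀ ∘ φ t, ?_⟩
  refine
    { flow := ⟨?_, fun t ht x v v' => ?_⟩
      phi_zero := hφ0
      f_zero := funext fun x => by rw [Function.comp_apply, hφ0]
      tau_pos := fun t ht => tau_pos ht
      phi_smooth := ?_
      phi_deriv := hφd
      g_eq := fun t ht x v v' => ?_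
      f_eq := fun t _ => rfl
      hess_eq := fun t ht x => ?_
      q_eq := fun t ht x => ?_
      f_deriv := fun t ht x => ?_ }
  · rw [solitonMetric_of_mem (zero_mem_tauDomain w c)]
    refine metric_ext fun x v v' => ?_
    rw [pullMetric_apply, tau_zero, one_mul]
    have h1 : (φ 0 : M → M) = id := funext hφ0
    have h2 : ∀ f : M → M, f = id →
        h.inner (f x) (mfderiv (𝓡 n) (𝓡 n) f x v) (mfderiv (𝓡 n) (𝓡 n) f x v') =
          h.inner x v v' := by
      rintro f rfl
      rw [mfderiv_id]
      rfl
    exact h2 _ h1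
  -- Product rule for τ φ^*h: the terms -2c τ^{w/2} φ^*h and 2 τ^{w/2} φ^* Hess_h f₀ leave τ^{w/2}
  -- φ^* q(h) by the soliton equation.
  · have h1 := (hasDerivAt_pullback_flow h hs.smooth hs.complete (flowTime w c t) x v v').scomp t
      (hasDerivAt_flowTime ht)
    have h2 := (hasDerivAt_tau ht).mul h1
    rw [solitonMetric_of_mem ht, tensor_pullMetric hq hw]
    refine (h2.congr_of_eventuallyEq ?_).congr_deriv ?_
    · filter_upwards [(isOpen_tauDomain w c).mem_nhds ht] with s hs'
      rw [solitonMetric_of_mem hs', pullMetric_apply]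
      rfl
    · rw [hsol, ← tau_mul_rpow ht, Function.comp_apply, smul_eq_mul]
      have h3 : (φ t : M → M) = fieldFlow hs.complete (flowTime w c t) := rfl
      rw [h3]
      ring
  · have h1 := ((contMDiffOn_iff_contDiffOn.2 (contDiffOn_flowTime w c)).comp (t := tauDomain w c)
      (contMDiffOn_fst (I := 𝓘(ℝ, ℝ)) (J := 𝓡 n) (s := tauDomain w c ×ˢ (Set.univ : Set M)))
      fun p hp => hp.1).prodMk contMDiffOn_snd
    exact (contMDiff_fieldFlow hs.complete hX).comp_contMDiffOn h1
  · rw [solitonMetric_of_mem ht]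
    rfl
  · refine ContinuousLinearMap.ext fun v => ContinuousLinearMap.ext fun v' => ?_
    rw [solitonMetric_of_mem ht]
    simp only [add_apply, smul_apply, smul_eq_mul]
    rw [hess_pullMetric _ _ _ hs.smooth, tensor_pullMetric hq hw, hsol, pullMetric_apply,
      Real.rpow_neg (tau_pos ht).le]
    have h1 := tau_pos ht
    have h2 : 0 < tau w c t ^ (w / 2) := Real.rpow_pos_of_pos h1 _
    field_simp
  · refine ContinuousLinearMap.ext fun v => ContinuousLinearMap.ext fun v' => ?_
    rw [solitonMetric_of_mem ht]
    simp only [add_apply, smul_apply, smul_eq_mul]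
    rw [hess_pullMetric _ _ _ hs.smooth, tensor_pullMetric hq hw, hsol, pullMetric_apply]
    have h1 := tau_pos ht
    field_simp
    ring
  -- Along the flow f changes at rate τ^{w/2-1} |∇_h f₀|², and |∇f|² for g_t is τ⁻¹ times the norm
  -- for h.
  · have h1 := ((hs.smooth (φ t x)).mdifferentiableAt (by simp)).hasMFDerivAt.comp t (hφd t ht x)
    let D : TangentSpace (𝓡 n) (φ t x) →L[ℝ] ℝ := mfderiv (𝓡 n) 𝓘(ℝ, ℝ) f₀ (φ t x)
    let L : ℝ →L[ℝ] ℝ := D.comp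
      ((1 : ℝ →L[ℝ] ℝ).smulRight (tau w c t ^ (w / 2 - 1) • grad h f₀ (φ t x)))
    have h2 : HasFDerivAt (fun s => (f₀ ∘ φ s) x) L t := h1.hasFDerivAt
    refine h2.hasDerivAt.congr_deriv ?_
    have h3 : L 1 = tau w c t ^ (w / 2 - 1) * D (grad h f₀ (φ t x)) :=
      (congrArg D (one_smul ℝ _)).trans (map_smul D _ _)
    have h4 : h.inner (φ t x) (grad h f₀ (φ t x)) (grad h f₀ (φ t x)) = D (grad h f₀ (φ t x)) :=
      inner_grad h f₀ _ _
    rw [solitonMetric_of_mem ht, inner_grad_pullMetric _ _ _ hs.smooth, ← tau_mul_rpow ht, h3, h4]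
    have h5 := (tau_pos ht).ne'
    field_simp

end Solution

end SelfSimilar

theorem mainTheorem11 {n : ℕ} {M : Type*} [TopologicalSpace M] [T2Space M]
    [ChartedSpace (EuclideanSpace ℝ (Fin n)) M] [IsManifold (𝓡 n) ∞ M] :
    (∀ (q : SelfSimilar.Metric n M → SelfSimilar.TwoTensor n M) (w : ℝ),
      SelfSimilar.IsNatural q → SelfSimilar.HasWeight w q →
      ∀ (h : SelfSimilar.Metric n M) (f₀ : M → ℝ) (c : ℝ),
        SelfSimilar.IsCompleteGradientSoliton q h f₀ c →
        SelfSimilar.GeneratesSelfSimilarSolution q w h f₀ c) ∧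
    (4 ≤ n → Even n →
      ∀ (h : SelfSimilar.Metric n M) (f₀ : M → ℝ) (c : ℝ),
        SelfSimilar.IsCompleteGradientSoliton
          SelfSimilar.ambientObstructionFlowTensor h f₀ c →
        SelfSimilar.GeneratesSelfSimilarSolution
          SelfSimilar.ambientObstructionFlowTensor (2 - (n : ℝ)) h f₀ c) :=
  ⟨fun _ _ hq hw _ _ _ hs => SelfSimilar.generatesSelfSimilarSolution hq hw hs,
    fun hn he _ _ _ hs => SelfSimilar.generatesSelfSimilarSolution
      SelfSimilar.isNatural_ambientObstructionFlowTensor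
      (SelfSimilar.hasWeight_ambientObstructionFlowTensor hn he) hs⟩
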